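/- Let $M=(S,\mathcal B)$ denote a matroid on a finite ground set $S$ with base family $\mathcal B$, and for $p:S\to\mathbb R$ and $X\subseteq S$ put $p(X)=\sum_{s\in X}p(s)$. $M$ is strongly base orderable if for any $B,B'\in\mathcal B$ there is a bijection $f:B\to B'$ (an exchange bijection) such that $(B\setminus X)\cup f(X)\in\mathcal B$ for every $X\subseteq B$. Theorem. Let $M_1=(S,\mathcal B_1)$ and $M_2=(S,\mathcal B_2)$ be strongly base orderable matroids on a common finite ground set, with rank functions $r_1,r_2$. (A) If there are disjoint bases $B_1\in\mathcal B_1$, $B_2\in\mathcal B_2$ with $B_1\cup B_2=S$, then there is a price vector $p:S\to\mathbb R$ such that 1. for every $B_1\in\arg\min_{X\in\mathcal B_1}p(X)$ we have $S\setminus B_1\in\mathcal B_2$; 2. for every $B_2\in\arg\min_{X\in\mathcal B_2}p(X)$ we have $S\setminus B_2\in\mathcal B_1$. (B) There is (without the assumption on disjoint bases) a price vector $p:S\to\mathbb R$ such that 1. for every $B_1\in\arg\max_{X\subseteq S}(r_1(X)-p(X))$ and every $B_2\in\arg\max_{Y\subseteq S\setminus B_1}(r_2(Y)-p(Y))$,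 $$r_1(B_1)+r_2(B_2)=\max\{r_1(X)+r_2(Y)\mid X,Y\subseteq S,\ X\cap Y=\emptyset\};$$ 2. for every $B_2\in\arg\max_{Y\subseteq S}(r_2(Y)-p(Y))$ and every $B_1\in\arg\max_{X\subseteq S\setminus B_2}(r_1(X)-p(X))$, the same equation holds. (C) If exchange bijections can be computed in polynomial time for any pair of bases of $M_1$ and for any pair of bases of $M_2$, then a (rational) price vector as in (A), for instances satisfying its assumption, and a (rational) price vector as in (B), for all instances, can be computed in polynomial time. Here $M_1$ and $M_2$ are accessed through independence oracles and through procedures computing the exchange bijections, and the running time is the number of elementary steps of a random access machine (with addition, subtraction, comparison and memory access) plus the number of independence oracle calls plus the running times of the calls of the exchange procedures. Precisely, for each of (A) and (B) there is one program such that for every polynomial $q$ there is a polynomial $r$ with the following property: on every instance with $|S|=n$ whose exchange procedures take time at most $q(n)$ on every pair of bases, the program halts within time $r(n)$ and outputs a price vector with the required properties. -/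

import Mathlib

namespace MatroidPricing

section Pricing

variable {α : Type*}

/-- A matroid is strongly base orderable if any two bases `B`, `B'` admit a bijection `f : B → B'`
such that `(B \ X) ∪ f(X)` is a base for every `X ⊆ B`. `IsExchangeBijection M B B' f` says that
`f` (only its values on `B` matter) is such a bijection. -/
def IsExchangeBijection (M : Matroid α) (B B' : Set α) (f : α → α) : Prop :=
  Set.BijOn f B B' ∧ ∀ X, X ⊆ B → M.IsBase ((B \ X) ∪ f '' X)

def StronglyBaseOrderable (M : Matroid α) : Prop :=
  ∀ B B' : Set α, M.IsBase B → M.IsBase B' → ∃ f : α → α, IsExchangeBijection M B B' f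

/-- The price `p(X)` of a bundle. -/
def price (p : α → ℝ) (X : Finset α) : ℝ := ∑ s ∈ X, p s

/-- The rank function of a matroid (used for finite matroids, where `eRk` is finite). -/
noncomputable def rank (M : Matroid α) (X : Finset α) : ℕ := (M.eRk (X : Set α)).toNat

/-- `B` is a base of `M` of minimum price. -/
def IsCheapestBase (M : Matroid α) (p : α → ℝ) (B : Finset α) : Prop :=
  M.IsBase (B : Set α) ∧ ∀ B' : Finset α, M.IsBase (B' : Set α) → price p B ≤ price p B'

/-- The ground set is the union of two disjoint sets, a base of `M₁` and a base of `M₂`. -/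
def ComplementaryBases (M₁ M₂ : Matroid α) : Prop :=
  ∃ B₁ B₂ : Set α, M₁.IsBase B₁ ∧ M₂.IsBase B₂ ∧ Disjoint B₁ B₂ ∧ B₁ ∪ B₂ = M₁.E

/-- Whichever buyer comes first and whichever cheapest base she takes, the remaining items form a
base for the other buyer. -/
def IsBasePricing (M₁ M₂ : Matroid α) (p : α → ℝ) : Prop :=
  (∀ B₁, IsCheapestBase M₁ p B₁ → M₂.IsBase (M₁.E \ (B₁ : Set α))) ∧
  (∀ B₂, IsCheapestBase M₂ p B₂ → M₁.IsBase (M₁.E \ (B₂ : Set α)))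

/-- `X` is a utility-maximizing bundle among those contained in `T`, for the valuation given by the
rank function of `M` and the prices `p`. -/
def IsBestBundle (M : Matroid α) (p : α → ℝ) (T : Set α) (X : Finset α) : Prop :=
  (X : Set α) ⊆ T ∧
  ∀ Y : Finset α, (Y : Set α) ⊆ T → (rank M Y : ℝ) - price p Y ≤ (rank M X : ℝ) - price p X

/-- Giving `X₁` to the first buyer and `X₂` to the second one attains the maximum of
`r₁(X) + r₂(Y)` over all disjoint subsets `X`, `Y` of the ground set. -/
def IsWelfareOptimal (M₁ M₂ : Matroid α) (X₁ X₂ : Finset α) : Prop :=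
  IsGreatest {w : ℕ | ∃ X Y : Finset α, (X : Set α) ⊆ M₁.E ∧ (Y : Set α) ⊆ M₁.E ∧
    Disjoint X Y ∧ w = rank M₁ X + rank M₂ Y} (rank M₁ X₁ + rank M₂ X₂)

/-- Whichever buyer comes first, if each buyer in turn takes an arbitrary utility-maximizing bundle
among the remaining items, then the social welfare is maximized. -/
def IsRankPricing (M₁ M₂ : Matroid α) (p : α → ℝ) : Prop :=
  (∀ B₁, IsBestBundle M₁ p M₁.E B₁ → ∀ B₂, IsBestBundle M₂ p (M₁.E \ (B₁ : Set α)) B₂ →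
    IsWelfareOptimal M₁ M₂ B₁ B₂) ∧
  (∀ B₂, IsBestBundle M₂ p M₁.E B₂ → ∀ B₁, IsBestBundle M₁ p (M₁.E \ (B₂ : Set α)) B₁ →
    IsWelfareOptimal M₁ M₂ B₁ B₂)

end Pricing

section Machine

/-! A random access machine, programmed by structured (`while`) programs. Its memory is a
two-dimensional array of natural numbers. The elementary operations are addition, truncated
subtraction, comparison and (indirect) memory access; every one of them takes one time unit. There
is no multiplication, so numbers written within `t` steps have `O(t)` bits. A set of items, a
subset of `Fin n`, is represented by a row of the memory: `s` belongs to it if the `s`-th entry of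
the row is nonzero. -/

abbrev Store : Type := ℕ → ℕ → ℕ

/-- Overwrite the memory cell `(i, j)` by `v`. -/
def Store.set (σ : Store) (i j v : ℕ) : Store :=
  fun a b => if a = i ∧ b = j then v else σ a b

/-- The subset of `Fin n` represented by row `i`. -/
def Store.rowSet (σ : Store) (n i : ℕ) : Finset (Fin n) :=
  Finset.univ.filter fun s => σ i (s : ℕ) ≠ 0

/-- Overwrite the first `n` entries of row `i` by the table of `f`. -/
def Store.setRow (σ : Store) {n : ℕ} (i : ℕ) (f : Fin n → Fin n) : Store :=
  fun a b => if h : b < n then (if a = i then (f ⟨b, h⟩ : ℕ) else σ a b) else σ a b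

inductive Expr : Type
  | const (k : ℕ)
  | get (i j : Expr)
  | add (a b : Expr)
  | sub (a b : Expr)
  | lt (a b : Expr)
  | eq (a b : Expr)

def Expr.eval (σ : Store) : Expr → ℕ
  | .const k => k
  | .get i j => σ (i.eval σ) (j.eval σ)
  | .add a b => a.eval σ + b.eval σ
  | .sub a b => a.eval σ - b.eval σ
  | .lt a b => if a.eval σ < b.eval σ then 1 else 0
  | .eq a b => if a.eval σ = b.eval σ then 1 else 0

/-- The number of elementary operations needed to evaluate an expression. -/
def Expr.cost : Expr → ℕ
  | .const _ => 1
  | .get i j => i.cost + j.cost + 1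
  | .add a b => a.cost + b.cost + 1
  | .sub a b => a.cost + b.cost + 1
  | .lt a b => a.cost + b.cost + 1
  | .eq a b => a.cost + b.cost + 1

/-- Programs. `indep m r i j` asks whether the set in row `r` is independent in the matroid number
`m` and stores the answer (`1` or `0`) in cell `(i, j)`; `exch m r r' o` calls the procedure that
computes exchange bijections of the matroid number `m` on the sets in the rows `r` and `r'`, and
stores the table of the resulting function in row `o`. -/
inductive Prog : Type
  | skip
  | assign (i j e : Expr)
  | seq (c d : Prog)
  | ite (e : Expr) (c d : Prog)
  | while (e : Expr) (c : Prog)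
  | indep (m : Fin 2) (r i j : Expr)
  | exch (m : Fin 2) (r r' o : Expr)

/-- A procedure returning a map for every pair of sets of items, with its running time on each
pair. -/
structure ExchangeProcedure (n : ℕ) where
  map : Finset (Fin n) → Finset (Fin n) → Fin n → Fin n
  time : Finset (Fin n) → Finset (Fin n) → ℕ

/-- The procedure computes, within `T` time units, an exchange bijection of `M` for any pair of
bases. Nothing is required when it is called on sets that are not bases. -/
def ExchangeProcedure.ComputesWithin {n : ℕ} (F : ExchangeProcedure n) (M : Matroid (Fin n))
    (T : ℕ) : Prop :=
  ∀ B B' : Finset (Fin n), M.IsBase (B : Set (Fin n)) → M.IsBase (B' : Set (Fin n)) →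
    IsExchangeBijection M (B : Set (Fin n)) (B' : Set (Fin n)) (F.map B B') ∧ F.time B B' ≤ T

open Classical in
/-- `Exec M F c σ t σ'`: started in memory `σ`, the program `c` halts after `t` time units in
memory `σ'`. Oracle calls to the independence oracles of `M 0`, `M 1` take one time unit, calls of
the procedures `F 0`, `F 1` are charged with their running times. -/
inductive Exec {n : ℕ} (M : Fin 2 → Matroid (Fin n)) (F : Fin 2 → ExchangeProcedure n) :
    Prog → Store → ℕ → Store → Prop
  | skip (σ : Store) : Exec M F .skip σ 1 σ
  | assign (i j e : Expr) (σ : Store) :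
      Exec M F (.assign i j e) σ (i.cost + j.cost + e.cost + 1)
        (σ.set (i.eval σ) (j.eval σ) (e.eval σ))
  | seq {c d : Prog} {σ σ' σ'' : Store} {t t' : ℕ} :
      Exec M F c σ t σ' → Exec M F d σ' t' σ'' → Exec M F (.seq c d) σ (t + t') σ''
  | ite_true {e : Expr} {c d : Prog} {σ σ' : Store} {t : ℕ} :
      e.eval σ ≠ 0 → Exec M F c σ t σ' → Exec M F (.ite e c d) σ (e.cost + 1 + t) σ'
  | ite_false {e : Expr} {c d : Prog} {σ σ' : Store} {t : ℕ} :
      e.eval σ = 0 → Exec M F d σ t σ' → Exec M F (.ite e c d) σ (e.cost + 1 + t) σ'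
  | while_false {e : Expr} {c : Prog} {σ : Store} :
      e.eval σ = 0 → Exec M F (.while e c) σ (e.cost + 1) σ
  | while_true {e : Expr} {c : Prog} {σ σ' σ'' : Store} {t t' : ℕ} :
      e.eval σ ≠ 0 → Exec M F c σ t σ' → Exec M F (.while e c) σ' t' σ'' →
      Exec M F (.while e c) σ (e.cost + 1 + t + t') σ''
  | indep (m : Fin 2) (r i j : Expr) (σ : Store) :
      Exec M F (.indep m r i j) σ (r.cost + i.cost + j.cost + 1)
        (σ.set (i.eval σ) (j.eval σ)
          (if (M m).Indep (σ.rowSet n (r.eval σ) : Set (Fin n)) then 1 else 0))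
  | exch (m : Fin 2) (r r' o : Expr) (σ : Store) :
      Exec M F (.exch m r r' o) σ
        (r.cost + r'.cost + o.cost + 1 +
          (F m).time (σ.rowSet n (r.eval σ)) (σ.rowSet n (r'.eval σ)))
        (σ.setRow (o.eval σ)
          ((F m).map (σ.rowSet n (r.eval σ)) (σ.rowSet n (r'.eval σ))))

/-- The initial memory holds the number `n` of items in cell `(0, 0)` and is zero elsewhere. -/
def Store.init (n : ℕ) : Store := fun a b => if a = 0 ∧ b = 0 then n else 0

/-- The rational price vector read off from the memory: row `1` holds the numerators, row `2` the
denominators. -/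
noncomputable def Store.outputPrice (σ : Store) (n : ℕ) : Fin n → ℝ :=
  fun s => (σ 1 (s : ℕ) : ℝ) / (σ 2 (s : ℕ) : ℝ)

/-- Price vectors satisfying `Good` can be computed in polynomial time for all pairs of strongly
base orderable matroids on `n` items (labelled by `Fin n`) satisfying `Pre`, provided that exchange
bijections can be computed in polynomial time: one program works for all instances, and if
every exchange bijection takes time at most `q(n)`, for a polynomial `q`, then the total running
time is at most `r(n)`, for a polynomial `r` depending only on `q`. -/
def PolyTimePricing (Pre : ∀ n : ℕ, Matroid (Fin n) → Matroid (Fin n) → Prop)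
    (Good : ∀ n : ℕ, Matroid (Fin n) → Matroid (Fin n) → (Fin n → ℝ) → Prop) : Prop :=
  ∃ c : Prog, ∀ q : Polynomial ℕ, ∃ r : Polynomial ℕ,
    ∀ (n : ℕ) (M : Fin 2 → Matroid (Fin n)) (F : Fin 2 → ExchangeProcedure n),
      (∀ m, (M m).E = Set.univ) →
      (∀ m, StronglyBaseOrderable (M m)) →
      (∀ m, (F m).ComputesWithin (M m) (q.eval n)) →
      Pre n (M 0) (M 1) →
      ∃ (t : ℕ) (σ : Store), Exec M F c (Store.init n) t σ ∧ t ≤ r.eval n ∧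
        (∀ s : Fin n, σ 2 (s : ℕ) ≠ 0) ∧ Good n (M 0) (M 1) (σ.outputPrice n)

end Machine

end MatroidPricing

/-!
Augmenting paths, as for matroid union, yield bases `A 0`, `A 1` of `M 0`, `M 1` covering as many
items as possible; let `U = A 0 ∪ A 1`. Put `B = C = A`, and keep the invariant that `B 0`, `C 1`
and `C 0`, `B 1` cover each item as often as `A 0`, `A 1` do. Consider the graph of all exchanges
into `B 0` and into `B 1`. If it is acyclic, the number of items reachable from `s` is a potential
`k` that increases along exchanges, and the prices `k s / (n + 1)` on `U` and `2` off `U` make `B m`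
the unique cheapest base and the unique best bundle of `M m`; the other matroid then takes
`U \ B m`, which is a part of its base `C m.rev`.

If there is a closed walk, rotate `B` along a shortest one. The rotated pair and `C` are not
balanced, but exchange bijections of `M 0` and `M 1` between `B m` and `C m` form two matchings of
the elements on which they differ, and a 2-colouring of their union recombines the four bases into
a balanced quadruple with a larger symmetric difference of `B 0` and `C 0`. Hence at most `n`
rounds suffice. Prices for arbitrary finite matroids come from running this algorithm on a
labelling of the items.
-/

namespace MatroidPricing

section Exchange

variable {α : Type*} {M : Matroid α} {B B' : Set α} {f : α → α}

/-- There is an arc from `u` to `w` in the exchange graph of the base `B` of `M`: the element `u`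
can replace `w` in `B`. -/
def ExchangeArc (M : Matroid α) (B : Set α) (u w : α) : Prop :=
  u ∉ B ∧ w ∈ B ∧ M.Indep (insert u B \ {w})

theorem ExchangeArc.isBase {u w : α} (h : ExchangeArc M B u w) (hB : M.IsBase B) :
    M.IsBase (insert u B \ {w}) :=
  hB.exchange_isBase_of_indep' h.2.1 h.1 h.2.2

theorem ExchangeArc.mem_ground {u w : α} (h : ExchangeArc M B u w) : u ∈ M.E :=
  h.2.2.subset_ground ⟨Set.mem_insert u B, fun huw => h.1 (huw ▸ h.2.1)⟩

theorem exchangeArc_iff_mem_fundCircuit (hB : M.IsBase B) {u w : α} (huE : u ∈ M.E) (hu : u ∉ B) :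
    ExchangeArc M B u w ↔ w ∈ B ∧ w ∈ M.fundCircuit u B := by
  rw [hB.indep.mem_fundCircuit_iff (hB.closure_eq ▸ huE) hu]
  simp [ExchangeArc, hu]

-- The fundamental circuit of `z` avoids `x`, so it is also the one in the new base.
theorem exchangeArc_exchange_iff (hB : M.IsBase B) {x y z w : α} (hyx : ExchangeArc M B y x)
    (hz : z ∉ B) (hzy : z ≠ y) (hzx : ¬ ExchangeArc M B z x) :
    ExchangeArc M (insert y B \ {x}) z w ↔ ExchangeArc M B z w := by
  by_cases hzE : z ∈ M.E
  swap
  · exact iff_of_false (fun h => hzE h.mem_ground) (fun h => hzE h.mem_ground)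
  have hB' := hyx.isBase hB
  have hz' : z ∉ insert y B \ {x} := by simp [hz, hzy]
  have hx : x ∉ M.fundCircuit z B := fun h =>
    hzx ((exchangeArc_iff_mem_fundCircuit hB hzE hz).2 ⟨hyx.2.1, h⟩)
  have hsub : M.fundCircuit z B ⊆ insert z (insert y B \ {x}) := fun s hs =>
    (M.fundCircuit_subset_insert z B hs).imp_right
      fun h => ⟨Or.inr h, fun hsx => hx (Set.mem_singleton_iff.1 hsx ▸ hs)⟩
  have hC := (hB.fundCircuit_isCircuit hzE hz).eq_fundCircuit_of_subset hB'.indep hsub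
  rw [exchangeArc_iff_mem_fundCircuit hB' hzE hz', exchangeArc_iff_mem_fundCircuit hB hzE hz, ← hC]
  refine and_congr_left fun hw => ⟨fun h => ?_, fun h => ⟨Or.inr h, fun hwx => hx ?_⟩⟩
  · exact (M.fundCircuit_subset_insert z B hw).resolve_left fun hwz => hz' (hwz ▸ h)
  · exact Set.mem_singleton_iff.1 hwx ▸ hw

-- If `s = f y` with `y ≠ s`, then exchanging `y` for `s` would give a base properly inside `B`.
theorem IsExchangeBijection.apply_eq_self (hf : IsExchangeBijection M B B' f) {s : α}
    (hs : s ∈ B) (hs' : s ∈ B') : f s = s := by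
  obtain ⟨y, hy, rfl⟩ := hf.1.surjOn hs'
  by_contra hne
  have hB : M.IsBase B := by simpa using hf.2 ∅ (Set.empty_subset B)
  have hBy : M.IsBase (B \ {y} ∪ {f y}) := by simpa using hf.2 {y} (by simpa using hy)
  have hsub : B \ {y} ∪ {f y} ⊆ B := Set.union_subset Set.sdiff_subset (by simpa using hs)
  rw [← hBy.eq_of_subset_isBase hB hsub] at hy
  rcases hy with hy | hy
  · exact hy.2 rfl
  · exact hne (congrArg f (Set.mem_singleton_iff.1 hy).symm)

theorem IsExchangeBijection.apply_notMem (hf : IsExchangeBijection M B B' f) {s : α}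
    (hs : s ∈ B) (hs' : s ∉ B') : f s ∉ B := fun h =>
  have hfs := hf.1.mapsTo hs
  hs' (hf.1.injOn h hs (hf.apply_eq_self h hfs) ▸ hfs)

theorem IsExchangeBijection.exchangeArc (hf : IsExchangeBijection M B B' f) {s : α}
    (hs : s ∈ B) (hs' : s ∉ B') : ExchangeArc M B (f s) s := by
  refine ⟨hf.apply_notMem hs hs', hs, (hf.2 {s} (by simpa using hs)).indep.subset ?_⟩
  rintro z ⟨rfl | hz, hzs⟩
  · exact Or.inr ⟨s, rfl, rfl⟩
  · exact Or.inl ⟨hz, hzs⟩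

theorem IsExchangeBijection.isBase_inter_union_sep_symmDiff (hf : IsExchangeBijection M B B' f)
    {P : α → Prop} (hP : ∀ s ∈ B, s ∉ B' → (P (f s) ↔ ¬ P s)) :
    M.IsBase (B ∩ B' ∪ {s ∈ symmDiff B B' | P s}) := by
  convert hf.2 {s | s ∈ B ∧ s ∉ B' ∧ ¬ P s} (fun s hs => hs.1) using 1
  ext s
  simp only [Set.mem_union, Set.mem_inter_iff, Set.mem_ofPred_eq, Set.mem_symmDiff, Set.mem_sdiff,
    Set.mem_image]
  constructor
  · rintro (⟨hs, hs'⟩ | ⟨⟨hs, -⟩ | ⟨hs', hs⟩, hPs⟩)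
    · exact Or.inl ⟨hs, fun h => h.2.1 hs'⟩
    · exact Or.inl ⟨hs, fun h => h.2.2 hPs⟩
    · obtain ⟨y, hy, rfl⟩ := hf.1.surjOn hs'
      have hy' : y ∉ B' := fun h => hs ((hf.apply_eq_self hy h).symm ▸ hy)
      exact Or.inr ⟨y, ⟨hy, hy', (hP y hy hy').1 hPs⟩, rfl⟩
  · rintro (⟨hs, hPs⟩ | ⟨y, ⟨hy, hy', hPy⟩, rfl⟩)
    · by_cases hs' : s ∈ B'
      · exact Or.inl ⟨hs, hs'⟩
      · exact Or.inr ⟨Or.inl ⟨hs, hs'⟩, by tauto⟩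
    · exact Or.inr ⟨Or.inr ⟨hf.1.mapsTo hy, hf.apply_notMem hy hy'⟩, (hP y hy hy').2 hPy⟩

end Exchange

section Rank

variable {α : Type*} {M : Matroid α} {X Y : Finset α}

theorem coe_rank (M : Matroid α) (X : Finset α) : (rank M X : ℕ∞) = M.eRk (X : Set α) :=
  ENat.natCast_toNat <| ne_top_of_le_ne_top (by simp) (M.eRk_le_encard _)

theorem rank_eq_card (h : M.Indep (X : Set α)) : rank M X = X.card := by
  rw [← Nat.cast_inj (R := ℕ∞), coe_rank, h.eRk_eq_encard, Set.encard_coe_eq_coe_finsetCard]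

theorem rank_le_card (M : Matroid α) (X : Finset α) : rank M X ≤ X.card := by
  rw [← Nat.cast_le (α := ℕ∞), coe_rank, ← Set.encard_coe_eq_coe_finsetCard]
  exact M.eRk_le_encard _

theorem rank_mono (M : Matroid α) (h : X ⊆ Y) : rank M X ≤ rank M Y := by
  rw [← Nat.cast_le (α := ℕ∞), coe_rank, coe_rank]
  exact M.eRk_mono (Finset.coe_subset.2 h)

variable [DecidableEq α]

theorem rank_le_rank_inter_add_card_sdiff (M : Matroid α) (X Z : Finset α) :
    rank M X ≤ rank M (X ∩ Z) + (X \ Z).card := by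
  rw [← Nat.cast_le (α := ℕ∞), Nat.cast_add, coe_rank, coe_rank,
    ← Set.encard_coe_eq_coe_finsetCard]
  refine le_trans (M.eRk_mono ?_) (M.eRk_union_le_eRk_add_encard _ _)
  rw [← Finset.coe_union, Finset.union_comm, Finset.sdiff_union_inter]

theorem rank_le_card_inter_of_closed {B Z : Finset α} (hB : M.IsBase (B : Set α))
    (hZ : ∀ u w, ExchangeArc M B u w → u ∈ Z → w ∈ Z) : rank M Z ≤ (B ∩ Z).card := by
  have hsub : (Z : Set α) ∩ M.E ⊆ M.closure ((B ∩ Z : Finset α) : Set α) := by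
    rintro z ⟨hz, hzE⟩
    by_cases hzB : z ∈ (B : Set α)
    · exact M.mem_closure_of_mem' (by simpa using ⟨hzB, hz⟩)
    · refine M.closure_subset_closure ?_ ((hB.fundCircuit_isCircuit hzE hzB
        ).mem_closure_sdiff_singleton_of_mem (M.mem_fundCircuit z B))
      rintro w ⟨hw, hwz⟩
      have hwB : w ∈ (B : Set α) := (M.fundCircuit_subset_insert z B hw).resolve_left hwz
      rw [Finset.coe_inter]
      exact ⟨hwB, hZ z w ((exchangeArc_iff_mem_fundCircuit hB hzE hzB).2 ⟨hwB, hw⟩) hz⟩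
  rw [← Nat.cast_le (α := ℕ∞), coe_rank, ← M.eRk_inter_ground, ← Set.encard_coe_eq_coe_finsetCard]
  exact (M.eRk_mono hsub).trans ((M.eRk_closure_eq _).trans_le (M.eRk_le_encard _))

theorem rank_insert_of_indep {s : α} (hs : s ∉ X) (h : M.Indep (insert s X : Finset α)) :
    rank M (insert s X) = rank M X + 1 := by
  rw [rank_eq_card h, rank_eq_card (h.subset (by simp)), Finset.card_insert_of_notMem hs]

end Rank

section Multiplicity

variable {ι α : Type*} [Fintype ι] [DecidableEq α]

/-- The number of members of the family `B` that contain `s`. -/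
def mult (B : ι → Finset α) (s : α) : ℕ := (Finset.univ.filter fun m => s ∈ B m).card

theorem mult_eq_zero {B : ι → Finset α} {s : α} : mult B s = 0 ↔ ∀ m, s ∉ B m := by
  simp [mult, Finset.filter_eq_empty_iff]

theorem mult_le_one {B : ι → Finset α} {s : α} :
    mult B s ≤ 1 ↔ ∀ m m', s ∈ B m → s ∈ B m' → m = m' := by
  simp only [mult, Finset.card_le_one, Finset.mem_filter, Finset.mem_univ, true_and]
  exact ⟨fun h m m' hm hm' => h m hm m' hm', fun h m hm m' hm' => h m m' hm hm'⟩

theorem mult_fin_two (B : Fin 2 → Finset α) (s : α) :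
    mult B s = (if s ∈ B 0 then 1 else 0) + if s ∈ B 1 then 1 else 0 := by
  rw [mult, Finset.card_filter, Fin.sum_univ_two]

theorem mult_update_exchange [DecidableEq ι] (B : ι → Finset α) {m : ι} {x y : α} (hx : x ∈ B m)
    (hy : y ∉ B m) (s : α) :
    mult (Function.update B m ((insert y (B m)).erase x)) s + (if s = x then 1 else 0)
      = mult B s + if s = y then 1 else 0 := by
  have hxy : x ≠ y := fun h => hy (h ▸ hx)
  have hm : (if s ∈ (insert y (B m)).erase x then 1 else 0) + (if s = x then 1 else 0)
      = (if s ∈ B m then 1 else 0) + if s = y then 1 else 0 := by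
    by_cases hsx : s = x
    · subst hsx; simp [hx, hxy]
    · by_cases hsy : s = y
      · subst hsy; simp [hy, hsx]
      · simp [hsx, hsy]
  have hrest : ∑ i ∈ Finset.univ.erase m,
      (if s ∈ Function.update B m ((insert y (B m)).erase x) i then 1 else 0)
      = ∑ i ∈ Finset.univ.erase m, if s ∈ B i then 1 else 0 :=
    Finset.sum_congr rfl fun i hi => by rw [Function.update_of_ne (Finset.ne_of_mem_erase hi)]
  simp only [mult, Finset.card_filter]
  rw [← Finset.add_sum_erase _ _ (Finset.mem_univ m), hrest, Function.update_self,
    ← Finset.add_sum_erase _ _ (Finset.mem_univ m)]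
  omega

/-- The union of the sets `B m` is as large as the total rank of disjoint sets can be. -/
def IsCovering (M : ι → Matroid α) (B : ι → Finset α) : Prop :=
  ∀ X : ι → Finset α, Pairwise (Function.onFun Disjoint X) →
    ∑ m, rank (M m) (X m) ≤ (Finset.univ.biUnion B).card

variable {M : ι → Matroid α} {B : ι → Finset α}

-- Split every `X m` into its parts inside and outside `Z`.
theorem isCovering_of_closed
    (hB : ∀ m, (M m).IsBase (B m : Set α)) {Z : Finset α}
    (hZ : ∀ m u w, ExchangeArc (M m) (B m) u w → u ∈ Z → w ∈ Z)
    (hZ₀ : ∀ s, mult B s = 0 → s ∈ Z) (hZ₁ : ∀ s ∈ Z, mult B s ≤ 1) : IsCovering M B := by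
  intro X hX
  have hrank : ∀ m, rank (M m) (X m) ≤ (B m ∩ Z).card + (X m \ Z).card := fun m =>
    (rank_le_rank_inter_add_card_sdiff (M m) (X m) Z).trans <| Nat.add_le_add_right
      ((rank_mono _ Finset.inter_subset_right).trans (rank_le_card_inter_of_closed (hB m) (hZ m))) _
  have hin : ∑ m, (B m ∩ Z).card = (Finset.univ.biUnion B ∩ Z).card := by
    rw [Finset.biUnion_inter, Finset.card_biUnion]
    refine fun i _ j _ hij => Finset.disjoint_left.2 fun s hi hj => hij ?_
    rw [Finset.mem_inter] at hi hj
    exact mult_le_one.1 (hZ₁ s hi.2) i j hi.1 hj.1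
  have hout : ∑ m, (X m \ Z).card ≤ (Finset.univ.biUnion B \ Z).card := by
    rw [← Finset.card_biUnion fun i _ j _ hij =>
      (hX hij).mono Finset.sdiff_subset Finset.sdiff_subset]
    refine Finset.card_le_card fun s hs => ?_
    obtain ⟨m, -, hs⟩ := Finset.mem_biUnion.1 hs
    obtain ⟨m', hm'⟩ := not_forall_not.1 fun h =>
      (Finset.mem_sdiff.1 hs).2 (hZ₀ s (mult_eq_zero.2 h))
    exact Finset.mem_sdiff.2
      ⟨Finset.mem_biUnion.2 ⟨m', Finset.mem_univ m', hm'⟩, (Finset.mem_sdiff.1 hs).2⟩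
  calc ∑ m, rank (M m) (X m) ≤ ∑ m, (B m ∩ Z).card + ∑ m, (X m \ Z).card :=
        (Finset.sum_le_sum fun m _ => hrank m).trans Finset.sum_add_distrib.le
    _ ≤ (Finset.univ.biUnion B ∩ Z).card + (Finset.univ.biUnion B \ Z).card :=
        Nat.add_le_add hin.le hout
    _ = (Finset.univ.biUnion B).card := Finset.card_inter_add_card_sdiff _ _

theorem isCovering_of_card_univ_le [Fintype α]
    (h : Fintype.card α ≤ (Finset.univ.biUnion B).card) : IsCovering M B := fun X hX =>
  calc ∑ m, rank (M m) (X m) ≤ ∑ m, (X m).card := Finset.sum_le_sum fun _ _ => rank_le_card _ _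
    _ = (Finset.univ.biUnion X).card := (Finset.card_biUnion fun _ _ _ _ hij => hX hij).symm
    _ ≤ (Finset.univ.biUnion B).card := (Finset.card_le_univ _).trans h

theorem IsCovering.mono (h : IsCovering M B) {B' : ι → Finset α}
    (hB : (Finset.univ.biUnion B).card ≤ (Finset.univ.biUnion B').card) : IsCovering M B' :=
  fun X hX => (h X hX).trans hB

end Multiplicity

section BestBundle

variable {α : Type*} {M : Matroid α} {p : α → ℝ} {T : Set α} {X : Finset α}

theorem IsBestBundle.price_le_one (h : IsBestBundle M p T X) {s : α} (hs : s ∈ X) : p s ≤ 1 := by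
  classical
  have hbest := h.2 (X.erase s) fun t ht => h.1 (Finset.mem_of_mem_erase ht)
  have hrank : rank M X ≤ rank M (X.erase s) + 1 := by
    simpa [Finset.inter_eq_right.2 (Finset.erase_subset _ _), Finset.sdiff_erase hs] using
      rank_le_rank_inter_add_card_sdiff M X (X.erase s)
  have hprice : price p X = p s + price p (X.erase s) := (Finset.add_sum_erase _ _ hs).symm
  have hrank' : (rank M X : ℝ) ≤ rank M (X.erase s) + 1 := by exact_mod_cast hrank
  linarith

theorem IsBestBundle.not_indep_insert [DecidableEq α] (h : IsBestBundle M p T X) {s : α}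
    (hs : p s < 1) (hsT : s ∈ T) (hsX : s ∉ X) : ¬ M.Indep (insert s X : Finset α) := by
  intro hI
  have hbest := h.2 (insert s X) (by
    rw [Finset.coe_insert]; exact Set.insert_subset hsT h.1)
  have hprice : price p (insert s X) = p s + price p X := Finset.sum_insert hsX
  rw [rank_insert_of_indep hsX hI, hprice] at hbest
  push_cast at hbest
  linarith

theorem IsBestBundle.indep (h : IsBestBundle M p T X) (hp : ∀ s ∈ X, 0 < p s) :
    M.Indep (X : Set α) := by
  obtain ⟨I, hI⟩ := M.exists_isBasis' (X : Set α)
  lift I to Finset α using X.finite_toSet.subset hI.subset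
  have hIX : I ⊆ X := Finset.coe_subset.1 hI.subset
  have hrank : rank M I = rank M X := by
    rw [← Nat.cast_inj (R := ℕ∞), coe_rank, coe_rank, hI.eRk_eq_eRk]
  have hbest := h.2 I (hI.subset.trans h.1)
  suffices I = X from this ▸ hI.indep
  by_contra hne
  obtain ⟨s, hs, hs'⟩ := Finset.exists_of_ssubset (hIX.ssubset_of_ne hne)
  have hprice : price p I < price p X :=
    Finset.sum_lt_sum_of_subset hIX hs hs' (hp s hs) fun t ht _ => (hp t ht).le
  rw [hrank] at hbest
  linarith

theorem IsBestBundle.eq_of_indep {J : Finset α} (hJT : (J : Set α) ⊆ T) (hJ : M.Indep (J : Set α))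
    (hlt : ∀ s ∈ J, p s < 1) (hgt : ∀ s ∈ T, s ∉ J → 1 < p s) (h : IsBestBundle M p T X) :
    X = J := by
  classical
  have hXJ : X ⊆ J := fun s hs => by
    by_contra hsJ
    exact (hgt s (h.1 hs) hsJ).not_ge (h.price_le_one hs)
  refine hXJ.antisymm fun s hs => ?_
  by_contra hsX
  exact h.not_indep_insert (hlt s hs) (hJT hs) hsX
    (hJ.subset (Finset.coe_subset.2 (Finset.insert_subset hs hXJ)))

-- An exchange bijection from `B` to `X` moves only along exchange arcs.
theorem price_lt_of_exchangeArc (hM : StronglyBaseOrderable M) {B : Finset α}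
    (hB : M.IsBase (B : Set α)) (hX : M.IsBase (X : Set α))
    (hp : ∀ u ∈ X, ∀ w, ExchangeArc M B u w → p w < p u) (hne : X ≠ B) :
    price p B < price p X := by
  obtain ⟨f, hf⟩ := hM B X hB hX
  have hsum : ∑ s ∈ B, p (f s) = price p X :=
    Finset.sum_nbij f (fun _ hs => hf.1.mapsTo hs) hf.1.injOn hf.1.surjOn fun _ _ => rfl
  have hlt : ∀ s ∈ B, s ∉ X → p s < p (f s) := fun s hs hs' =>
    hp _ (hf.1.mapsTo hs) _ (hf.exchangeArc hs hs')
  obtain ⟨s, hs, hs'⟩ : ∃ s ∈ B, s ∉ X := by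
    by_contra! h
    exact hne (Finset.coe_injective (hB.eq_of_subset_isBase hX h).symm)
  rw [← hsum]
  refine Finset.sum_lt_sum (fun t ht => ?_) ⟨s, hs, hlt s hs hs'⟩
  by_cases ht' : t ∈ X
  · rw [hf.apply_eq_self ht ht']
  · exact (hlt t ht ht').le

theorem IsBestBundle.eq_of_isBase (hM : StronglyBaseOrderable M) {B U : Finset α}
    (hB : M.IsBase (B : Set α)) (hBU : B ⊆ U) (hBT : (B : Set α) ⊆ T) (hpos : ∀ s ∈ U, 0 < p s)
    (hlt : ∀ s ∈ U, p s < 1) (hgt : ∀ s ∉ U, 1 < p s)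
    (harc : ∀ u ∈ U, ∀ w, ExchangeArc M B u w → p w < p u) (h : IsBestBundle M p T X) : X = B := by
  classical
  have hXU : X ⊆ U := fun s hs => by
    by_contra hsU
    exact (hgt s hsU).not_ge (h.price_le_one hs)
  have hXI := h.indep fun s hs => hpos s (hXU hs)
  have hXB : M.IsBase (X : Set α) := by
    by_contra hX
    obtain ⟨e, he, hI⟩ := hXI.exists_insert_of_not_isBase hX hB
    exact h.not_indep_insert (hlt e (hBU he.1)) (hBT he.1) he.2 (by simpa using hI)
  by_contra hne
  have hprice := price_lt_of_exchangeArc hM hB hXB (fun u hu => harc u (hXU hu)) hne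
  have hbest := h.2 B hBT
  have hrank : rank M B = rank M X := by
    rw [← Nat.cast_inj (R := ℕ∞), coe_rank, coe_rank, hB.eRk_eq_eRank, hXB.eRk_eq_eRank]
  rw [hrank] at hbest
  linarith

end BestBundle

section Certificate

variable {α : Type*} [DecidableEq α] {M : Fin 2 → Matroid α} {B C : Fin 2 → Finset α}
  {U : Finset α} {p : α → ℝ}

/-- A combinatorial certificate that the prices `p` are good: `U` is a set of maximum welfare,
covered both by the bases `B 0`, `C 1` and by the bases `C 0`, `B 1`, and `p` separates `U` from the
other items and increases along all exchanges into `B 0` and `B 1`. The index of the other matroid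
is `m.rev`. -/
structure IsPricingCertificate (M : Fin 2 → Matroid α) (B C : Fin 2 → Finset α) (U : Finset α)
    (p : α → ℝ) : Prop where
  isBase_left : ∀ m, (M m).IsBase (B m : Set α)
  isBase_right : ∀ m, (M m).IsBase (C m : Set α)
  union_eq : ∀ m, B m ∪ C m.rev = U
  welfare_le : ∀ X Y : Finset α, Disjoint X Y → rank (M 0) X + rank (M 1) Y ≤ U.card
  pos : ∀ s ∈ U, 0 < p s
  lt_one : ∀ s ∈ U, p s < 1
  one_lt : ∀ s ∉ U, 1 < p s
  lt_of_exchangeArc : ∀ m, ∀ u ∈ U, ∀ w, ExchangeArc (M m) (B m) u w → p w < p u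

namespace IsPricingCertificate

variable (h : IsPricingCertificate M B C U p)

include h

theorem base_subset (m : Fin 2) : B m ⊆ U := h.union_eq m ▸ Finset.subset_union_left

theorem indep_sdiff (m : Fin 2) : (M m.rev).Indep ((U \ B m : Finset α) : Set α) :=
  (h.isBase_right m.rev).indep.subset <| Finset.coe_subset.2 <| by
    rw [← h.union_eq m, Finset.union_sdiff_left]
    exact Finset.sdiff_subset

theorem isWelfareOptimal {X Y : Finset α} (hE : (M 0).E = (M 1).E)
    (hX : (M 0).Indep (X : Set α)) (hY : (M 1).Indep (Y : Set α)) (hXY : Disjoint X Y)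
    (hU : X ∪ Y = U) : IsWelfareOptimal (M 0) (M 1) X Y := by
  refine ⟨⟨X, Y, hX.subset_ground, hE ▸ hY.subset_ground, hXY, rfl⟩, ?_⟩
  rintro w ⟨X', Y', -, -, hXY', rfl⟩
  rw [rank_eq_card hX, rank_eq_card hY, ← Finset.card_union_of_disjoint hXY, hU]
  exact h.welfare_le X' Y' hXY'

theorem bestBundle_eq (hM : ∀ m, StronglyBaseOrderable (M m)) {m : Fin 2} {T : Set α}
    (hT : T = (M m).E) {X : Finset α} (hX : IsBestBundle (M m) p T X) : X = B m :=
  hX.eq_of_isBase (hM m) (h.isBase_left m) (h.base_subset m)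
    (hT ▸ (h.isBase_left m).subset_ground) h.pos h.lt_one h.one_lt (h.lt_of_exchangeArc m)

theorem bestBundle_sdiff_eq {m : Fin 2} {T : Set α} (hT : T = (M m.rev).E) {Y : Finset α}
    (hY : IsBestBundle (M m.rev) p (T \ (B m : Set α)) Y) : Y = U \ B m := by
  have hsub : ((U \ B m : Finset α) : Set α) ⊆ T \ B m := fun s hs =>
    ⟨hT ▸ (h.indep_sdiff m).subset_ground hs, (Finset.mem_sdiff.1 (Finset.mem_coe.1 hs)).2⟩
  exact hY.eq_of_indep hsub (h.indep_sdiff m)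
    (fun s hs => h.lt_one s (Finset.mem_sdiff.1 hs).1)
    fun s hs hs' => h.one_lt s fun hsU => hs' (Finset.mem_sdiff.2 ⟨hsU, hs.2⟩)

theorem isRankPricing (hE : (M 0).E = (M 1).E) (hM : ∀ m, StronglyBaseOrderable (M m)) :
    IsRankPricing (M 0) (M 1) p := by
  refine ⟨fun X hX Y hY => ?_, fun Y hY X hX => ?_⟩
  · obtain rfl := h.bestBundle_eq hM rfl hX
    obtain rfl := h.bestBundle_sdiff_eq (m := 0) hE hY
    exact h.isWelfareOptimal hE (h.isBase_left 0).indep (h.indep_sdiff 0) Finset.disjoint_sdiff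
      (Finset.union_sdiff_of_subset (h.base_subset 0))
  · obtain rfl := h.bestBundle_eq hM hE hY
    obtain rfl := h.bestBundle_sdiff_eq (m := 1) rfl hX
    exact h.isWelfareOptimal hE (h.indep_sdiff 1) (h.isBase_left 1).indep Finset.sdiff_disjoint
      (Finset.sdiff_union_of_subset (h.base_subset 1))

theorem cheapestBase_eq (hM : ∀ m, StronglyBaseOrderable (M m)) {m : Fin 2}
    (hU : (U : Set α) = (M m).E) {X : Finset α} (hX : IsCheapestBase (M m) p X) : X = B m := by
  by_contra hne
  have hsub : X ⊆ U := Finset.coe_subset.1 (hU ▸ hX.1.subset_ground)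
  exact (hX.2 _ (h.isBase_left m)).not_gt <| price_lt_of_exchangeArc (hM m) (h.isBase_left m) hX.1
    (fun u hu => h.lt_of_exchangeArc m u (hsub hu)) hne

theorem disjoint_of_card_eq {A : Fin 2 → Finset α} (hA : ∀ m, (M m).IsBase (A m : Set α))
    (hU : (A 0).card + (A 1).card = U.card) (m : Fin 2) : Disjoint (B m) (C m.rev) := by
  have hcard : ∀ m (X Y : Finset α), (M m).IsBase (X : Set α) → (M m).IsBase (Y : Set α) →
      X.card = Y.card := fun m X Y hX hY => by
    simpa using hX.encard_eq_encard_of_isBase hY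
  rw [← Finset.card_union_eq_card_add_card, h.union_eq, ← hU,
    hcard m _ _ (h.isBase_left m) (hA m), hcard _ _ _ (h.isBase_right m.rev) (hA m.rev)]
  fin_cases m
  · rfl
  · exact add_comm _ _

theorem subset_ground (hE : (M 0).E = (M 1).E) (m : Fin 2) : (U : Set α) ⊆ (M m).E := by
  have hE' : (M m.rev).E = (M m).E := by fin_cases m <;> simp [hE]
  rw [← h.union_eq m, Finset.coe_union]
  exact Set.union_subset (h.isBase_left m).subset_ground
    (hE' ▸ (h.isBase_right m.rev).subset_ground)

theorem eq_union_of_isBase (hE : (M 0).E = (M 1).E) {A : Fin 2 → Finset α}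
    (hA : ∀ m, (M m).IsBase (A m : Set α)) (hdisj : Disjoint (A 0) (A 1))
    (hcover : ((A 0 ∪ A 1 : Finset α) : Set α) = (M 0).E) : U = A 0 ∪ A 1 := by
  refine Finset.eq_of_subset_of_card_le
    (Finset.coe_subset.1 (hcover ▸ h.subset_ground hE 0)) ?_
  rw [Finset.card_union_of_disjoint hdisj, ← rank_eq_card (hA 0).indep,
    ← rank_eq_card (hA 1).indep]
  exact h.welfare_le _ _ hdisj

theorem isBasePricing (hE : (M 0).E = (M 1).E) (hM : ∀ m, StronglyBaseOrderable (M m))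
    (hc : ComplementaryBases (M 0) (M 1)) : IsBasePricing (M 0) (M 1) p := by
  obtain ⟨A₀, A₁, hA₀, hA₁, hdisj, hcover⟩ := hc
  lift A₀ to Finset α using (h.isBase_left 0).finite_of_finite (B 0).finite_toSet hA₀
  lift A₁ to Finset α using (h.isBase_left 1).finite_of_finite (B 1).finite_toSet hA₁
  have hA : ∀ m, (M m).IsBase (![A₀, A₁] m : Set α) := Fin.forall_fin_two.2 ⟨hA₀, hA₁⟩
  have hdisj' : Disjoint A₀ A₁ := Finset.disjoint_coe.1 hdisj
  have hU : U = A₀ ∪ A₁ := h.eq_union_of_isBase hE hA hdisj' (by simpa using hcover)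
  have hcard : A₀.card + A₁.card = U.card := by rw [hU, Finset.card_union_of_disjoint hdisj']
  have hUE : ∀ m, (U : Set α) = (M m).E :=
    Fin.forall_fin_two.2 ⟨by simpa [hU] using hcover, by simpa [hU, ← hE] using hcover⟩
  have hcompl : ∀ m X, IsCheapestBase (M m) p X → (M m.rev).IsBase ((M m.rev).E \ X) := by
    intro m X hX
    rw [h.cheapestBase_eq hM (hUE m) hX, ← hUE, ← Finset.coe_sdiff, ← h.union_eq m,
      Finset.union_sdiff_cancel_left (h.disjoint_of_card_eq hA hcard m)]
    exact h.isBase_right m.rev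
  exact ⟨fun X hX => by simpa [hE] using hcompl 0 X hX,
    fun X hX => by simpa [hE] using hcompl 1 X hX⟩

end IsPricingCertificate

end Certificate

section Distance

variable {V : Type*} [Fintype V] {adj : V → V → Prop} {src : Finset V} {d : V → ℕ}

/-- `d` is the distance from the set `src` in the digraph `adj`. Vertices that cannot be reached
from `src` have a distance greater than the number of vertices. -/
structure IsDist (adj : V → V → Prop) (src : Finset V) (d : V → ℕ) : Prop where
  zero : ∀ s, d s = 0 ↔ s ∈ src
  pred : ∀ w k, d w = k + 1 → k < Fintype.card V → ∃ y, d y = k ∧ adj y w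
  step : ∀ y w, adj y w → d y < Fintype.card V → d w ≤ d y + 1

/-- The vertices at a finite distance, when `d` is a distance in the sense of `IsDist`. -/
def reached (d : V → ℕ) : Finset V := {x | d x ≤ Fintype.card V}

@[simp] theorem mem_reached {x : V} : x ∈ reached d ↔ d x ≤ Fintype.card V := by simp [reached]

namespace IsDist

theorem subset_reached (h : IsDist adj src d) : src ⊆ reached d := fun s hs => by
  simp [(h.zero s).2 hs]

theorem exists_eq (h : IsDist adj src d) {w : V} (hw : w ∈ reached d) {k : ℕ} (hk : k ≤ d w) :
    ∃ y, d y = k := by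
  induction hk using Nat.decreasingInduction with
  | self => exact ⟨w, rfl⟩
  | of_succ k hk ih =>
    obtain ⟨y, hy⟩ := ih
    obtain ⟨z, hz, -⟩ := h.pred y k hy (hk.trans_le (mem_reached.1 hw))
    exact ⟨z, hz⟩

-- All numbers up to the distance of a reached vertex are distances.
theorem lt_card (h : IsDist adj src d) {w : V} (hw : w ∈ reached d) : d w < Fintype.card V := by
  have hsub : Finset.range (d w + 1) ⊆ Finset.univ.image d := fun k hk => by
    obtain ⟨y, hy⟩ := h.exists_eq hw (Finset.mem_range_succ_iff.1 hk)
    exact Finset.mem_image.2 ⟨y, Finset.mem_univ y, hy⟩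
  simpa using (Finset.card_le_card hsub).trans Finset.card_image_le

theorem exists_pred (h : IsDist adj src d) {w : V} (hw : w ∈ reached d) (hsrc : w ∉ src) :
    ∃ y ∈ reached d, adj y w := by
  obtain ⟨k, hk⟩ := Nat.exists_eq_add_one_of_ne_zero fun h0 => hsrc ((h.zero w).1 h0)
  have hlt := h.lt_card hw
  obtain ⟨y, hy, hyw⟩ := h.pred w k hk (by omega)
  exact ⟨y, mem_reached.2 (by omega), hyw⟩

theorem mem_reached_of_adj (h : IsDist adj src d) {y w : V} (hyw : adj y w) (hy : y ∈ reached d) :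
    w ∈ reached d :=
  mem_reached.2 ((h.step y w hyw (h.lt_card hy)).trans (h.lt_card hy))

theorem reached_induction (h : IsDist adj src d) {P : V → Prop} (src_mem : ∀ s ∈ src, P s)
    (step : ∀ y w, adj y w → P y → P w) {w : V} (hw : w ∈ reached d) : P w := by
  induction hk : d w generalizing w with
  | zero => exact src_mem w ((h.zero w).1 hk)
  | succ k ih =>
    have hlt := h.lt_card hw
    obtain ⟨y, hy, hyw⟩ := h.pred w k hk (by omega)
    exact step y w hyw (ih (mem_reached.2 (by omega)) hy)

end IsDist

/-- `d` is the distance from the set `src` in the digraph `adj` as far as it is at most `l`. All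
other vertices have the value `Fintype.card V + 1`. -/
structure IsPartialDist (adj : V → V → Prop) (src : Finset V) (l : ℕ) (d : V → ℕ) : Prop where
  zero : ∀ s, d s = 0 ↔ s ∈ src
  le : ∀ s, d s ≤ l ∨ d s = Fintype.card V + 1
  pred : ∀ w k, d w = k + 1 → k < Fintype.card V → ∃ y, d y = k ∧ adj y w
  step : ∀ y w, adj y w → d y < l → d w ≤ d y + 1

theorem IsPartialDist.isDist (h : IsPartialDist adj src (Fintype.card V) d) : IsDist adj src d :=
  ⟨h.zero, h.pred, h.step⟩

theorem isPartialDist_zero (h₀ : ∀ s ∈ src, d s = 0)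
    (h₁ : ∀ s ∉ src, d s = Fintype.card V + 1) : IsPartialDist adj src 0 d := by
  refine ⟨fun s => ?_, fun s => ?_, fun w k hw hk => ?_, by simp⟩ <;> by_cases hs : ‹V› ∈ src
  all_goals grind

open scoped Classical in
theorem IsPartialDist.relax {l : ℕ} (h : IsPartialDist adj src l d) (hl : l < Fintype.card V)
    {d' : V → ℕ} (hd' : ∀ w, d' w =
      if d w = Fintype.card V + 1 ∧ ∃ y, d y = l ∧ adj y w then l + 1 else d w) :
    IsPartialDist adj src (l + 1) d' := by
  have old : ∀ w, d w ≤ l → d' w = d w := fun w hw => by rw [hd' w, if_neg (by omega)]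
  refine ⟨fun s => ?_, fun s => ?_, fun w k hw hk => ?_, fun y w hyw hy => ?_⟩
  · rw [← h.zero s, hd' s]
    split_ifs with hnew
    exacts [by simp [hnew.1], Iff.rfl]
  · rw [hd' s]
    split_ifs
    exacts [.inl le_rfl, (h.le s).imp_left (by omega)]
  · obtain ⟨y, hy, hyw⟩ : ∃ y, d y = k ∧ adj y w := by
      rw [hd' w] at hw
      split_ifs at hw with hnew
      · obtain rfl : l = k := by omega
        exact hnew.2
      · exact h.pred w k hw hk
    exact ⟨y, by rw [old y (by grind [h.le w, h.le y]), hy], hyw⟩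
  · have hyl : d y ≤ l := by
      rw [hd' y] at hy
      split_ifs at hy <;> omega
    rw [old y hyl, hd' w]
    obtain hlt | heq := hyl.lt_or_eq
    · have := h.step y w hyw hlt
      split_ifs <;> omega
    · split_ifs with hnew
      · omega
      · have := (h.le w).resolve_right fun hw => hnew ⟨hw, y, heq, hyw⟩
        omega

/-- The vertex `v` lies on no closed walk, and `k` vertices can be reached from it. -/
def IsAcyclicAt (adj : V → V → Prop) (v : V) (k : ℕ) : Prop :=
  ∃ d, IsDist adj {v} d ∧ (∀ y, adj y v → y ∉ reached d) ∧ k = (reached d).card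

/-- The positive numbers `k`, at most the number of vertices, decrease along the arcs. -/
structure IsPotential (adj : V → V → Prop) (k : V → ℕ) : Prop where
  lt : ∀ u w, adj u w → k w < k u
  pos : ∀ v, 0 < k v
  le_card : ∀ v, k v ≤ Fintype.card V

-- Everything reached from the head of an arc is reached from its tail, but the tail is not
-- reached from the head.
theorem card_reached_lt {d : V → V → ℕ} (hd : ∀ v, IsDist adj {v} (d v))
    (hcyc : ∀ v y, adj y v → y ∉ reached (d v)) {u w : V} (huw : adj u w) :
    (reached (d w)).card < (reached (d u)).card := by
  have hself : ∀ v, v ∈ reached (d v) := fun v =>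
    (hd v).subset_reached (Finset.mem_singleton_self v)
  have hw : w ∈ reached (d u) := (hd u).mem_reached_of_adj huw (hself u)
  have hsub : reached (d w) ⊆ reached (d u) := fun x hx =>
    (hd w).reached_induction (P := (· ∈ reached (d u)))
      (fun s hs => Finset.mem_singleton.1 hs ▸ hw)
      (fun _ _ hyz => (hd u).mem_reached_of_adj hyz) hx
  refine Finset.card_lt_card ((Finset.ssubset_iff_of_subset hsub).2 ⟨u, hself u, fun hu => ?_⟩)
  by_cases huw' : u = w
  · exact hcyc w u huw (huw' ▸ hself u)
  · obtain ⟨y, hy, hyu⟩ := (hd w).exists_pred hu (by simpa using huw')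
    exact hcyc u y hyu (hsub hy)

theorem isPotential_of_isAcyclicAt {k : V → ℕ} (h : ∀ v, IsAcyclicAt adj v (k v)) :
    IsPotential adj k := by
  choose d hd hcyc hk using h
  refine ⟨fun u w huw => ?_, fun v => ?_, fun v => ?_⟩
  · rw [hk, hk]
    exact card_reached_lt hd hcyc huw
  · rw [hk, Finset.card_pos]
    exact ⟨v, (hd v).subset_reached (Finset.mem_singleton_self v)⟩
  · exact hk v ▸ Finset.card_le_univ _

theorem IsPotential.notMem_reached {k : V → ℕ} (h : IsPotential adj k) {v y : V}
    (hd : IsDist adj {v} d) (hyv : adj y v) : y ∉ reached d := fun hy => by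
  have hle : k y ≤ k v := hd.reached_induction (P := (k · ≤ k v))
    (fun s hs => (congrArg k (Finset.mem_singleton.1 hs)).le)
    (fun y z hyz hle => (h.lt y z hyz).le.trans hle) hy
  exact hle.not_gt (h.lt y v hyv)

end Distance

section Walk

variable {ι α : Type*} [Fintype ι] [DecidableEq α] {M : ι → Matroid α} {B₀ B : ι → Finset α}
  {d : α → ℕ} {x₀ cur : α} {L : ℕ}

/-- The exchange graph of a family of bases. -/
def ExchangeAdj (M : ι → Matroid α) (B : ι → Finset α) (u w : α) : Prop :=
  ∃ m, ExchangeArc (M m) (B m) u w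

/-- The situation when a shortest walk of length `L` ending in `x₀` has been followed backwards from
`x₀` to `cur`, which is at distance `rem` from the sources, and the exchanges along it have turned
the bases `B₀` into `B`. -/
structure WalkInvariant (M : ι → Matroid α) (B₀ : ι → Finset α) (d : α → ℕ) (x₀ : α) (L : ℕ)
    (B : ι → Finset α) (cur : α) (rem : ℕ) : Prop where
  isBase : ∀ m, (M m).IsBase (B m : Set α)
  notMem : ∀ m y, y ∉ B₀ m → d y < rem → y ∉ B m
  arc_iff : ∀ m y, y ∉ B₀ m → d y < rem →
    ∀ w, ExchangeArc (M m) (B m) y w ↔ ExchangeArc (M m) (B₀ m) y w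
  le_dist : ∀ y, ExchangeAdj M B₀ y cur → rem ≤ d y + 1
  mult_eq : ∀ s, mult B s + (if s = x₀ then 1 else 0) = mult B₀ s + if s = cur then 1 else 0
  moved : (rem = L ∧ cur = x₀) ∨ ∃ m, x₀ ∈ B₀ m ∧ x₀ ∉ B m

theorem WalkInvariant.init (hB : ∀ m, (M m).IsBase (B₀ m : Set α))
    (hL : ∀ y, ExchangeAdj M B₀ y x₀ → L ≤ d y + 1) : WalkInvariant M B₀ d x₀ L B₀ x₀ L :=
  ⟨hB, fun _ _ h _ => h, fun _ _ _ _ _ => Iff.rfl, hL, fun _ => rfl, Or.inl ⟨rfl, rfl⟩⟩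

-- As the walk is shortest, no vertex nearer to the sources has an arc to `cur`, so the exchange
-- leaves the arcs from these vertices unchanged.
theorem WalkInvariant.arc_iff_update [DecidableEq ι] {k : ℕ}
    (h : WalkInvariant M B₀ d x₀ L B cur (k + 1)) {m : ι} {y : α} (hy : d y = k)
    (harc : ExchangeArc (M m) (B m) y cur) (m' : ι) {z : α} (hz : z ∉ B₀ m') (hdz : d z < k)
    (w : α) :
    ExchangeArc (M m') (Function.update B m ((insert y (B m)).erase cur) m') z w
      ↔ ExchangeArc (M m') (B₀ m') z w := by
  have hiff := h.arc_iff m' z hz (by omega)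
  by_cases hm : m' = m
  · subst hm
    have hzy : z ≠ y := by rintro rfl; omega
    have hzc : ¬ ExchangeArc (M m') (B m') z cur := fun hzc => by
      have := h.le_dist z ⟨m', (hiff cur).1 hzc⟩
      omega
    rw [Function.update_self, Finset.coe_erase, Finset.coe_insert,
      exchangeArc_exchange_iff (h.isBase m') harc (h.notMem m' z hz (by omega)) hzy hzc, hiff]
  · rw [Function.update_of_ne hm, hiff]

theorem WalkInvariant.step [DecidableEq ι] {k : ℕ} (h : WalkInvariant M B₀ d x₀ L B cur (k + 1))
    {y : α} (hy : d y = k) {m : ι} (harc₀ : ExchangeArc (M m) (B₀ m) y cur)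
    (hdist : ∀ z, ExchangeAdj M B₀ z y → k ≤ d z + 1) :
    WalkInvariant M B₀ d x₀ L (Function.update B m ((insert y (B m)).erase cur)) y k := by
  have harc := (h.arc_iff m y harc₀.1 (by omega) cur).2 harc₀
  constructor
  · intro m'
    by_cases hm : m' = m
    · subst hm
      rw [Function.update_self, Finset.coe_erase, Finset.coe_insert]
      exact harc.isBase (h.isBase m')
    · rw [Function.update_of_ne hm]
      exact h.isBase m'
  · intro m' z hz hdz
    have hzB := h.notMem m' z hz (by omega)
    by_cases hm : m' = m
    · subst hm
      have hzy : z ≠ y := by rintro rfl; omega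
      simp [hzB, hzy]
    · rwa [Function.update_of_ne hm]
  · exact fun m' z => h.arc_iff_update hy harc m'
  · exact hdist
  · intro s
    have hs := h.mult_eq s
    have hs' := mult_update_exchange B harc.2.1 harc.1 s
    omega
  · right
    rcases h.moved with ⟨-, rfl⟩ | ⟨m', hx₀, hx₀'⟩
    · exact ⟨m, harc₀.2.1, by simp⟩
    · refine ⟨m', hx₀, ?_⟩
      by_cases hm : m' = m
      · subst hm
        have : x₀ ≠ y := fun h => harc₀.1 (h ▸ hx₀)
        simp [hx₀', this]
      · rwa [Function.update_of_ne hm]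

theorem WalkInvariant.biUnion_eq_insert (h : WalkInvariant M B₀ d x₀ L B cur 0)
    (hx₀ : 1 < mult B₀ x₀) : Finset.univ.biUnion B = insert cur (Finset.univ.biUnion B₀) := by
  ext s
  have hmem : ∀ B : ι → Finset α, s ∈ Finset.univ.biUnion B ↔ mult B s ≠ 0 := by
    simp [mult_eq_zero]
  have hs := h.mult_eq s
  rw [Finset.mem_insert, hmem, hmem]
  split_ifs at hs with hsx <;> subst_vars <;> grind

/-- The bases `B'` arise from `B` by the exchanges along a closed walk. -/
structure IsRotation [Fintype α] (M : ι → Matroid α) (B B' : ι → Finset α) : Prop where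
  isBase : ∀ m, (M m).IsBase (B' m : Set α)
  mult_eq : ∀ s, mult B' s = mult B s
  moved : ∃ m, ∃ x ∈ B m, x ∉ B' m
  cyclic : ∃ v d, IsDist (ExchangeAdj M B) {v} d ∧ ∃ y ∈ reached d, ExchangeAdj M B y v

theorem IsPotential.not_isRotation [Fintype α] {k : α → ℕ} (h : IsPotential (ExchangeAdj M B) k)
    {B' : ι → Finset α} : ¬ IsRotation M B B' := fun h' => by
  obtain ⟨v, d, hd, y, hy, hyv⟩ := h'.cyclic
  exact h.notMem_reached hd hyv hy

end Walk

section Recombination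

variable {α : Type*} [DecidableEq α] {M : Fin 2 → Matroid α} {μ : α → ℕ} {B B' C : Fin 2 → Finset α}

/-- The pair of bases `B 0`, `C 1` and the pair `C 0`, `B 1` both cover every element `s` exactly
`μ s` times. -/
structure IsBalanced (M : Fin 2 → Matroid α) (μ : α → ℕ) (B C : Fin 2 → Finset α) : Prop where
  isBase_left : ∀ m, (M m).IsBase (B m : Set α)
  isBase_right : ∀ m, (M m).IsBase (C m : Set α)
  mult_eq : ∀ m s, (if s ∈ B m then 1 else 0) + (if s ∈ C m.rev then 1 else 0) = μ s

theorem IsBalanced.refl (hB : ∀ m, (M m).IsBase (B m : Set α)) : IsBalanced M (mult B) B B := by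
  refine ⟨hB, hB, fun m s => ?_⟩
  rw [mult_fin_two]
  fin_cases m
  · rfl
  · exact add_comm _ _

theorem IsBalanced.mult_add_mult (h : IsBalanced M μ B C) (s : α) :
    mult B s + mult C s = 2 * μ s := by
  have h₀ := h.mult_eq 0 s
  have h₁ := h.mult_eq 1 s
  rw [mult_fin_two, mult_fin_two]
  simp only [Fin.rev_zero, Fin.reduceLast, Fin.reduceRev] at h₀ h₁
  omega

theorem symmDiff_eq_symmDiff_zero (h : ∀ s, mult B s + mult C s = 2 * μ s) (m : Fin 2) :
    symmDiff (B m) (C m) = symmDiff (B 0) (C 0) := by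
  ext s
  have hs := h s
  rw [mult_fin_two, mult_fin_two] at hs
  fin_cases m
  · rfl
  · simp only [Fin.mk_one, Finset.mem_symmDiff]
    split_ifs at hs <;> first | omega | tauto

/-- A fixed-point free involution of `V`. -/
def IsMatching (V : Finset α) (φ : α → α) : Prop :=
  ∀ x ∈ V, φ x ∈ V ∧ φ (φ x) = x ∧ φ x ≠ x

theorem IsExchangeBijection.exists_isMatching {N : Matroid α} {B C : Finset α} {f : α → α}
    (hf : IsExchangeBijection N B C f) :
    ∃ φ, IsMatching (symmDiff B C) φ ∧ ∀ s ∈ B, s ∉ C → φ s = f s ∧ φ (f s) = s := by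
  have hfC : ∀ s ∈ B, f s ∈ C := fun s hs => hf.1.mapsTo hs
  have hfB : ∀ s ∈ B, s ∉ C → f s ∉ B := fun s hs hs' => hf.apply_notMem hs hs'
  have hinv : ∀ s, ∃ t, s ∈ C → t ∈ B ∧ f t = s := fun s => by
    by_cases hs : s ∈ C
    · obtain ⟨t, ht⟩ := hf.1.surjOn hs
      exact ⟨t, fun _ => ht⟩
    · exact ⟨s, fun h => absurd h hs⟩
  choose g hg using hinv
  have hgf : ∀ s ∈ B, g (f s) = s := fun s hs =>
    hf.1.injOn (hg _ (hfC s hs)).1 hs (hg _ (hfC s hs)).2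
  have hgC : ∀ s ∈ C, s ∉ B → g s ∉ C := fun s hs hs' hgs => by
    have hgs' := hf.apply_eq_self (hg s hs).1 hgs
    exact hs' ((hg s hs).2 ▸ hgs'.symm ▸ (hg s hs).1)
  refine ⟨fun s => if s ∈ B then f s else g s, fun s hs => ?_, fun s hs hs' => ?_⟩
  · rcases Finset.mem_symmDiff.1 hs with ⟨hsB, hsC⟩ | ⟨hsC, hsB⟩
    · have hne : f s ≠ s := fun h => hsC (h ▸ hfC s hsB)
      simp [Finset.mem_symmDiff, hsB, hfC s hsB, hfB s hsB hsC, hgf s hsB, hne]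
    · have hne : g s ≠ s := fun h => hsB (h ▸ (hg s hsC).1)
      simp [Finset.mem_symmDiff, hsB, hgC s hsC hsB, hg s hsC, hne]
  · simp [hs, hfB s hs hs', hgf s hs]

theorem IsExchangeBijection.isBase_of_colouring {N : Matroid α} {B C B₁ : Finset α} {f : α → α}
    (hf : IsExchangeBijection N B C f) {c : α → ℕ} (hc : ∀ s ∈ symmDiff B C, c s = 1 ∨ c s = 2)
    (hcf : ∀ s ∈ B, s ∉ C → c (f s) ≠ c s) {k : ℕ} (hk : k = 1 ∨ k = 2)
    (hB₁ : ∀ s, s ∈ B₁ ↔ if s ∈ symmDiff B C then c s = k else s ∈ B) :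
    N.IsBase (B₁ : Set α) := by
  convert hf.isBase_inter_union_sep_symmDiff (P := (c · = k)) fun s hs hs' => ?_ using 1
  · ext s
    simp only [Finset.mem_coe, hB₁, Finset.mem_symmDiff, Set.mem_union, Set.mem_inter_iff,
      Set.mem_ofPred_eq, Set.mem_symmDiff]
    split_ifs <;> tauto
  · have hne := hcf s hs hs'
    have hcs := hc s (Finset.mem_symmDiff.2 (Or.inl ⟨hs, hs'⟩))
    have hcfs := hc (f s)
      (Finset.mem_symmDiff.2 (Or.inr ⟨hf.1.mapsTo hs, hf.apply_notMem hs hs'⟩))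
    omega

-- The colour classes, which both exchange bijections respect, trade places between the pairs.
theorem isBalanced_of_colouring (hμ : ∀ s, mult B s + mult C s = 2 * μ s) {f : Fin 2 → α → α}
    (hf : ∀ m, IsExchangeBijection (M m) (B m : Set α) (C m : Set α) (f m)) {c : α → ℕ}
    (hc : ∀ s ∈ symmDiff (B 0) (C 0), c s = 1 ∨ c s = 2)
    (hcf : ∀ m, ∀ s ∈ B m, s ∉ C m → c (f m s) ≠ c s) {B₁ C₁ : Fin 2 → Finset α}
    (hB₁ : ∀ m s, s ∈ B₁ m ↔ if s ∈ symmDiff (B 0) (C 0) then c s = 1 else s ∈ B m)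
    (hC₁ : ∀ m s, s ∈ C₁ m ↔ if s ∈ symmDiff (B 0) (C 0) then c s = 2 else s ∈ C m) :
    IsBalanced M μ B₁ C₁ := by
  have hV := symmDiff_eq_symmDiff_zero hμ
  have hBC : ∀ m, ∀ s ∉ symmDiff (B 0) (C 0), (s ∈ C m ↔ s ∈ B m) := fun m s hs => by
    rw [← hV m, Finset.mem_symmDiff] at hs
    tauto
  refine ⟨fun m => (hf m).isBase_of_colouring (hV m ▸ hc) (hcf m) (Or.inl rfl) fun s => ?_,
    fun m => (hf m).isBase_of_colouring (hV m ▸ hc) (hcf m) (Or.inr rfl) fun s => ?_,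
    fun m s => ?_⟩
  · rw [hB₁, hV m]
  · rw [hC₁, hV m]
    split_ifs with hs
    exacts [Iff.rfl, hBC m s hs]
  · have hs := hμ s
    rw [mult_fin_two, mult_fin_two] at hs
    simp only [hB₁, hC₁]
    by_cases hsV : s ∈ symmDiff (B 0) (C 0)
    · have hsV₁ := hV 1 ▸ hsV
      rw [Finset.mem_symmDiff] at hsV₁
      have hcs := hc s hsV
      simp only [hsV, if_true]
      rw [Finset.mem_symmDiff] at hsV
      grind
    · have hs₀ := hBC 0 s hsV
      have hs₁ := hBC 1 s hsV
      simp only [hs₀, hs₁] at hs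
      fin_cases m <;>
        simp only [Fin.zero_eta, Fin.mk_one, Fin.reduceRev, hsV, if_false, hs₀, hs₁] <;> omega

theorem IsBalanced.mem_iff_of_mem_symmDiff (h : IsBalanced M μ B C) {s : α}
    (hs : s ∈ symmDiff (B 0) (C 0)) : s ∈ B 0 ↔ s ∈ B 1 := by
  have h₀ := h.mult_eq 0 s
  have h₁ := h.mult_eq 1 s
  simp only [Fin.rev_zero, Fin.reduceLast, Fin.reduceRev] at h₀ h₁
  rw [Finset.mem_symmDiff] at hs
  split_ifs at h₀ h₁ <;> first | omega | tauto

theorem mem_iff_of_mult_eq {s : α} (hs : mult B' s = mult B s) (h : s ∈ B 0 ↔ s ∈ B 1) (m : Fin 2) :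
    s ∈ B' m ↔ s ∈ B m := by
  rw [mult_fin_two, mult_fin_two] at hs
  fin_cases m <;> simp only [Fin.zero_eta, Fin.mk_one] <;> split_ifs at hs <;>
    first | omega | tauto

-- Where `B` and `C` differ, the two bases `B m` agree, so the rotation does not move anything.
theorem IsBalanced.card_symmDiff_lt (h : IsBalanced M μ B C) (hB' : ∀ s, mult B' s = mult B s)
    {x : α} {m : Fin 2} (hx : x ∈ B m) (hx' : x ∉ B' m) :
    (symmDiff (B 0) (C 0)).card < (symmDiff (B' 0) (C 0)).card := by
  have hsub : symmDiff (B 0) (C 0) ⊆ symmDiff (B' 0) (C 0) := fun s hs => by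
    have hs' := mem_iff_of_mult_eq (hB' s) (h.mem_iff_of_mem_symmDiff hs) 0
    rwa [Finset.mem_symmDiff, hs', ← Finset.mem_symmDiff]
  have hxB : ¬ (x ∈ B 0 ↔ x ∈ B 1) := fun hxB => hx' ((mem_iff_of_mult_eq (hB' x) hxB m).2 hx)
  have hxV : x ∉ symmDiff (B 0) (C 0) := fun hxV => hxB (h.mem_iff_of_mem_symmDiff hxV)
  refine Finset.card_lt_card ((Finset.ssubset_iff_of_subset hsub).2 ⟨x, ?_, hxV⟩)
  have hxm := hB' x
  rw [mult_fin_two, mult_fin_two] at hxm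
  rw [Finset.mem_symmDiff] at hxV ⊢
  fin_cases m <;> simp only [Fin.zero_eta, Fin.mk_one] at hx hx' <;> split_ifs at hxm <;>
    first | omega | tauto

-- Every exchange leaving `B 0` or `B 1` raises the price, so these are the only cheapest bases.
theorem IsBalanced.isPricingCertificate [Fintype α] {A : Fin 2 → Finset α}
    (h : IsBalanced M (mult A) B C) (hA : IsCovering M A) {k : α → ℕ}
    (hk : IsPotential (ExchangeAdj M B) k) {p : α → ℝ}
    (hp : ∀ s ∈ Finset.univ.biUnion A, p s = k s / (Fintype.card α + 1))
    (hp' : ∀ s ∉ Finset.univ.biUnion A, p s = 2) :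
    IsPricingCertificate M B C (Finset.univ.biUnion A) p := by
  have hpos : (0 : ℝ) < Fintype.card α + 1 := by positivity
  have hU : ∀ m, B m ∪ C m.rev = Finset.univ.biUnion A := fun m => by
    ext s
    have hs : mult A s ≠ 0 ↔ s ∈ Finset.univ.biUnion A := by
      simp [mult_eq_zero, or_iff_not_imp_left]
    rw [← hs, ← h.mult_eq m s, Finset.mem_union]
    split_ifs <;> simp_all
  refine ⟨h.isBase_left, h.isBase_right, hU, fun X Y hXY => ?_, fun s hs => ?_, fun s hs => ?_,
    fun s hs => ?_, fun m u hu w harc => ?_⟩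
  · simpa using hA ![X, Y] fun i j hij => by
      fin_cases i <;> fin_cases j <;> simp_all [Function.onFun, disjoint_comm]
  · rw [hp s hs]
    exact div_pos (Nat.cast_pos.2 (hk.pos s)) hpos
  · rw [hp s hs, div_lt_one hpos]
    exact_mod_cast Nat.lt_succ_of_le (hk.le_card s)
  · rw [hp' s hs]
    norm_num
  · rw [hp u hu, hp w (hU m ▸ Finset.mem_union_left _ (by simpa using harc.2.1))]
    exact div_lt_div_of_pos_right (Nat.cast_lt.2 (hk.lt u w ⟨m, harc⟩)) hpos

end Recombination

section Colouring

variable {α : Type*} {V : Finset α} {φ γ : α → α} {c : α → ℕ} {v u : α}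

/-- `c` is a partial colouring with the colours `1` and `2`, where `0` stands for uncoloured, in
which matched elements are both uncoloured or have different colours. -/
def IsColouring (V : Finset α) (φ : α → α) (c : α → ℕ) : Prop :=
  ∀ x ∈ V, c x ≤ 2 ∧ 3 ∣ c x + c (φ x)

theorem IsColouring.eq_zero (hc : IsColouring V φ c) (hφ : IsMatching V φ) (hu : u ∈ V)
    (h0 : c u = 0) : c (φ u) = 0 := by
  have := hc _ hu
  have := hc _ (hφ u hu).1
  omega

theorem IsColouring.update [DecidableEq α] (hc : IsColouring V φ c) (hφ : IsMatching V φ)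
    (hu : u ∈ V) : IsColouring V φ (Function.update (Function.update c u 1) (φ u) 2) := by
  intro x hx
  have := hφ u hu
  have := hφ x hx
  have := hc x hx
  grind

/-- The situation when a cycle alternating between the matchings `φ` and `γ` has been coloured from
`v` to the element before `u`: either nothing or the whole cycle has been coloured, or the
colouring violates `γ` exactly at the two ends of the coloured path. -/
structure ColourWalk (V : Finset α) (φ γ : α → α) (v : α) (c : α → ℕ) (u : α) : Prop where
  mem_start : v ∈ V
  mem : u ∈ V
  isColouring : IsColouring V φ c
  ends : (u = v ∧ IsColouring V γ c) ∨
    (c u = 0 ∧ c (γ u) = 2 ∧ c v = 1 ∧ c (γ v) = 0 ∧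
      ∀ x ∈ V, x ≠ u → x ≠ γ u → x ≠ v → x ≠ γ v → 3 ∣ c x + c (γ x))

theorem ColourWalk.step [DecidableEq α] (hφ : IsMatching V φ) (hγ : IsMatching V γ)
    (h : ColourWalk V φ γ v c u) (h0 : c u = 0) :
    ColourWalk V φ γ v (Function.update (Function.update c u 1) (φ u) 2) (γ (φ u)) := by
  obtain ⟨hv, hu, hc, hends⟩ := h
  obtain ⟨hwV, hφw, hwu⟩ := hφ u hu
  have hw0 := hc.eq_zero hφ hu h0
  refine ⟨hv, (hγ _ hwV).1, hc.update hφ hu, ?_⟩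
  rcases hends with ⟨rfl, hends⟩ | ⟨-, h2, h1, hv0, hends⟩
  · by_cases huw : γ (φ u) = u
    · refine Or.inl ⟨huw, fun x hx => ?_⟩
      have := hγ _ hwV
      have := hγ x hx
      have := hends x hx
      grind
    · have := hγ _ hwV
      have := hγ _ hu
      have := hends.eq_zero hγ hu h0
      have := hends.eq_zero hγ hwV hw0
      refine Or.inr ⟨by grind, by grind, by grind, by grind, fun x hx => ?_⟩
      have := hγ x hx
      have := hends x hx
      grind
  · by_cases huw : γ (φ u) = v
    · refine Or.inl ⟨huw, fun x hx => ?_⟩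
      have := hγ _ hwV
      have := hγ _ hu
      have := hγ x hx
      have := hends x hx
      have := hc x hx
      by_cases hxu : x = γ u <;> by_cases hxv : x = v <;> grind
    · have := hγ _ hwV
      have := hγ _ hu
      have := hγ _ hv
      have hγw0 : c (γ (φ u)) = 0 := by
        have := hends _ hwV (by grind) (by grind) (by grind) (by grind)
        have := hc _ (hγ _ hwV).1
        omega
      refine Or.inr ⟨by grind, by grind, by grind, by grind, fun x hx => ?_⟩
      have := hγ x hx
      have := hends x hx
      by_cases hxu : x = γ u <;> grind

end Colouring

section Commands

/-- Programs whose only loops are `for` loops of length `n`. `set r j e` writes into the fixed row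
`r`, `mset i j e` into row `100 + i`, and `loop x c` runs `c` with the counter in the memory cell
`(0, x)` taking the values `0, …, n - 1`. -/
inductive Cmd : Type
  | skip
  | set (r : ℕ) (j e : Expr)
  | mset (i j e : Expr)
  | seq (c d : Cmd)
  | ite (e : Expr) (c d : Cmd)
  | loop (x : ℕ) (c : Cmd)
  | indep (m : Fin 2) (r o : ℕ)
  | exch (m : Fin 2) (r r' o : ℕ)

infixr:60 ";;" => Cmd.seq

/-- The counter stored in cell `(0, x)`. -/
def Expr.ctr (x : ℕ) : Expr := .get (.const 0) (.const x)

/-- The entry `j` of the fixed row `r`. -/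
def Expr.cell (r : ℕ) (j : Expr) : Expr := .get (.const r) j

/-- The scalar stored at the beginning of row `r`. -/
def Expr.var (r : ℕ) : Expr := .get (.const r) (.const 0)

/-- The matrix entry `(i, j)`. -/
def Expr.mat (i j : Expr) : Expr := .get (.add (.const 100) i) j

/-- The negation of a condition. -/
def Expr.not (a : Expr) : Expr := .eq a (.const 0)

/-- The conjunction of two conditions. -/
def Expr.and (a b : Expr) : Expr := .lt (.const 1) (.add (.lt (.const 0) a) (.lt (.const 0) b))

/-- Expressions serve as conditions, which hold if the value is nonzero. -/
def Expr.Holds (σ : Store) (e : Expr) : Prop := e.eval σ ≠ 0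

section Eval

variable (σ : Store) (a b : Expr)

@[simp] theorem Expr.eval_const (k : ℕ) : (Expr.const k).eval σ = k := rfl
@[simp] theorem Expr.eval_add : (Expr.add a b).eval σ = a.eval σ + b.eval σ := rfl
@[simp] theorem Expr.eval_sub : (Expr.sub a b).eval σ = a.eval σ - b.eval σ := rfl
@[simp] theorem Expr.eval_lt :
    (Expr.lt a b).eval σ = if a.eval σ < b.eval σ then 1 else 0 := rfl
@[simp] theorem Expr.eval_eq :
    (Expr.eq a b).eval σ = if a.eval σ = b.eval σ then 1 else 0 := rfl
@[simp] theorem Expr.eval_ctr (x : ℕ) : (Expr.ctr x).eval σ = σ 0 x := rfl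
@[simp] theorem Expr.eval_cell (r : ℕ) : (Expr.cell r a).eval σ = σ r (a.eval σ) := rfl
@[simp] theorem Expr.eval_var (r : ℕ) : (Expr.var r).eval σ = σ r 0 := rfl
@[simp] theorem Expr.eval_mat :
    (Expr.mat a b).eval σ = σ (100 + a.eval σ) (b.eval σ) := rfl

@[simp] theorem Expr.holds_lt : (Expr.lt a b).Holds σ ↔ a.eval σ < b.eval σ := by
  simp [Expr.Holds, Expr.eval]

@[simp] theorem Expr.holds_eq : (Expr.eq a b).Holds σ ↔ a.eval σ = b.eval σ := by
  simp [Expr.Holds, Expr.eval]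

@[simp] theorem Expr.holds_not : a.not.Holds σ ↔ ¬ a.Holds σ := by
  by_cases h : a.eval σ = 0 <;> simp [Expr.Holds, Expr.eval, Expr.not, h]

@[simp] theorem Expr.holds_and : (a.and b).Holds σ ↔ a.Holds σ ∧ b.Holds σ := by
  simp only [Expr.Holds, Expr.eval, Expr.and]
  by_cases ha : a.eval σ = 0 <;> by_cases hb : b.eval σ = 0 <;>
    simp [ha, hb, Nat.pos_iff_ne_zero]

@[simp] theorem Expr.holds_cell (r : ℕ) : (Expr.cell r a).Holds σ ↔ σ r (a.eval σ) ≠ 0 := Iff.rfl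
@[simp] theorem Expr.holds_var (r : ℕ) : (Expr.var r).Holds σ ↔ σ r 0 ≠ 0 := Iff.rfl
@[simp] theorem Expr.holds_mat :
    (Expr.mat a b).Holds σ ↔ σ (100 + a.eval σ) (b.eval σ) ≠ 0 := Iff.rfl

end Eval

theorem Store.set_apply (σ : Store) (i j v a b : ℕ) :
    σ.set i j v a b = if a = i ∧ b = j then v else σ a b := rfl

@[simp] theorem Store.set_row_of_ne (σ : Store) (i j v : ℕ) {a : ℕ} (h : a ≠ i) :
    σ.set i j v a = σ a := by
  funext b; simp [Store.set_apply, h]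

theorem Store.set_row (σ : Store) (i j v : ℕ) :
    σ.set i j v i = Function.update (σ i) j v := by
  funext b; simp [Store.set_apply, Function.update_apply]

@[simp] theorem Store.set_zero_succ (σ : Store) (j v a : ℕ) : σ.set 0 j v (a + 1) = σ (a + 1) :=
  σ.set_row_of_ne _ _ _ (by simp)

namespace Cmd

/-- Rows other than row `0` that the command may change. -/
def writes : Cmd → ℕ → Bool
  | skip, _ => false
  | set r _ _, a => a == r
  | mset _ _ _, a => decide (100 ≤ a)
  | seq c d, a => c.writes a || d.writes a
  | ite _ c d, a => c.writes a || d.writes a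
  | loop _ c, a => c.writes a
  | indep _ _ o, a => a == o
  | exch _ _ _ o, a => a == o

/-- Counters that the command may change. -/
def uses : Cmd → ℕ → Bool
  | seq c d, a => c.uses a || d.uses a
  | ite _ c d, a => c.uses a || d.uses a
  | loop x c, a => a == x || c.uses a
  | _, _ => false

/-- Nested loops have different counters, and the cell containing `n` is no counter. -/
def nested : Cmd → Bool
  | seq c d => c.nested && d.nested
  | ite _ c d => c.nested && d.nested
  | loop x c => x != 0 && !c.uses x && c.nested
  | _ => true

/-- Counters are changed by the loops only. -/
def WellFormed (c : Cmd) : Prop := c.writes 0 = false ∧ c.nested = true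

instance (c : Cmd) : Decidable c.WellFormed := inferInstanceAs (Decidable (_ ∧ _))

/-- The underlying program; a `for` loop becomes a `while` loop maintaining its counter. -/
def compile : Cmd → Prog
  | skip => .skip
  | set r j e => .assign (.const r) j e
  | mset i j e => .assign (.add (.const 100) i) j e
  | seq c d => .seq c.compile d.compile
  | ite e c d => .ite e c.compile d.compile
  | loop x c => .seq (.assign (.const 0) (.const x) (.const 0))
      (.while (.lt (.ctr x) (.ctr 0))
        (.seq c.compile (.assign (.const 0) (.const x) (.add (.ctr x) (.const 1)))))
  | indep m r o => .indep m (.const r) (.const o) (.const 0)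
  | exch m r r' o => .exch m (.const r) (.const r') (.const o)

/-- The memory at the beginning of round `i` of a loop with counter `x` and body `f`. -/
def iter (f : Store → Store) (x : ℕ) (σ : Store) : ℕ → Store
  | 0 => σ.set 0 x 0
  | i + 1 => (f (iter f x σ i)).set 0 x (i + 1)

variable {n : ℕ} (M : Fin 2 → Matroid (Fin n)) (F : Fin 2 → ExchangeProcedure n)

open Classical in
/-- The memory after running a command. -/
noncomputable def den : Cmd → Store → Store
  | skip, σ => σ
  | set r j e, σ => σ.set r (j.eval σ) (e.eval σ)
  | mset i j e, σ => σ.set (100 + i.eval σ) (j.eval σ) (e.eval σ)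
  | seq c d, σ => d.den (c.den σ)
  | ite e c d, σ => if e.Holds σ then c.den σ else d.den σ
  | loop x c, σ => iter c.den x σ (σ 0 0)
  | indep m r o, σ =>
      σ.set o 0 (if (M m).Indep (σ.rowSet n r : Set (Fin n)) then 1 else 0)
  | exch m r r' o, σ => σ.setRow o ((F m).map (σ.rowSet n r) (σ.rowSet n r'))

/-- The exchange procedures are called on bases only. -/
def Safe : Cmd → Store → Prop
  | seq c d, σ => c.Safe σ ∧ d.Safe (c.den M F σ)
  | ite e c d, σ => (e.Holds σ → c.Safe σ) ∧ (¬ e.Holds σ → d.Safe σ)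
  | loop x c, σ => ∀ i < σ 0 0, c.Safe (iter (c.den M F) x σ i)
  | exch m r r' _, σ => (M m).IsBase (σ.rowSet n r : Set (Fin n)) ∧
      (M m).IsBase (σ.rowSet n r' : Set (Fin n))
  | _, _ => True

/-- The command contains no call of an exchange procedure. -/
def noExch : Cmd → Bool
  | seq c d => c.noExch && d.noExch
  | ite _ c d => c.noExch && d.noExch
  | loop _ c => c.noExch
  | exch _ _ _ _ => false
  | _ => true

theorem safe_of_noExch (c : Cmd) (h : c.noExch = true) (σ : Store) : c.Safe M F σ := by
  induction c generalizing σ with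
  | seq c d hc hd =>
    simp only [noExch, Bool.and_eq_true] at h
    exact ⟨hc h.1 _, hd h.2 _⟩
  | ite e c d hc hd =>
    simp only [noExch, Bool.and_eq_true] at h
    exact ⟨fun _ => hc h.1 _, fun _ => hd h.2 _⟩
  | loop x c hc => exact fun i _ => hc h _
  | exch => simp [noExch] at h
  | _ => trivial

variable {M F}

theorem den_row {c : Cmd} {r : ℕ} (hr : r ≠ 0) (h : c.writes r = false) (σ : Store) :
    c.den M F σ r = σ r := by
  induction c generalizing σ with
  | skip => rfl
  | set r' j e => exact σ.set_row_of_ne _ _ _ (by simpa [writes] using h)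
  | mset i j e =>
    refine σ.set_row_of_ne _ _ _ ?_
    have : ¬ 100 ≤ r := by simpa [writes] using h
    omega
  | seq c d hc hd =>
    simp only [writes, Bool.or_eq_false_iff] at h
    simp only [den]
    rw [hd h.2, hc h.1]
  | ite e c d hc hd =>
    simp only [writes, Bool.or_eq_false_iff] at h
    simp only [den]
    split_ifs
    · exact hc h.1 _
    · exact hd h.2 _
  | loop x c hc =>
    simp only [den]
    generalize σ 0 0 = k
    induction k with
    | zero => exact σ.set_row_of_ne _ _ _ hr
    | succ k ih => rw [iter, Store.set_row_of_ne _ _ _ _ hr, hc h, ih]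
  | indep m r' o => exact σ.set_row_of_ne _ _ _ (by simpa [writes] using h)
  | exch m r' r'' o =>
    have : r ≠ o := by simpa [writes] using h
    funext b
    simp [den, Store.setRow, this]

theorem den_counter {c : Cmd} {x : ℕ} (hw : c.writes 0 = false) (h : c.uses x = false)
    (σ : Store) : c.den M F σ 0 x = σ 0 x := by
  induction c generalizing σ with
  | skip => rfl
  | set r' j e =>
    simp only [den]
    rw [σ.set_row_of_ne _ _ _ (by simpa [writes] using hw)]
  | mset i j e =>
    simp only [den]
    rw [σ.set_row_of_ne _ _ _ (by omega)]
  | seq c d hc hd =>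
    simp only [writes, uses, Bool.or_eq_false_iff] at h hw
    simp only [den]
    rw [hd hw.2 h.2, hc hw.1 h.1]
  | ite e c d hc hd =>
    simp only [writes, uses, Bool.or_eq_false_iff] at h hw
    simp only [den]
    split_ifs
    · exact hc hw.1 h.1 _
    · exact hd hw.2 h.2 _
  | loop y c hc =>
    simp only [uses, Bool.or_eq_false_iff, beq_eq_false_iff_ne] at h
    simp only [den]
    generalize σ 0 0 = k
    induction k with
    | zero => simp [iter, Store.set_apply, h.1]
    | succ k ih => simp [iter, Store.set_apply, h.1, hc hw h.2, ih]
  | indep m r' o =>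
    simp only [den]
    rw [σ.set_row_of_ne _ _ _ (by simpa [writes] using hw)]
  | exch m r' r'' o =>
    have : (0 : ℕ) ≠ o := by simpa [writes] using hw
    simp [den, Store.setRow, this]

theorem nested_not_uses_zero {c : Cmd} (h : c.nested = true) : c.uses 0 = false := by
  induction c with
  | seq c d hc hd => simp_all [nested, uses]
  | ite e c d hc hd => simp_all [nested, uses]
  | loop x c hc =>
    simp only [nested, Bool.and_eq_true, bne_iff_ne, ne_eq] at h
    simp only [uses, Bool.or_eq_false_iff, beq_eq_false_iff_ne]
    exact ⟨fun h' => h.1.1 h'.symm, hc h.2⟩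
  | _ => rfl

/-- `τ` differs from `σ` only in places where `c` may write. -/
structure Frame (c : Cmd) (σ τ : Store) : Prop where
  row : ∀ r, c.writes (r + 1) = false → τ (r + 1) = σ (r + 1)
  ctr : ∀ x, c.uses x = false → τ 0 x = σ 0 x

theorem Frame.row_of_ne {c : Cmd} {σ τ : Store} (h : Frame c σ τ) {r : ℕ} (hr : r ≠ 0)
    (hw : c.writes r = false) : τ r = σ r := by
  obtain ⟨r, rfl⟩ := Nat.exists_eq_succ_of_ne_zero hr
  exact h.row r hw

theorem WellFormed.frame {c : Cmd} (h : c.WellFormed) (σ : Store) : Frame c σ (c.den M F σ) :=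
  ⟨fun _ hr => den_row (by simp) hr σ, fun _ hx => den_counter h.1 hx σ⟩

theorem WellFormed.of_loop {c : Cmd} {x : ℕ} (h : (loop x c).WellFormed) : c.WellFormed := by
  obtain ⟨h₁, h₂⟩ := h
  simp only [nested, Bool.and_eq_true] at h₂
  exact ⟨h₁, h₂.2⟩

theorem WellFormed.seq_left {c d : Cmd} (h : (c.seq d).WellFormed) : c.WellFormed := by
  simpa [WellFormed, writes, nested] using
    And.intro (Bool.or_eq_false_iff.1 h.1).1 (Bool.and_eq_true_iff.1 h.2).1

theorem WellFormed.seq_right {c d : Cmd} (h : (c.seq d).WellFormed) : d.WellFormed := by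
  simpa [WellFormed, writes, nested] using
    And.intro (Bool.or_eq_false_iff.1 h.1).2 (Bool.and_eq_true_iff.1 h.2).2

theorem frame_iter {c : Cmd} {x : ℕ} (h : (loop x c).WellFormed) (σ : Store) (i : ℕ) :
    Frame (loop x c) σ (iter (c.den M F) x σ i) ∧ iter (c.den M F) x σ i 0 x = i := by
  have hc := h.of_loop
  induction i with
  | zero =>
    refine ⟨⟨fun r _ => by simp [iter], fun y hy => ?_⟩, by simp [iter, Store.set_apply]⟩
    simp only [uses, Bool.or_eq_false_iff, beq_eq_false_iff_ne] at hy
    simp [iter, Store.set_apply, hy.1]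
  | succ i ih =>
    refine ⟨⟨fun r hr => ?_, fun y hy => ?_⟩, by simp [iter, Store.set_apply]⟩
    · rw [iter, Store.set_zero_succ, hc.frame _ |>.row r hr, ih.1.row r hr]
    · have hy' := hy
      simp only [uses, Bool.or_eq_false_iff, beq_eq_false_iff_ne] at hy'
      rw [iter, Store.set_apply, if_neg (by simp [hy'.1]), hc.frame _ |>.ctr y hy'.2,
        ih.1.ctr y hy]

theorem iter_induction {c : Cmd} {x : ℕ} (h : (loop x c).WellFormed) {σ : Store}
    (P : ℕ → Store → Prop) (zero : P 0 (σ.set 0 x 0))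
    (succ : ∀ i < σ 0 0, ∀ τ, Frame (loop x c) σ τ → τ 0 x = i → P i τ →
      P (i + 1) ((c.den M F τ).set 0 x (i + 1))) {i : ℕ} (hi : i ≤ σ 0 0) :
    P i (iter (c.den M F) x σ i) := by
  induction i with
  | zero => exact zero
  | succ i ih =>
    obtain ⟨h₁, h₂⟩ := frame_iter (M := M) (F := F) h σ i
    exact succ i (by omega) _ h₁ h₂ (ih (by omega))

theorem loop_induction {c : Cmd} {x : ℕ} (h : (loop x c).WellFormed) {σ : Store}
    (P : ℕ → Store → Prop) (zero : P 0 (σ.set 0 x 0))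
    (succ : ∀ i < σ 0 0, ∀ τ, Frame (loop x c) σ τ → τ 0 x = i → P i τ →
      P (i + 1) ((c.den M F τ).set 0 x (i + 1))) :
    P (σ 0 0) ((loop x c).den M F σ) :=
  iter_induction h P zero succ le_rfl

theorem loop_induction_safe {c : Cmd} {x : ℕ} (h : (loop x c).WellFormed) {σ : Store}
    (P : ℕ → Store → Prop) (zero : P 0 (σ.set 0 x 0))
    (succ : ∀ i < σ 0 0, ∀ τ, Frame (loop x c) σ τ → τ 0 x = i → P i τ →
      c.Safe M F τ ∧ P (i + 1) ((c.den M F τ).set 0 x (i + 1))) :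
    (loop x c).Safe M F σ ∧ P (σ 0 0) ((loop x c).den M F σ) := by
  have step := fun i hi τ hτ hx hP => (succ i hi τ hτ hx hP).2
  refine ⟨fun i hi => ?_, loop_induction h P zero step⟩
  obtain ⟨h₁, h₂⟩ := frame_iter (M := M) (F := F) h σ i
  exact (succ i hi _ h₁ h₂ (iter_induction h P zero step hi.le)).1

open Polynomial in
/-- A bound for the running time, if the exchange procedures take time at most `q`. -/
noncomputable def timeBound (q : ℕ[X]) : Cmd → ℕ[X]
  | skip => 1
  | set _ j e => C (j.cost + e.cost + 2)
  | mset i j e => C (i.cost + j.cost + e.cost + 3)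
  | seq c d => c.timeBound q + d.timeBound q
  | ite e c d => C (e.cost + 1) + c.timeBound q + d.timeBound q
  | loop _ c => C 12 + X * (c.timeBound q + C 16)
  | indep _ _ _ => C 4
  | exch _ _ _ _ => C 4 + q

theorem exec_while {c : Cmd} {x : ℕ} (h : (loop x c).WellFormed) {σ : Store} (hn : σ 0 0 = n)
    {T : ℕ} (hc : ∀ i < n, ∃ t, Exec M F c.compile (iter (c.den M F) x σ i) t
      (c.den M F (iter (c.den M F) x σ i)) ∧ t ≤ T) {k : ℕ} (hk : k ≤ n) :
    ∃ t, Exec M F (.while (.lt (.ctr x) (.ctr 0))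
        (.seq c.compile (.assign (.const 0) (.const x) (.add (.ctr x) (.const 1)))))
      (iter (c.den M F) x σ (n - k)) t (iter (c.den M F) x σ n) ∧ t ≤ k * (T + 16) + 8 := by
  have hu0 := nested_not_uses_zero h.2
  obtain ⟨hframe, hx⟩ := frame_iter (M := M) (F := F) h σ (n - k)
  have h0 : iter (c.den M F) x σ (n - k) 0 0 = n := (hframe.ctr 0 hu0).trans hn
  induction k with
  | zero =>
    refine ⟨_, .while_false ?_, by simp [Expr.cost, Expr.ctr]⟩
    simp only [Nat.sub_zero] at hx h0
    simp [Expr.eval, Expr.ctr, hx, h0]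
  | succ k ih =>
    obtain ⟨hframe', hx'⟩ := frame_iter (M := M) (F := F) h σ (n - k)
    obtain ⟨t', h', ht'⟩ := ih (by omega) hframe' hx' ((hframe'.ctr 0 hu0).trans hn)
    obtain ⟨t, ht, htT⟩ := hc (n - (k + 1)) (by omega)
    have hincr := Exec.assign (M := M) (F := F) (.const 0) (.const x) (.add (.ctr x) (.const 1))
      (c.den M F (iter (c.den M F) x σ (n - (k + 1))))
    have hcx : c.uses x = false := by
      have := h.2
      simp only [nested, Bool.and_eq_true, Bool.not_eq_true'] at this
      exact this.1.2
    have hnext : (c.den M F (iter (c.den M F) x σ (n - (k + 1)))).set 0 x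
        (c.den M F (iter (c.den M F) x σ (n - (k + 1))) 0 x + 1)
        = iter (c.den M F) x σ (n - k) := by
      rw [den_counter h.of_loop.1 hcx, hx, show n - k = n - (k + 1) + 1 by omega, iter]
    simp only [Expr.eval_const, Expr.eval_add, Expr.eval_ctr] at hincr
    rw [hnext] at hincr
    refine ⟨_, .while_true ?_ (.seq ht hincr) h', ?_⟩
    · have : n - (k + 1) < n := by omega
      simp [Expr.eval, Expr.ctr, hx, h0, this]
    · simp only [Expr.cost, Expr.ctr]
      have : (k + 1) * (T + 16) = k * (T + 16) + (T + 16) := by ring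
      omega

theorem exec_compile {c : Cmd} (hc : c.WellFormed) {q : Polynomial ℕ}
    (hF : ∀ m, (F m).ComputesWithin (M m) (q.eval n)) {σ : Store} (hn : σ 0 0 = n)
    (hs : c.Safe M F σ) :
    ∃ t, Exec M F c.compile σ t (c.den M F σ) ∧ t ≤ (c.timeBound q).eval n := by
  induction c generalizing σ with
  | skip => exact ⟨1, .skip σ, by simp [timeBound]⟩
  | set r j e => exact ⟨_, .assign _ _ _ σ, by simp [timeBound, Expr.cost]; omega⟩
  | mset i j e => exact ⟨_, .assign _ _ _ σ, by simp [timeBound, Expr.cost]; omega⟩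
  | seq c d ihc ihd =>
    obtain ⟨t, h, ht⟩ := ihc hc.seq_left hn hs.1
    obtain ⟨t', h', ht'⟩ := ihd hc.seq_right
      (((hc.seq_left.frame σ).ctr 0 (nested_not_uses_zero hc.seq_left.2)).trans hn) hs.2
    exact ⟨t + t', .seq h h', by simp only [timeBound, Polynomial.eval_add]; omega⟩
  | ite e c d ihc ihd =>
    have hc' : c.WellFormed := WellFormed.seq_left (d := d) hc
    have hd' : d.WellFormed := WellFormed.seq_right (c := c) hc
    by_cases he : e.Holds σ
    · obtain ⟨t, h, ht⟩ := ihc hc' hn (hs.1 he)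
      refine ⟨e.cost + 1 + t, ?_, ?_⟩
      · simp only [den, if_pos he]
        exact .ite_true he h
      · simp only [timeBound, Polynomial.eval_add, Polynomial.eval_C]; omega
    · obtain ⟨t, h, ht⟩ := ihd hd' hn (hs.2 he)
      refine ⟨e.cost + 1 + t, ?_, ?_⟩
      · simp only [den, if_neg he]
        exact .ite_false (not_not.1 he) h
      · simp only [timeBound, Polynomial.eval_add, Polynomial.eval_C]; omega
  | loop x c ih =>
    have hn' : ∀ i, iter (c.den M F) x σ i 0 0 = n := fun i =>
      ((frame_iter hc σ i).1.ctr 0 (nested_not_uses_zero hc.2)).trans hn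
    obtain ⟨t, h, ht⟩ := exec_while hc hn
      (fun i hi => ih hc.of_loop (hn' i) (hs i (hn.symm ▸ hi))) le_rfl
    have hden : (loop x c).den M F σ = iter (c.den M F) x σ n := by simp only [den, hn]
    rw [Nat.sub_self] at h
    rw [hden]
    refine ⟨_, .seq (.assign _ _ _ _) h, ?_⟩
    simp only [timeBound, Polynomial.eval_add, Polynomial.eval_mul, Polynomial.eval_C,
      Polynomial.eval_X, Expr.cost]
    omega
  | indep m r o => exact ⟨_, .indep _ _ _ _ σ, by simp [timeBound, Expr.cost]⟩
  | exch m r r' o =>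
    refine ⟨_, .exch _ _ _ _ σ, ?_⟩
    have := (hF m _ _ hs.1 hs.2).2
    simp only [timeBound, Expr.cost, Polynomial.eval_add, Polynomial.eval_C, Expr.eval_const]
    omega

end Cmd

end Commands

notation "rB₀" => (10 : ℕ)
notation "rB₁" => (11 : ℕ)
notation "rC₀" => (12 : ℕ)
notation "rC₁" => (13 : ℕ)
notation "rSrc" => (14 : ℕ)
notation "rTgt" => (15 : ℕ)
notation "rDist" => (16 : ℕ)
notation "rCount" => (17 : ℕ)
notation "rScratch" => (18 : ℕ)
notation "rUncov" => (19 : ℕ)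
notation "rMap₀" => (20 : ℕ)
notation "rMap₁" => (21 : ℕ)
notation "rMate₀" => (22 : ℕ)
notation "rMate₁" => (23 : ℕ)
notation "rColour" => (24 : ℕ)
notation "rAns" => (30 : ℕ)
notation "rFound" => (31 : ℕ)
notation "rCur" => (32 : ℕ)
notation "rRem" => (33 : ℕ)
notation "rPtr" => (34 : ℕ)

section Support

variable {n : ℕ}

/-- The set represented by a row of the memory. -/
def supp (n : ℕ) (ρ : ℕ → ℕ) : Finset (Fin n) := Finset.univ.filter fun s => ρ s ≠ 0

@[simp] theorem mem_supp {ρ : ℕ → ℕ} {s : Fin n} : s ∈ supp n ρ ↔ ρ s ≠ 0 := by simp [supp]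

@[simp] theorem rowSet_eq_supp (σ : Store) (r : ℕ) : σ.rowSet n r = supp n (σ r) := rfl

theorem supp_congr {ρ ρ' : ℕ → ℕ} (h : ∀ j < n, ρ j = ρ' j) : supp n ρ = supp n ρ' := by
  ext s; simp [h s s.2]

theorem supp_update_ne_zero (ρ : ℕ → ℕ) (s : Fin n) {v : ℕ} (hv : v ≠ 0) :
    supp n (Function.update ρ s v) = insert s (supp n ρ) := by
  ext t
  simp only [mem_supp, Function.update_apply, Finset.mem_insert, Fin.val_inj]
  split_ifs with h <;> simp [h, hv]

theorem supp_update_zero (ρ : ℕ → ℕ) (s : Fin n) :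
    supp n (Function.update ρ s 0) = (supp n ρ).erase s := by
  ext t
  simp only [mem_supp, Function.update_apply, Finset.mem_erase, Fin.val_inj]
  split_ifs with h <;> simp [h]

/-- The pair of sets represented by two rows. -/
def pair (n : ℕ) (ρ₀ ρ₁ : ℕ → ℕ) : Fin 2 → Finset (Fin n) := ![supp n ρ₀, supp n ρ₁]

@[simp] theorem pair_zero (ρ₀ ρ₁ : ℕ → ℕ) : pair n ρ₀ ρ₁ 0 = supp n ρ₀ := rfl
@[simp] theorem pair_one (ρ₀ ρ₁ : ℕ → ℕ) : pair n ρ₀ ρ₁ 1 = supp n ρ₁ := rfl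

@[simp] theorem Store.ite_apply (p : Prop) [Decidable p] (σ τ : Store) (r : ℕ) :
    (if p then σ else τ) r = if p then σ r else τ r := by split_ifs <;> rfl

end Support

namespace Cmd

variable {n : ℕ} {M : Fin 2 → Matroid (Fin n)} {F : Fin 2 → ExchangeProcedure n}

section Den

variable (σ : Store)

@[simp] theorem den_skip : skip.den M F σ = σ := rfl
@[simp] theorem den_set (r : ℕ) (j e : Expr) :
    (set r j e).den M F σ = σ.set r (j.eval σ) (e.eval σ) := rfl
@[simp] theorem den_mset (i j e : Expr) :
    (mset i j e).den M F σ = σ.set (100 + i.eval σ) (j.eval σ) (e.eval σ) := rfl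
@[simp] theorem den_seq (c d : Cmd) : (c ;; d).den M F σ = d.den M F (c.den M F σ) := rfl

open scoped Classical in
@[simp] theorem den_ite (e : Expr) (c d : Cmd) :
    (ite e c d).den M F σ = if e.Holds σ then c.den M F σ else d.den M F σ := rfl

open scoped Classical in
@[simp] theorem den_indep (m : Fin 2) (r o : ℕ) : (indep m r o).den M F σ
    = σ.set o 0 (if (M m).Indep (supp n (σ r) : Set (Fin n)) then 1 else 0) := rfl

end Den

section Loops

theorem Frame.trans {c : Cmd} {σ τ ρ : Store} (h : Frame c σ τ) (h' : Frame c τ ρ) : Frame c σ ρ :=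
  ⟨fun r hr => (h'.row r hr).trans (h.row r hr), fun x hx => (h'.ctr x hx).trans (h.ctr x hx)⟩

theorem Frame.loop {c : Cmd} {σ τ : Store} (h : Frame c σ τ) (x : ℕ) : Frame (loop x c) σ τ :=
  ⟨h.row, fun y hy => h.ctr y (Bool.or_eq_false_iff.1 hy).2⟩

theorem loop_pointwise {c : Cmd} {x : ℕ} (h : (loop x c).WellFormed) {σ : Store} (R : ℕ → Prop)
    (hR : ∀ r, R r → r ≠ 0) (v : ℕ → ℕ → ℕ)
    (hc : ∀ i < σ 0 0, ∀ τ, Frame (loop x c) σ τ → τ 0 x = i →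
      (∀ r, R r → ∀ j, τ r j = if j < i then v r j else σ r j) →
      ∀ r, R r → c.den M F τ r = Function.update (τ r) i (v r i)) :
    ∀ r, R r → ∀ j, (loop x c).den M F σ r j = if j < σ 0 0 then v r j else σ r j := by
  refine loop_induction h (fun i τ => ∀ r, R r → ∀ j, τ r j = if j < i then v r j else σ r j) ?_ ?_
  · intro r hr j
    rw [Store.set_row_of_ne _ _ _ _ (hR r hr)]
    simp
  · intro i hi τ hf hx ih r hr j
    rw [Store.set_row_of_ne _ _ _ _ (hR r hr), hc i hi τ hf hx ih r hr, Function.update_apply,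
      ih r hr j]
    grind

theorem loop_fill {c : Cmd} {x : ℕ} (h : (loop x c).WellFormed) {σ : Store} {r : ℕ}
    (hr : r ≠ 0) (v : ℕ → ℕ)
    (hc : ∀ i < σ 0 0, ∀ τ, Frame (loop x c) σ τ → τ 0 x = i →
      (∀ j, τ r j = if j < i then v j else σ r j) →
      c.den M F τ r = Function.update (τ r) i (v i))
    (j : ℕ) (hj : j < σ 0 0) : (loop x c).den M F σ r j = v j := by
  rw [loop_pointwise h (· = r) (by simpa using hr) (fun _ => v) ?_ r rfl, if_pos hj]
  rintro i hi τ hf hx hτ _ rfl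
  exact hc i hi τ hf hx (hτ _ rfl)

theorem loop_loop_induction {c : Cmd} {x y : ℕ} (h : (loop x (loop y c)).WellFormed) {σ : Store}
    (hn : σ 0 0 = n) (P : Finset (Fin n × Fin n) → Store → Prop) (empty : P ∅ σ)
    (set_zero : ∀ S ρ z v, P S ρ → P S (ρ.set 0 z v))
    (step : ∀ S ρ (i k : Fin n), Frame (loop x (loop y c)) σ ρ → ρ 0 x = i → ρ 0 y = k →
      P S ρ → P (insert (i, k) S) (c.den M F ρ)) :
    P Finset.univ ((loop x (loop y c)).den M F σ) := by
  let done (i k : ℕ) : Finset (Fin n × Fin n) := {p | p.1 < i ∨ p.1 = i ∧ p.2 < k}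
  have hux : (loop y c).uses x = false := by
    have := h.2
    simp only [nested, Bool.and_eq_true, Bool.not_eq_true'] at this
    exact this.1.2
  have key := loop_induction (M := M) (F := F) h (σ := σ) (fun i τ => P (done i 0) τ) ?_ ?_
  · rwa [hn, show done n 0 = Finset.univ by ext; simp [done]] at key
  · rw [show done 0 0 = ∅ by ext; simp [done]]
    exact set_zero _ _ _ _ empty
  · intro i hi τ hf hx ih
    have hnτ : τ 0 0 = n := (hf.ctr 0 (nested_not_uses_zero h.2)).trans hn
    have hinner := loop_induction (M := M) (F := F) h.of_loop (σ := τ)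
      (fun k ρ => P (done i k) ρ) (set_zero _ _ _ _ ih) fun k hk ρ hg hy ih' => ?_
    · rw [show done (i + 1) 0 = done i (τ 0 0) by ext; simp [done]; omega]
      exact set_zero _ _ _ _ hinner
    · lift i to Fin n using hn ▸ hi
      lift k to Fin n using hnτ ▸ hk
      rw [show done i (k + 1) = insert (i, k) (done i k) by
        ext; simp [done, Prod.ext_iff, Fin.ext_iff]; omega]
      exact set_zero _ _ _ _ (step _ ρ i k (hf.trans (hg.loop x)) ((hg.ctr x hux).trans hx) hy ih')

theorem loop_loop_fill {c : Cmd} {x y : ℕ} (h : (loop x (loop y c)).WellFormed) {σ : Store}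
    (hn : σ 0 0 = n) (v : Fin n → Fin n → ℕ)
    (hc : ∀ (i k : Fin n) (ρ : Store), Frame (loop x (loop y c)) σ ρ → ρ 0 x = i → ρ 0 y = k →
      ∀ a b, c.den M F ρ (100 + a) b = if a = i ∧ b = k then v i k else ρ (100 + a) b)
    (i k : Fin n) : (loop x (loop y c)).den M F σ (100 + i) k = v i k := by
  refine loop_loop_induction (M := M) (F := F) h hn
    (fun S τ => ∀ p ∈ S, τ (100 + p.1) p.2 = v p.1 p.2) (by simp) (fun S ρ z w hS p hp => ?_)
    (fun S ρ i k hf hx hy ih p hp => ?_) (i, k) (Finset.mem_univ _)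
  · rw [ρ.set_row_of_ne _ _ _ (by omega), hS p hp]
  · rw [hc i k ρ hf hx hy]
    grind

end Loops

section Greedy

/-- Extend the empty set in row `r` greedily to a base. -/
def greedy (m : Fin 2) (r : ℕ) : Cmd :=
  loop 1 (set r (.ctr 1) (.const 1) ;; indep m r rAns ;;
    ite (.not (.var rAns)) (set r (.ctr 1) (.const 0)) skip)

open scoped Classical in
theorem den_greedy_body (m : Fin 2) {r : ℕ} (hr : r ≠ 0) (hr' : r ≠ rAns) {τ : Store} {s : Fin n}
    (hs : τ 0 1 = s) (h0 : τ r s = 0) :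
    (set r (.ctr 1) (.const 1) ;; indep m r rAns ;;
      ite (.not (.var rAns)) (set r (.ctr 1) (.const 0)) skip).den M F τ r
      = if (M m).Indep (insert s (supp n (τ r)) : Finset (Fin n))
        then Function.update (τ r) s 1 else τ r := by
  have hdel : Function.update (Function.update (τ r) s 1) s 0 = τ r := by
    rw [Function.update_idem, ← h0, Function.update_eq_self]
  simp only [den_seq, den_set, den_indep, den_ite, den_skip, Expr.eval_ctr, Expr.eval_const,
    Store.ite_apply, Expr.holds_not, Expr.holds_var, Store.set_row, Store.set_row_of_ne _ _ _ _ hr',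
    hs, supp_update_ne_zero _ _ one_ne_zero, Store.set_row_of_ne _ _ _ _ hr.symm,
    Store.set_row_of_ne _ _ _ _ (show 0 ≠ rAns by simp), hdel, Function.update_self]
  split_ifs <;> simp_all

theorem isBase_of_forall_notMem {N : Matroid (Fin n)} {I : Finset (Fin n)}
    (hI : N.Indep (I : Set (Fin n)))
    (h : ∀ s ∉ I, ¬ N.Indep (insert s I : Finset (Fin n))) : N.IsBase (I : Set (Fin n)) := by
  by_contra hI'
  obtain ⟨B, hB⟩ := N.exists_isBase
  obtain ⟨e, he, heI⟩ := hI.exists_insert_of_not_isBase hI' hB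
  exact h e he.2 (by simpa using heI)

theorem isBase_greedy {m : Fin 2} {r : ℕ} (hr : r ≠ 0) (hr' : r ≠ rAns) {σ : Store}
    (hn : σ 0 0 = n) (h0 : ∀ j, σ r j = 0) :
    (M m).IsBase (supp n ((greedy m r).den M F σ r) : Set (Fin n)) := by
  have hwf : (greedy m r).WellFormed := by
    simp [WellFormed, writes, nested, uses, greedy, hr.symm]
  have key := loop_induction (M := M) (F := F) hwf (σ := σ) (fun i τ => (∀ j, i ≤ j → τ r j = 0) ∧
    (M m).Indep (supp n (τ r) : Set (Fin n)) ∧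
    ∀ s : Fin n, (s : ℕ) < i → s ∉ supp n (τ r) →
      ¬ (M m).Indep (insert s (supp n (τ r)) : Finset (Fin n))) ?_ ?_
  · rw [hn] at key
    exact isBase_of_forall_notMem key.2.1 fun s => key.2.2 s s.2
  · rw [Store.set_row_of_ne _ _ _ _ hr]
    have hempty : supp n (σ r) = ∅ := by ext; simp [h0]
    exact ⟨fun j _ => h0 j, by simp [hempty], by simp⟩
  · intro i hi τ _ hx ⟨hzero, hindep, hmax⟩
    obtain ⟨s, rfl⟩ : ∃ s : Fin n, (s : ℕ) = i := ⟨⟨i, hn ▸ hi⟩, rfl⟩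
    rw [Store.set_row_of_ne _ _ _ _ hr, den_greedy_body m hr hr' hx (hzero s le_rfl)]
    have hlt : ∀ t : Fin n, (t : ℕ) < s + 1 → t ≠ s → (t : ℕ) < s := fun t ht hts => by
      have := Fin.val_ne_of_ne hts
      omega
    split_ifs with hI
    · rw [supp_update_ne_zero _ _ one_ne_zero]
      refine ⟨fun j hj => ?_, hI, fun t ht ht' hI' => ?_⟩
      · rw [Function.update_of_ne (by omega), hzero j (by omega)]
      · rw [Finset.mem_insert, not_or] at ht'
        refine hmax t (hlt t ht ht'.1) ht'.2 (hI'.subset ?_)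
        exact_mod_cast Finset.insert_subset_insert _ (Finset.subset_insert _ _)
    · refine ⟨fun j hj => hzero j (by omega), hindep, fun t ht ht' => ?_⟩
      obtain rfl | hts := eq_or_ne t s
      exacts [hI, hmax t (hlt t ht hts) ht']

end Greedy

section ExchangeGraph

/-- Copy row `r` into row `r'`. -/
def copyRow (x r' r : ℕ) : Cmd := loop x (set r' (.ctr x) (.cell r (.ctr x)))

theorem supp_copyRow {x r r' : ℕ} (hx : x ≠ 0) (hr : r ≠ 0) (hr' : r' ≠ 0) (hrr' : r ≠ r')
    {σ : Store} (hn : σ 0 0 = n) : supp n ((copyRow x r' r).den M F σ r') = supp n (σ r) := by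
  have hwf : (copyRow x r' r).WellFormed := by
    simp [WellFormed, writes, nested, uses, copyRow, hr'.symm, hx]
  refine supp_congr fun j hj => loop_fill hwf hr' (σ r) (fun i _ τ hf hx _ => ?_) j (hn ▸ hj)
  have hτ : τ r = σ r := hf.row_of_ne hr (by simp [writes, hrr'])
  simp [Store.set_row, hx, hτ]

/-- Test whether the element in counter `1` can replace the element in counter `2` in the base of
the matroid number `m` in row `r`. -/
def testExchange (m : Fin 2) (r : ℕ) : Cmd :=
  copyRow 3 rScratch r ;; set rScratch (.ctr 1) (.const 1) ;; set rScratch (.ctr 2) (.const 0) ;;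
    indep m rScratch rAns ;;
    set rAns (.const 0) (.and (.not (.cell r (.ctr 1))) (.and (.cell r (.ctr 2)) (.var rAns)))

theorem testExchange_wf (m : Fin 2) (r : ℕ) : (testExchange m r).WellFormed := by
  simp [WellFormed, writes, nested, uses, copyRow, testExchange]

theorem testExchange_spec (m : Fin 2) {r : ℕ} (hr : r = rB₀ ∨ r = rB₁) {σ : Store}
    (hn : σ 0 0 = n) {u w : Fin n} (hu : σ 0 1 = u) (hw : σ 0 2 = w) :
    (testExchange m r).den M F σ rAns 0 ≠ 0 ↔
      ExchangeArc (M m) (supp n (σ r) : Set (Fin n)) u w := by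
  have hr₀ : r ≠ 0 ∧ r ≠ rScratch ∧ r ≠ rAns := by rcases hr with rfl | rfl <;> simp
  have hwf : (copyRow 3 rScratch r).WellFormed := by
    simp [WellFormed, writes, nested, uses, copyRow]
  have hf := hwf.frame (M := M) (F := F) σ
  have hcopy := supp_copyRow (M := M) (F := F) (x := 3) (r' := rScratch) (by simp) hr₀.1 (by simp)
    hr₀.2.1 hn
  have hrow := hf.row_of_ne hr₀.1 (by simpa [copyRow, writes] using hr₀.2.1)
  have h₁ := (hf.ctr 1 (by simp [uses, copyRow])).trans hu
  have h₂ := (hf.ctr 2 (by simp [uses, copyRow])).trans hw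
  have hne : ∀ (τ : Store) (j v : ℕ), τ.set rAns j v r = τ r ∧ τ.set rAns j v 0 = τ 0 ∧
      τ.set rScratch j v r = τ r ∧ τ.set rScratch j v 0 = τ 0 := fun τ j v =>
    ⟨τ.set_row_of_ne _ _ _ hr₀.2.2, τ.set_row_of_ne _ _ _ (by simp), τ.set_row_of_ne _ _ _ hr₀.2.1,
      τ.set_row_of_ne _ _ _ (by simp)⟩
  simp only [testExchange, den_seq, den_set, den_indep, Expr.eval_ctr, Expr.eval_const, hne, h₁, h₂,
    Store.set_row]
  change Expr.Holds _ _ ↔ _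
  simp only [Expr.holds_and, Expr.holds_not, Expr.holds_cell, Expr.holds_var, Expr.eval_ctr, hne,
    h₁, h₂, hrow, Store.set_row, Function.update_self, supp_update_zero,
    supp_update_ne_zero _ _ one_ne_zero, hcopy, ExchangeArc, SetLike.mem_coe, mem_supp,
    Finset.coe_erase, Finset.coe_insert, ne_eq, ite_eq_right_iff, one_ne_zero, imp_false, not_not]

/-- Record the arcs of the exchange graph in the matrix: the entry at `(u, w)` is `m + 1` if `u`
can replace `w` in the base of the matroid number `m`, and `0` if there is no such `m`. -/
def exchangeGraph : Cmd :=
  loop 1 (loop 2 (testExchange 0 rB₀ ;; ite (.var rAns) (mset (.ctr 1) (.ctr 2) (.const 1))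
    (testExchange 1 rB₁ ;; ite (.var rAns) (mset (.ctr 1) (.ctr 2) (.const 2))
      (mset (.ctr 1) (.ctr 2) (.const 0)))))

open scoped Classical in
/-- The matrix entry that records the arc of the exchange graph from `u` to `w`. -/
noncomputable def label (M : Fin 2 → Matroid (Fin n)) (B : Fin 2 → Finset (Fin n))
    (u w : Fin n) : ℕ :=
  if ExchangeArc (M 0) (B 0 : Set (Fin n)) u w then 1
  else if ExchangeArc (M 1) (B 1 : Set (Fin n)) u w then 2 else 0

theorem exchangeGraph_wf : exchangeGraph.WellFormed := by decide

theorem exchangeGraph_spec {σ : Store} (hn : σ 0 0 = n) (u w : Fin n) :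
    exchangeGraph.den M F σ (100 + u) w = label M (pair n (σ rB₀) (σ rB₁)) u w := by
  classical
  refine loop_loop_fill exchangeGraph_wf hn _ (fun u w ρ hf hu hw a b => ?_) u w
  have hn₀ : ρ 0 0 = n := (hf.ctr 0 rfl).trans hn
  have hf₀ := (testExchange_wf 0 rB₀).frame (M := M) (F := F) ρ
  have hf₁ := (testExchange_wf 1 rB₁).frame (M := M) (F := F) ((testExchange 0 rB₀).den M F ρ)
  have hmat : ∀ m r (τ : Store), (testExchange m r).den M F τ (100 + a) = τ (100 + a) :=
    fun m r τ => den_row (by omega) (by simp [testExchange, writes, copyRow]; omega) _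
  have t₀ := testExchange_spec (M := M) (F := F) 0 (.inl rfl) hn₀ hu hw
  have t₁ := testExchange_spec (M := M) (F := F) 1 (.inr rfl) ((hf₀.ctr 0 rfl).trans hn₀)
    ((hf₀.ctr 1 rfl).trans hu) ((hf₀.ctr 2 rfl).trans hw)
  rw [hf.row_of_ne (r := rB₀) (by simp) rfl] at t₀
  rw [hf₀.row_of_ne (r := rB₁) (by simp) rfl, hf.row_of_ne (r := rB₁) (by simp) rfl] at t₁
  simp only [den_seq, den_ite, den_mset, ite_apply, Expr.holds_var, Expr.eval_ctr, Expr.eval_const,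
    hf₁.ctr 1 rfl, hf₁.ctr 2 rfl, hf₀.ctr 1 rfl, hf₀.ctr 2 rfl, hu, hw,
    Store.set_apply, hmat, t₀, t₁, label, pair_zero, pair_one, Nat.add_left_cancel_iff]
  split_ifs <;> simp_all

end ExchangeGraph

end Cmd

section Distances

variable {n : ℕ} {M : Fin 2 → Matroid (Fin n)} {F : Fin 2 → ExchangeProcedure n}

namespace Cmd

/-- If the vertex `w` in counter `2` has an in-neighbour at the distance `l` in counter `1`, then
give `w` the distance `l + 1`. -/
def relaxVertex : Cmd :=
  loop 3 (ite (.and (.eq (.cell rDist (.ctr 3)) (.ctr 1)) (.mat (.ctr 3) (.ctr 2)))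
    (set rDist (.ctr 2) (.add (.ctr 1) (.const 1))) skip)

/-- Find all vertices at distance `l + 1`, where `l` is in counter `1`. -/
def relaxLevel : Cmd :=
  loop 2 (ite (.eq (.cell rDist (.ctr 2)) (.add (.ctr 0) (.const 1))) relaxVertex skip)

/-- Give the vertices in row `rSrc` the distance `0`, and all others the distance `n + 1`. -/
def initDistances : Cmd :=
  loop 1 (ite (.cell rSrc (.ctr 1)) (set rDist (.ctr 1) (.const 0))
    (set rDist (.ctr 1) (.add (.ctr 0) (.const 1))))

/-- Compute the distances from the set in row `rSrc` in the digraph given by the matrix. -/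
def distances : Cmd := initDistances ;; loop 1 relaxLevel

theorem relaxVertex_wf : relaxVertex.WellFormed := by decide
theorem relaxLevel_wf : relaxLevel.WellFormed := by decide
theorem distances_wf : distances.WellFormed := by decide

theorem relaxVertex_writes (a : ℕ) : relaxVertex.writes (100 + a) = false := by
  simp only [relaxVertex, writes, Bool.or_false, beq_eq_false_iff_ne]
  omega

theorem relaxLevel_writes (a : ℕ) : relaxLevel.writes (100 + a) = false := by
  simp [relaxLevel, writes, relaxVertex_writes]

theorem distances_writes (a : ℕ) : distances.writes (100 + a) = false := by
  simp only [distances, initDistances, writes, relaxLevel_writes, Bool.or_self, Bool.or_false,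
    beq_eq_false_iff_ne]
  omega

open scoped Classical in
theorem relaxVertex_spec {σ : Store} {l w : ℕ} (hl : σ 0 1 = l) (hw : σ 0 2 = w)
    (hd : σ rDist w ≠ l) :
    relaxVertex.den M F σ rDist = if ∃ y < σ 0 0, σ rDist y = l ∧ σ (100 + y) w ≠ 0
      then Function.update (σ rDist) w (l + 1) else σ rDist := by
  refine loop_induction (M := M) (F := F) relaxVertex_wf (σ := σ)
    (fun i τ => τ rDist = if ∃ y < i, σ rDist y = l ∧ σ (100 + y) w ≠ 0
      then Function.update (σ rDist) w (l + 1) else σ rDist) (by simp) fun i _ τ hf hx ih => ?_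
  have hi' : τ rDist i = l ↔ σ rDist i = l := by
    rw [ih]
    split_ifs
    · rw [Function.update_apply]
      grind
    · rfl
  have hmat : τ (100 + i) = σ (100 + i) := hf.row_of_ne (by omega) (relaxVertex_writes i)
  rw [Store.set_row_of_ne _ _ _ _ (by simp)]
  simp only [den_ite, den_set, den_skip, Store.ite_apply, Expr.holds_and, Expr.holds_eq,
    Expr.holds_mat, Expr.eval_cell, Expr.eval_ctr, Expr.eval_add, Expr.eval_const, hx,
    (hf.ctr 1 rfl).trans hl, (hf.ctr 2 rfl).trans hw, hi', hmat, Store.set_row]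
  by_cases hnew : σ rDist i = l ∧ σ (100 + i) w ≠ 0
  · rw [if_pos hnew, if_pos ⟨i, by omega, hnew⟩, ih]
    split_ifs <;> simp
  · rw [if_neg hnew, ih]
    congr 1
    grind

open scoped Classical in
theorem relaxLevel_spec {σ : Store} (hn : σ 0 0 = n) {l : ℕ} (hl : σ 0 1 = l) (hln : l < n)
    (w : Fin n) : relaxLevel.den M F σ rDist w =
      if σ rDist w = n + 1 ∧ ∃ y : Fin n, σ rDist y = l ∧ σ (100 + y) w ≠ 0
      then l + 1 else σ rDist w := by
  refine loop_pointwise (M := M) (F := F) relaxLevel_wf (σ := σ) (· = rDist) (by simp)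
    (fun _ j => if σ rDist j = n + 1 ∧ ∃ y : Fin n, σ rDist y = l ∧ σ (100 + y) j ≠ 0
      then l + 1 else σ rDist j) ?_ rDist rfl w |>.trans (if_pos (hn ▸ w.2))
  rintro i _ τ hf hx hτ _ rfl
  have hmat : ∀ a, τ (100 + a) = σ (100 + a) := fun a =>
    hf.row_of_ne (by omega) (relaxLevel_writes a)
  have hlevel : ∀ y, τ rDist y = l ↔ σ rDist y = l := fun y => by
    rw [hτ rDist rfl y]
    split_ifs <;> omega
  have hi' := hτ rDist rfl i
  rw [if_neg (lt_irrefl i)] at hi'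
  simp only [den_ite, den_skip, Store.ite_apply, Expr.holds_eq, Expr.eval_cell, Expr.eval_ctr,
    Expr.eval_add, Expr.eval_const, hx, (hf.ctr 0 rfl).trans hn, hi']
  by_cases hi₁ : σ rDist i = n + 1
  · rw [if_pos hi₁, relaxVertex_spec ((hf.ctr 1 rfl).trans hl) hx (by omega)]
    simp only [(hf.ctr 0 rfl).trans hn, hlevel, hmat, hi₁, true_and, Fin.exists_iff, exists_prop]
    split_ifs
    · rfl
    · rw [Function.update_eq_self_iff.2 (by rw [hi', hi₁])]
  · rw [if_neg hi₁, if_neg (fun h => hi₁ h.1), ← hi', Function.update_eq_self]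

theorem initDistances_spec {σ : Store} (hn : σ 0 0 = n) (s : Fin n) :
    initDistances.den M F σ rDist s = if σ rSrc s ≠ 0 then 0 else n + 1 := by
  refine loop_fill (M := M) (F := F) (by decide) (by simp)
    (fun j => if σ rSrc j ≠ 0 then 0 else n + 1) (fun i _ τ hf hx _ => ?_) s (hn ▸ s.2)
  simp only [den_ite, den_set, Store.ite_apply, Expr.holds_cell, Expr.eval_ctr, Expr.eval_const,
    Expr.eval_add, hx, hf.row_of_ne (r := rSrc) (by simp) rfl, (hf.ctr 0 rfl).trans hn,
    Store.set_row]
  split_ifs <;> rfl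

theorem distances_spec {σ : Store} (hn : σ 0 0 = n) :
    IsDist (fun u w : Fin n => σ (100 + u) w ≠ 0) (supp n (σ rSrc))
      (fun s => distances.den M F σ rDist s) := by
  set τ₀ := initDistances.den M F σ with hτ₀
  have hf₀ : Frame initDistances σ τ₀ := WellFormed.frame (by decide) σ
  have hn₀ : τ₀ 0 0 = n := (hf₀.ctr 0 rfl).trans hn
  have key := loop_induction (M := M) (F := F) (c := relaxLevel) (x := 1) (by decide) (σ := τ₀)
    (fun l τ => IsPartialDist (fun u w : Fin n => σ (100 + u) w ≠ 0) (supp n (σ rSrc)) l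
      (fun s => τ rDist s)) ?_ fun l hl τ hf hx ih => ?_
  · rw [hn₀] at key
    exact IsPartialDist.isDist (by rwa [Fintype.card_fin])
  · simp only [Store.set_row_of_ne _ _ _ _ (show rDist ≠ 0 by simp), hτ₀, initDistances_spec hn]
    exact isPartialDist_zero (by simp) (by simp)
  · have hn' := (hf.ctr 0 rfl).trans hn₀
    have hmat : ∀ a, τ (100 + a) = σ (100 + a) := fun a =>
      (hf.row_of_ne (by omega) (relaxLevel_writes a)).trans
        (hf₀.row_of_ne (by omega) (by simp [initDistances, writes]; omega))
    rw [Store.set_row_of_ne _ _ _ _ (by simp)]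
    refine ih.relax (by simpa [hn₀] using hl) fun w => ?_
    rw [relaxLevel_spec hn' hx (hn₀ ▸ hl)]
    simp only [hmat, Fintype.card_fin]

end Cmd

end Distances

section Augment

variable {n : ℕ} {M : Fin 2 → Matroid (Fin n)} {F : Fin 2 → ExchangeProcedure n}

namespace Cmd

theorem label_ne_zero {B : Fin 2 → Finset (Fin n)} {u w : Fin n} :
    label M B u w ≠ 0 ↔ ExchangeAdj M B u w := by
  unfold label ExchangeAdj
  rw [Fin.exists_fin_two]
  split_ifs <;> simp_all

theorem exchangeArc_of_label {B : Fin 2 → Finset (Fin n)} {u w : Fin n} (h : ExchangeAdj M B u w) :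
    if label M B u w = 1 then ExchangeArc (M 0) (B 0 : Set (Fin n)) u w
      else ExchangeArc (M 1) (B 1 : Set (Fin n)) u w := by
  rw [← label_ne_zero] at h
  unfold label at h ⊢
  split_ifs at h ⊢ <;> simp_all

/-- The memory contains the exchange graph of the bases `B` and the distances `d` in it. -/
structure StoresGraph (M : Fin 2 → Matroid (Fin n)) (B : Fin 2 → Finset (Fin n)) (d : Fin n → ℕ)
    (σ : Store) : Prop where
  size : σ 0 0 = n
  mat : ∀ u w : Fin n, σ (100 + u) w = label M B u w
  dist : ∀ s : Fin n, σ rDist s = d s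

theorem StoresGraph.of_frame {B : Fin 2 → Finset (Fin n)} {d : Fin n → ℕ} {c : Cmd} {σ τ : Store}
    (h : StoresGraph M B d σ) (hf : Frame c σ τ) (h₀ : c.uses 0 = false)
    (hmat : ∀ a, c.writes (100 + a) = false) (hdist : c.writes rDist = false) :
    StoresGraph M B d τ where
  size := (hf.ctr 0 h₀).trans h.size
  mat u w := by rw [hf.row_of_ne (by omega) (hmat u), h.mat]
  dist s := by rw [hf.row_of_ne (by simp) hdist, h.dist]

/-- Record the arc from the vertex in counter `2` to the vertex in counter `1` if it enters a target
from a smaller distance than the arc found so far. -/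
def tryTarget : Cmd :=
  ite (.and (.cell rTgt (.ctr 1)) (.and (.mat (.ctr 2) (.ctr 1))
      (.lt (.add (.cell rDist (.ctr 2)) (.const 1)) (.var rRem))))
    (set rCur (.const 0) (.ctr 1) ;; set rRem (.const 0) (.add (.cell rDist (.ctr 2)) (.const 1)))
    skip

/-- Find an element of row `rTgt` with an in-neighbour at the smallest possible distance. The length
of the walk found is stored in `rRem`; the length `n + 1` means that there is no such element. -/
def findTarget : Cmd :=
  set rRem (.const 0) (.add (.ctr 0) (.const 1)) ;; loop 1 (loop 2 tryTarget)

theorem findTarget_wf : findTarget.WellFormed := by decide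

theorem tryTarget_writes (a : ℕ) : tryTarget.writes (100 + a) = false := by
  simp only [tryTarget, writes, Bool.or_false, Bool.or_eq_false_iff, beq_eq_false_iff_ne]
  omega

theorem findTarget_writes (a : ℕ) : findTarget.writes (100 + a) = false := by
  simp only [findTarget, writes, tryTarget_writes, Bool.or_false, beq_eq_false_iff_ne]
  omega

variable {B₀ : Fin 2 → Finset (Fin n)} {src : Finset (Fin n)} {d : Fin n → ℕ} {x₀ cur : Fin n}
  {L k : ℕ} {σ : Store}

open scoped Classical in
theorem tryTarget_spec (h : StoresGraph M B₀ d σ) {x y : Fin n} (hx : σ 0 1 = x)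
    (hy : σ 0 2 = y) : tryTarget.den M F σ =
      if x ∈ supp n (σ rTgt) ∧ ExchangeAdj M B₀ y x ∧ d y + 1 < σ rRem 0
      then (σ.set rCur 0 x).set rRem 0 (d y + 1) else σ := by
  simp only [tryTarget, den_ite, den_seq, den_set, den_skip, Expr.holds_and, Expr.holds_cell,
    Expr.holds_mat, Expr.holds_lt, Expr.eval_ctr, Expr.eval_add, Expr.eval_const, Expr.eval_cell,
    Expr.eval_var, hx, hy, mem_supp, h.mat, h.dist, label_ne_zero, ne_eq, Nat.reduceEqDiff,
    not_false_eq_true, Store.set_row_of_ne, OfNat.zero_ne_ofNat]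

theorem findTarget_spec (h : StoresGraph M B₀ d σ) :
    (∀ x ∈ supp n (σ rTgt), ∀ y, ExchangeAdj M B₀ y x →
      findTarget.den M F σ rRem 0 ≤ d y + 1) ∧
    (findTarget.den M F σ rRem 0 = n + 1 ∨ findTarget.den M F σ rRem 0 ≤ n ∧
      ∃ x ∈ supp n (σ rTgt), ∃ y, ExchangeAdj M B₀ y x ∧ findTarget.den M F σ rCur 0 = x ∧
        findTarget.den M F σ rRem 0 = d y + 1) := by
  let init := set rRem (.const 0) (.add (.ctr 0) (.const 1))
  have hf₀ : Frame init σ (init.den M F σ) := WellFormed.frame (by decide) σ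
  have h₀ := h.of_frame hf₀ rfl
    (fun a => by simp only [init, writes, beq_eq_false_iff_ne]; omega) rfl
  have key := loop_loop_induction (M := M) (F := F) findTarget_wf.seq_right h₀.size
    (fun S τ => (∀ p ∈ S, p.1 ∈ supp n (σ rTgt) → ExchangeAdj M B₀ p.2 p.1 →
        τ rRem 0 ≤ d p.2 + 1) ∧
      (τ rRem 0 = n + 1 ∨ τ rRem 0 ≤ n ∧ ∃ x ∈ supp n (σ rTgt), ∃ y, ExchangeAdj M B₀ y x ∧
        τ rCur 0 = x ∧ τ rRem 0 = d y + 1))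
    (by simp [init, Store.set_row, h.size]) (by simp) ?_
  · exact ⟨fun x hx y => key.1 (x, y) (Finset.mem_univ _) hx, key.2⟩
  intro S τ x y hf hx hy ⟨hle, hex⟩
  rw [tryTarget_spec (h₀.of_frame hf rfl tryTarget_writes rfl) hx hy,
    hf.row_of_ne (r := rTgt) (by simp) rfl, hf₀.row_of_ne (r := rTgt) (by simp) rfl]
  split_ifs with hnew
  · have hn : τ rRem 0 ≤ n + 1 := by omega
    simp only [Store.set_row, Function.update_self, Store.set_row_of_ne _ _ _ _
      (show rCur ≠ rRem by simp), Finset.forall_mem_insert]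
    refine ⟨⟨fun _ _ => le_rfl, fun p hp hx hy => hnew.2.2.le.trans (hle p hp hx hy)⟩,
      .inr ⟨by omega, x, hnew.1, y, hnew.2.1, rfl, rfl⟩⟩
  · rw [Finset.forall_mem_insert]
    exact ⟨⟨fun hx hy => not_lt.1 fun hlt => hnew ⟨hx, hy, hlt⟩, hle⟩, hex⟩

/-- Find a predecessor of the current vertex on a shortest walk. -/
def findPred : Cmd :=
  loop 2 (ite (.and (.eq (.add (.cell rDist (.ctr 2)) (.const 1)) (.var rRem))
    (.mat (.ctr 2) (.var rCur))) (set rPtr (.const 0) (.ctr 2)) skip)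

/-- Make the exchange belonging to the arc from `rPtr` to `rCur`. -/
def exchangeStep : Cmd :=
  ite (.eq (.mat (.var rPtr) (.var rCur)) (.const 1))
    (set rB₀ (.var rPtr) (.const 1) ;; set rB₀ (.var rCur) (.const 0))
    (set rB₁ (.var rPtr) (.const 1) ;; set rB₁ (.var rCur) (.const 0))

/-- Make the exchange belonging to the last arc of a shortest walk to the current vertex, and go to
its beginning. -/
def walkStep : Cmd :=
  findPred ;; exchangeStep ;; set rCur (.const 0) (.var rPtr) ;;
    set rRem (.const 0) (.sub (.var rRem) (.const 1))

/-- Follow a shortest walk backwards, making the exchanges along it. -/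
def walk : Cmd := loop 1 (ite (.lt (.const 0) (.var rRem)) walkStep skip)

theorem findPred_wf : findPred.WellFormed := by decide
theorem exchangeStep_wf : exchangeStep.WellFormed := by decide
theorem walk_wf : walk.WellFormed := by decide

theorem findPred_writes (a : ℕ) : findPred.writes (100 + a) = false := by
  simp only [findPred, writes, Bool.or_false, beq_eq_false_iff_ne]
  omega

theorem walk_writes (a : ℕ) : walk.writes (100 + a) = false := by
  simp only [walk, walkStep, findPred_writes, exchangeStep, writes, Bool.or_false, Bool.false_or,
    Bool.or_eq_false_iff, beq_eq_false_iff_ne]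
  omega

theorem findPred_spec (h : StoresGraph M B₀ d σ) (hcur : σ rCur 0 = cur) (hrem : σ rRem 0 = k + 1)
    (hpred : ∃ y, d y = k ∧ ExchangeAdj M B₀ y cur) :
    ∃ y : Fin n, findPred.den M F σ rPtr 0 = y ∧ d y = k ∧ ExchangeAdj M B₀ y cur := by
  classical
  have key := loop_induction (M := M) (F := F) findPred_wf (σ := σ)
    (fun i τ => (∃ y : Fin n, y < i ∧ d y = k ∧ ExchangeAdj M B₀ y cur) →
      ∃ y : Fin n, τ rPtr 0 = y ∧ d y = k ∧ ExchangeAdj M B₀ y cur) (by simp)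
    fun i hi τ hf hx ih hex => ?_
  · obtain ⟨y, hy⟩ := hpred
    exact key ⟨y, h.size ▸ y.2, hy⟩
  lift i to Fin n using h.size ▸ hi
  have hτ := h.of_frame hf rfl findPred_writes rfl
  rw [Store.set_row_of_ne _ _ _ _ (by simp)]
  simp only [den_ite, den_set, den_skip, Store.ite_apply, Expr.holds_and, Expr.holds_mat,
    Expr.holds_eq, Expr.eval_ctr, Expr.eval_add, Expr.eval_const, Expr.eval_var, Expr.eval_cell, hx,
    hτ.dist, hτ.mat, hf.row_of_ne (r := rCur) (by simp) rfl, hcur, label_ne_zero,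
    hf.row_of_ne (r := rRem) (by simp) rfl, hrem, Nat.add_right_cancel_iff, Store.set_row]
  split_ifs with hi'
  · exact ⟨i, by simp, hi'⟩
  · obtain ⟨y, hy, hy'⟩ := hex
    have hyi : y ≠ i := fun h => hi' (h ▸ hy')
    exact ih ⟨y, by have := Fin.val_ne_of_ne hyi; omega, hy'⟩

theorem pair_update_zero (ρ₀ ρ₁ ρ : ℕ → ℕ) :
    pair n ρ ρ₁ = Function.update (pair n ρ₀ ρ₁) 0 (supp n ρ) := by
  funext m
  fin_cases m <;> simp [pair]

theorem pair_update_one (ρ₀ ρ₁ ρ : ℕ → ℕ) :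
    pair n ρ₀ ρ = Function.update (pair n ρ₀ ρ₁) 1 (supp n ρ) := by
  funext m
  fin_cases m <;> simp [pair]

theorem exchangeStep_spec (h : StoresGraph M B₀ d σ) {y : Fin n} (hptr : σ rPtr 0 = y)
    (hcur : σ rCur 0 = cur) (hadj : ExchangeAdj M B₀ y cur) :
    ∃ m, ExchangeArc (M m) (B₀ m : Set (Fin n)) y cur ∧
      pair n (exchangeStep.den M F σ rB₀) (exchangeStep.den M F σ rB₁)
        = Function.update (pair n (σ rB₀) (σ rB₁)) m
            ((insert y (pair n (σ rB₀) (σ rB₁) m)).erase cur) := by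
  have harc := exchangeArc_of_label hadj
  simp only [exchangeStep, den_ite, den_seq, den_set, Expr.holds_eq, Expr.eval_mat, Expr.eval_var,
    Expr.eval_const, hptr, hcur, h.mat, ne_eq, Nat.reduceEqDiff, not_false_eq_true,
    Store.set_row_of_ne]
  split_ifs at harc ⊢
  · refine ⟨0, harc, ?_⟩
    rw [pair_update_zero (σ rB₀)]
    simp [Store.set_row, supp_update_zero, supp_update_ne_zero]
  · refine ⟨1, harc, ?_⟩
    rw [pair_update_one _ (σ rB₁)]
    simp [Store.set_row, supp_update_zero, supp_update_ne_zero]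

/-- The situation when a shortest walk of length `L` ending in `x₀` has been followed backwards, and
the first `k` of its arcs remain. -/
structure WalkState (M : Fin 2 → Matroid (Fin n)) (B₀ : Fin 2 → Finset (Fin n)) (d : Fin n → ℕ)
    (x₀ : Fin n) (L k : ℕ) (cur : Fin n) (σ : Store) : Prop where
  cur_eq : σ rCur 0 = cur
  rem_eq : σ rRem 0 = k
  walk : WalkInvariant M B₀ d x₀ L (pair n (σ rB₀) (σ rB₁)) cur k
  dist_eq_zero : k = 0 → d cur = 0
  exists_pred : ∀ j, k = j + 1 → ∃ y, d y = j ∧ ExchangeAdj M B₀ y cur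

theorem walkStep_spec (hd : IsDist (ExchangeAdj M B₀) src d) (h : StoresGraph M B₀ d σ)
    (hw : WalkState M B₀ d x₀ L (k + 1) cur σ) (hk : k < n) :
    ∃ y, WalkState M B₀ d x₀ L k y (walkStep.den M F σ) := by
  have hn : Fintype.card (Fin n) = n := Fintype.card_fin n
  obtain ⟨y, hptr, hy, hadj⟩ :=
    findPred_spec (M := M) (F := F) h hw.cur_eq hw.rem_eq (hw.exists_pred k rfl)
  set ρ := findPred.den M F σ with hρ
  have hf : Frame findPred σ ρ := findPred_wf.frame σ
  have hf' : Frame exchangeStep ρ (exchangeStep.den M F ρ) := exchangeStep_wf.frame ρ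
  obtain ⟨m, harc, hpair⟩ := exchangeStep_spec (M := M) (F := F)
    (h.of_frame hf rfl findPred_writes rfl) hptr
    ((congrFun (hf.row_of_ne (by simp) rfl) 0).trans hw.cur_eq) hadj
  rw [hf.row_of_ne (r := rB₀) (by simp) rfl, hf.row_of_ne (r := rB₁) (by simp) rfl] at hpair
  refine ⟨y, ⟨?_, ?_, ?_, fun h0 => hy.trans h0, fun j hj => ?_⟩⟩
  · simp [walkStep, ← hρ, Store.set_row, hf'.row_of_ne (r := rPtr) (by simp) rfl, hptr]
  · simp [walkStep, ← hρ, Store.set_row, hf'.row_of_ne (r := rRem) (by simp) rfl,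
      hf.row_of_ne (r := rRem) (by simp) rfl, hw.rem_eq]
  · simp only [walkStep, den_seq, den_set, ← hρ, ne_eq, Nat.reduceEqDiff, not_false_eq_true,
      Store.set_row_of_ne, hpair]
    refine hw.walk.step hy harc fun z hz => ?_
    by_cases hzn : d z < n
    · exact hy ▸ hd.step z y hz (hn.symm ▸ hzn)
    · omega
  · exact hd.pred y j (hy.trans hj) (by omega)

theorem walk_spec (hd : IsDist (ExchangeAdj M B₀) src d) (h : StoresGraph M B₀ d σ) (hL : L ≤ n)
    (hw : WalkState M B₀ d x₀ L L x₀ σ) :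
    ∃ cur ∈ src, WalkInvariant M B₀ d x₀ L
      (pair n (walk.den M F σ rB₀) (walk.den M F σ rB₁)) cur 0 := by
  classical
  have hset : ∀ {k cur τ z v}, WalkState M B₀ d x₀ L k cur τ →
      WalkState M B₀ d x₀ L k cur (τ.set 0 z v) := fun ⟨h₁, h₂, h₃, h₄, h₅⟩ =>
    ⟨by simpa, by simpa, by simpa, h₄, h₅⟩
  have key := loop_induction (M := M) (F := F) walk_wf (σ := σ)
    (fun i τ => ∃ cur, WalkState M B₀ d x₀ L (L - i) cur τ) ⟨x₀, hset hw⟩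
    fun i _ τ hf _ ⟨cur, ih⟩ => ?_
  · rw [h.size, Nat.sub_eq_zero_of_le hL] at key
    obtain ⟨cur, key⟩ := key
    exact ⟨cur, (hd.zero cur).1 (key.dist_eq_zero rfl), key.walk⟩
  simp only [den_ite, Expr.holds_lt, Expr.eval_const, Expr.eval_var, ih.rem_eq, den_skip]
  split_ifs with hrem
  · rw [show L - i = L - (i + 1) + 1 by omega] at ih
    obtain ⟨y, hy⟩ := walkStep_spec (F := F) hd (h.of_frame hf rfl walk_writes rfl) ih (by omega)
    exact ⟨y, hset hy⟩
  · rw [show L - (i + 1) = L - i by omega]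
    exact ⟨cur, hset ih⟩

/-- Set `rFound` if there is a walk to row `rTgt` with at least one arc, and make the exchanges
along a shortest such walk. -/
def augment : Cmd :=
  findTarget ;; set rFound (.const 0) (.lt (.var rRem) (.add (.ctr 0) (.const 1))) ;;
    ite (.var rFound) walk skip

open scoped Classical in
theorem den_augment (hn : σ 0 0 = n) : augment.den M F σ =
    if findTarget.den M F σ rRem 0 < n + 1
      then walk.den M F ((findTarget.den M F σ).set rFound 0 1)
      else (findTarget.den M F σ).set rFound 0 0 := by
  have h0 : findTarget.den M F σ 0 0 = n := ((findTarget_wf.frame σ).ctr 0 rfl).trans hn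
  simp only [augment, den_seq, den_set, den_ite, Expr.holds_var, Expr.eval_lt, Expr.eval_var,
    Expr.eval_add, Expr.eval_ctr, Expr.eval_const, den_skip, Store.set_row, h0]
  split_ifs <;> simp_all

theorem augment_spec (hd : IsDist (ExchangeAdj M B₀) src d) (h : StoresGraph M B₀ d σ)
    (hB : pair n (σ rB₀) (σ rB₁) = B₀) (hB₀ : ∀ m, (M m).IsBase (B₀ m : Set (Fin n))) :
    (augment.den M F σ rFound 0 = 0 ∧ augment.den M F σ rB₀ = σ rB₀ ∧
      augment.den M F σ rB₁ = σ rB₁ ∧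
      ∀ x ∈ supp n (σ rTgt), ∀ y, ExchangeAdj M B₀ y x → y ∉ reached d) ∨
    (augment.den M F σ rFound 0 = 1 ∧ ∃ x ∈ supp n (σ rTgt), ∃ y ∈ reached d,
      ExchangeAdj M B₀ y x ∧ ∃ L ≠ 0, ∃ cur ∈ src, WalkInvariant M B₀ d x L
        (pair n (augment.den M F σ rB₀) (augment.den M F σ rB₁)) cur 0) := by
  have hn : Fintype.card (Fin n) = n := Fintype.card_fin n
  have htarget := findTarget_spec (M := M) (F := F) h
  have hf : Frame findTarget σ (findTarget.den M F σ) := findTarget_wf.frame σ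
  rw [den_augment h.size]
  set τ := findTarget.den M F σ
  have hb₀ : τ rB₀ = σ rB₀ := hf.row_of_ne (by simp) rfl
  have hb₁ : τ rB₁ = σ rB₁ := hf.row_of_ne (by simp) rfl
  obtain ⟨hmin, hnone | ⟨hle, x, hx, y, hyx, hcur, hrem⟩⟩ := htarget
  · left
    rw [if_neg (by omega)]
    refine ⟨by simp [Store.set_row], by simp [hb₀], by simp [hb₁], fun x hx y hyx hy => ?_⟩
    have := hd.lt_card hy
    have := hmin x hx y hyx
    omega
  · right
    have hg : StoresGraph M B₀ d (τ.set rFound 0 1) := by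
      obtain ⟨h₁, h₂, h₃⟩ := h.of_frame hf rfl findTarget_writes rfl
      exact ⟨by simpa, fun u w => by rw [Store.set_row_of_ne _ _ _ _ (by omega), h₂], by simpa⟩
    have hw : WalkState M B₀ d x (d y + 1) (d y + 1) x (τ.set rFound 0 1) := by
      refine ⟨by simpa, by simpa, ?_, by simp, fun j hj => ⟨y, by omega, hyx⟩⟩
      simpa [hb₀, hb₁, hB] using WalkInvariant.init hB₀ fun z hz => hrem ▸ hmin x hx z hz
    obtain ⟨cur, hcur, hwalk⟩ := walk_spec (M := M) (F := F) hd hg (by omega) hw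
    rw [if_pos (by omega)]
    refine ⟨?_, x, hx, y, by rw [mem_reached]; omega, hyx, d y + 1, by omega, cur, hcur, hwalk⟩
    rw [den_row (by simp) rfl, Store.set_row, Function.update_self]

/-- Look for a walk from row `rSrc` to row `rTgt` in the exchange graph and make the exchanges along
it. -/
def search : Cmd := distances ;; augment

theorem search_wf : search.WellFormed := by decide

theorem search_spec (hn : σ 0 0 = n) (hB : pair n (σ rB₀) (σ rB₁) = B₀)
    (hB₀ : ∀ m, (M m).IsBase (B₀ m : Set (Fin n)))
    (hmat : ∀ u w : Fin n, σ (100 + u) w = label M B₀ u w) :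
    ∃ d, IsDist (ExchangeAdj M B₀) (supp n (σ rSrc)) d ∧
      (∀ s : Fin n, search.den M F σ rDist s = d s) ∧
      ((search.den M F σ rFound 0 = 0 ∧ search.den M F σ rB₀ = σ rB₀ ∧
        search.den M F σ rB₁ = σ rB₁ ∧
        ∀ x ∈ supp n (σ rTgt), ∀ y, ExchangeAdj M B₀ y x → y ∉ reached d) ∨
      (search.den M F σ rFound 0 = 1 ∧ ∃ x ∈ supp n (σ rTgt), ∃ y ∈ reached d,
        ExchangeAdj M B₀ y x ∧ ∃ L ≠ 0, ∃ cur ∈ supp n (σ rSrc), WalkInvariant M B₀ d x L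
          (pair n (search.den M F σ rB₀) (search.den M F σ rB₁)) cur 0)) := by
  have hadj : (fun u w : Fin n => σ (100 + u) w ≠ 0) = ExchangeAdj M B₀ := by
    simp only [hmat, label_ne_zero]
  have hd := hadj ▸ distances_spec (M := M) (F := F) hn
  have hf : Frame distances σ (distances.den M F σ) := distances_wf.frame σ
  have hg : StoresGraph M B₀ _ (distances.den M F σ) :=
    ⟨(hf.ctr 0 rfl).trans hn, fun u w => by
      rw [hf.row_of_ne (by omega) (distances_writes u), hmat], fun s => rfl⟩
  have haug := augment_spec (F := F) hd hg
  rw [hf.row_of_ne (r := rB₀) (by simp) rfl, hf.row_of_ne (r := rB₁) (by simp) rfl,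
    hf.row_of_ne (r := rTgt) (by simp) rfl] at haug
  exact ⟨_, hd, fun s => by rw [search, den_seq, den_row (by simp) rfl], haug hB hB₀⟩

end Cmd

end Augment

section Search

variable {n : ℕ} {M : Fin 2 → Matroid (Fin n)} {F : Fin 2 → ExchangeProcedure n}
  {B : Fin 2 → Finset (Fin n)} {σ : Store} {v : Fin n}

namespace Cmd

/-- Make the elements satisfying `e` the sources and those satisfying `f` the targets. -/
def mark (e f : Expr) : Cmd := loop 1 (set rSrc (.ctr 1) e ;; set rTgt (.ctr 1) f)

theorem mark_wf (e f : Expr) : (mark e f).WellFormed := ⟨rfl, rfl⟩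

theorem mark_writes (e f : Expr) (a : ℕ) : (mark e f).writes (100 + a) = false := by
  simp only [mark, writes, Bool.or_eq_false_iff, beq_eq_false_iff_ne]
  omega

theorem supp_mark {e f : Expr} (hn : σ 0 0 = n) {S T : Finset (Fin n)}
    (he : ∀ τ, Frame (mark e f) σ τ → ∀ s : Fin n, τ 0 1 = s → (e.Holds τ ↔ s ∈ S))
    (hf : ∀ τ, Frame (mark e f) σ τ → ∀ s : Fin n, τ 0 1 = s → (f.Holds τ ↔ s ∈ T)) :
    supp n ((mark e f).den M F σ rSrc) = S ∧ supp n ((mark e f).den M F σ rTgt) = T := by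
  have key := loop_induction (M := M) (F := F) (mark_wf e f) (σ := σ) (fun i τ =>
    ∀ s : Fin n, s < i → (τ rSrc s ≠ 0 ↔ s ∈ S) ∧ (τ rTgt s ≠ 0 ↔ s ∈ T)) (by simp) ?_
  · rw [hn] at key
    constructor <;> ext s
    · exact mem_supp.trans (key s s.2).1
    · exact mem_supp.trans (key s s.2).2
  intro i hi τ hτ hx ih s hs
  lift i to Fin n using hn ▸ hi
  have hτ' : Frame (mark e f) σ (τ.set rSrc i (e.eval τ)) := by
    refine hτ.trans ⟨fun r hr => Store.set_row_of_ne _ _ _ _ fun h => ?_, by simp⟩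
    simp [writes, h] at hr
  simp only [den_seq, den_set, Expr.eval_ctr, hx, ne_eq, Nat.reduceEqDiff, not_false_eq_true,
    OfNat.zero_ne_ofNat, OfNat.ofNat_ne_zero, Store.set_row_of_ne, Store.set_row,
    Function.update_apply, Fin.val_inj]
  split_ifs with hsi
  · rw [hsi]
    exact ⟨he τ hτ i hx, hf _ hτ' i (by simpa using hx)⟩
  · exact ih s (by have := Fin.val_ne_of_ne hsi; omega)

/-- The sources are the elements in neither base, the targets those in both bases. -/
def markEnds : Cmd :=
  mark (.and (.not (.cell rB₀ (.ctr 1))) (.not (.cell rB₁ (.ctr 1))))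
    (.and (.cell rB₀ (.ctr 1)) (.cell rB₁ (.ctr 1)))

theorem markEnds_spec (hn : σ 0 0 = n) (hB : pair n (σ rB₀) (σ rB₁) = B) :
    supp n (markEnds.den M F σ rSrc) = Finset.univ.filter (mult B · = 0) ∧
      supp n (markEnds.den M F σ rTgt) = Finset.univ.filter (1 < mult B ·) := by
  refine supp_mark hn (fun τ hf s hs => ?_) fun τ hf s hs => ?_ <;>
  · rw [← hB, Finset.mem_filter_univ, mult_fin_two]
    simp only [Expr.holds_and, Expr.holds_not, Expr.holds_cell, Expr.eval_ctr, hs, pair_zero,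
      pair_one, mem_supp, hf.row_of_ne (r := rB₀) (by simp) rfl,
      hf.row_of_ne (r := rB₁) (by simp) rfl]
    split_ifs <;> simp_all

/-- Look for bases of the two matroids with a larger union. -/
def enlarge : Cmd := exchangeGraph ;; markEnds ;; search

/-- Compute bases of the two matroids with a union of maximum size. -/
def cover : Cmd := greedy 0 rB₀ ;; greedy 1 rB₁ ;; loop 5 enlarge

theorem cover_wf : cover.WellFormed := by decide

theorem enlarge_spec (hn : σ 0 0 = n) (hB : pair n (σ rB₀) (σ rB₁) = B)
    (hB₀ : ∀ m, (M m).IsBase (B m : Set (Fin n))) {B' : Fin 2 → Finset (Fin n)}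
    (hB' : pair n (enlarge.den M F σ rB₀) (enlarge.den M F σ rB₁) = B') :
    (∀ m, (M m).IsBase (B' m : Set (Fin n))) ∧ (IsCovering M B' ∨
      (Finset.univ.biUnion B').card = (Finset.univ.biUnion B).card + 1) := by
  have hf₁ : Frame exchangeGraph σ (exchangeGraph.den M F σ) := exchangeGraph_wf.frame σ
  have hB₁ : pair n (exchangeGraph.den M F σ rB₀) (exchangeGraph.den M F σ rB₁) = B := by
    rw [hf₁.row_of_ne (r := rB₀) (by simp) rfl, hf₁.row_of_ne (r := rB₁) (by simp) rfl, hB]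
  have hn₁ := (hf₁.ctr 0 rfl).trans hn
  obtain ⟨hsrc, htgt⟩ := markEnds_spec (M := M) (F := F) hn₁ hB₁
  have hf₂ : Frame markEnds _ (markEnds.den M F (exchangeGraph.den M F σ)) := (mark_wf _ _).frame _
  have hB₂ := hB₁
  rw [← hf₂.row_of_ne (r := rB₀) (by simp) rfl, ← hf₂.row_of_ne (r := rB₁) (by simp) rfl] at hB₂
  obtain ⟨d, hd, -, h⟩ := search_spec (M := M) (F := F) ((hf₂.ctr 0 rfl).trans hn₁) hB₂ hB₀
    (fun u w => by
      rw [hf₂.row_of_ne (by omega) (mark_writes _ _ u), exchangeGraph_spec (F := F) hn u w, hB])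
  rw [hsrc] at hd h
  rw [htgt] at h
  simp only [Finset.mem_filter_univ] at h
  rcases h with ⟨-, h₁, h₂, h₃⟩ | ⟨-, x, hx, -, -, -, L, -, cur, hcur, hw⟩
  · obtain rfl : B' = B := by rw [← hB', enlarge, den_seq, den_seq, h₁, h₂, hB₂]
    refine ⟨hB₀, .inl (isCovering_of_closed hB₀ (Z := reached d)
      (fun m u w harc => hd.mem_reached_of_adj ⟨m, harc⟩)
      (fun s hs => hd.subset_reached (by simpa using hs)) fun s hs => not_lt.1 fun hs' => ?_)⟩
    obtain ⟨y, hy, hys⟩ := hd.exists_pred hs (by simp; omega)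
    exact h₃ s hs' y hys hy
  · rw [enlarge, den_seq, den_seq] at hB'
    rw [hB'] at hw
    refine ⟨hw.isBase, .inr ?_⟩
    rw [hw.biUnion_eq_insert hx, Finset.card_insert_of_notMem]
    simpa [mult_eq_zero] using hcur

theorem cover_spec (hn : σ 0 0 = n) (h₀ : ∀ j, σ rB₀ j = 0) (h₁ : ∀ j, σ rB₁ j = 0)
    (hB : pair n (cover.den M F σ rB₀) (cover.den M F σ rB₁) = B) :
    (∀ m, (M m).IsBase (B m : Set (Fin n))) ∧ IsCovering M B := by
  have hf₁ := WellFormed.frame (M := M) (F := F) (c := greedy 0 rB₀) (by decide) σ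
  have g₀ := isBase_greedy (M := M) (F := F) (m := 0) (r := rB₀) (by simp) (by simp) hn h₀
  have hn₁ := (hf₁.ctr 0 rfl).trans hn
  have hf₂ := WellFormed.frame (M := M) (F := F) (c := greedy 1 rB₁) (by decide)
    ((greedy 0 rB₀).den M F σ)
  have g₁ := isBase_greedy (M := M) (F := F) (m := 1) (r := rB₁) (by simp) (by simp) hn₁
    (by rwa [hf₁.row_of_ne (by simp) rfl])
  have hn₂ := (hf₂.ctr 0 rfl).trans hn₁
  rw [← hf₂.row_of_ne (r := rB₀) (by simp) rfl] at g₀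
  have key := loop_induction (M := M) (F := F) cover_wf.seq_right.seq_right
    (σ := (greedy 1 rB₁).den M F ((greedy 0 rB₀).den M F σ)) (fun i τ => ∀ B,
      pair n (τ rB₀) (τ rB₁) = B → (∀ m, (M m).IsBase (B m : Set (Fin n))) ∧
        (IsCovering M B ∨ i ≤ (Finset.univ.biUnion B).card)) ?_ ?_
  · obtain ⟨hbase, hcov⟩ := key B hB
    refine ⟨hbase, hcov.elim id fun hcard => isCovering_of_card_univ_le ?_⟩
    rw [hn₂] at hcard
    rwa [Fintype.card_fin]
  · rintro _ rfl
    refine ⟨fun m => ?_, .inr (Nat.zero_le _)⟩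
    fin_cases m
    · simpa using g₀
    · simpa using g₁
  · intro i _ τ hf _ ih B' hB'
    obtain ⟨hbase, hcov⟩ := ih _ rfl
    obtain ⟨hbase', hcov'⟩ := enlarge_spec (F := F) ((hf.ctr 0 rfl).trans hn₂) rfl hbase hB'
    refine ⟨hbase', hcov'.elim .inl fun hcard => ?_⟩
    exact hcov.imp (fun h => h.mono (by omega)) fun h => by omega

/-- Make the vertex in counter `6` the only source and the only target. -/
def markVertex : Cmd := mark (.eq (.ctr 1) (.ctr 6)) (.eq (.ctr 1) (.ctr 6))

/-- Count the vertices at finite distance. -/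
def countReached : Cmd :=
  set rCount (.ctr 6) (.const 0) ;;
  loop 1 (ite (.lt (.cell rDist (.ctr 1)) (.add (.ctr 0) (.const 1)))
    (set rCount (.ctr 6) (.add (.cell rCount (.ctr 6)) (.const 1))) skip)

theorem countReached_wf : countReached.WellFormed := by decide

theorem countReached_spec (hn : σ 0 0 = n) :
    countReached.den M F σ rCount = Function.update (σ rCount) (σ 0 6)
      (reached fun s : Fin n => σ rDist s).card := by
  let R (i : ℕ) : Finset (Fin n) := (reached fun s : Fin n => σ rDist s).filter (· < i)
  have hf₀ : Frame countReached σ (σ.set rCount (σ 0 6) 0) :=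
    ⟨fun r hr => Store.set_row_of_ne _ _ _ _ fun h => by simp [h, countReached, writes] at hr,
      by simp⟩
  have key := loop_induction (M := M) (F := F) countReached_wf.seq_right
    (σ := σ.set rCount (σ 0 6) 0)
    (fun i τ => τ rCount = Function.update (σ rCount) (σ 0 6) (R i).card) ?_ ?_
  · rw [Store.set_row_of_ne _ _ _ _ (by simp), hn] at key
    simp only [R, Fin.is_lt, Finset.filter_true] at key
    exact key
  · simp [R, Store.set_row]
  · intro i hi τ hf hx ih
    rw [Store.set_row_of_ne _ _ _ _ (by simp), hn] at hi
    lift i to Fin n using hi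
    have hdist : τ rDist = σ rDist := (hf.row_of_ne (by simp) rfl).trans
      (hf₀.row_of_ne (by simp) rfl)
    have hn' : τ 0 0 = n := ((hf.ctr 0 rfl).trans (hf₀.ctr 0 rfl)).trans hn
    have hv : τ 0 6 = σ 0 6 := (hf.ctr 6 rfl).trans (hf₀.ctr 6 rfl)
    have hcard : (R (i + 1)).card = (R i).card + if σ rDist i < n + 1 then 1 else 0 := by
      have : R (i + 1) = R i ∪ if σ rDist i < n + 1 then {i} else ∅ := by
        ext x
        simp only [R, Finset.mem_filter, mem_reached, Fintype.card_fin, Finset.mem_union]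
        rcases eq_or_ne x i with rfl | hxi
        · split_ifs <;> simp <;> omega
        · have := Fin.val_ne_of_ne hxi
          split_ifs <;> simp [hxi] <;> omega
      rw [this, Finset.card_union_of_disjoint] <;> split_ifs <;> simp [R]
    rw [Store.set_row_of_ne _ _ _ _ (by simp), hcard]
    simp only [den_ite, den_set, den_skip, Store.ite_apply, Expr.holds_lt, Expr.eval_cell,
      Expr.eval_ctr, Expr.eval_add, Expr.eval_const, hx, hdist, hn', hv, Store.set_row, ih,
      Function.update_self, Function.update_idem]
    split_ifs <;> rfl

/-- Search for a closed walk through the vertex in counter `6`. -/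
def probe : Cmd := markVertex ;; search ;; countReached

/-- Search for a closed walk in the exchange graph and make the exchanges along it. -/
def scan : Cmd :=
  exchangeGraph ;; set rFound (.const 0) (.const 0) ;; loop 6 (ite (.not (.var rFound)) probe skip)

theorem scan_wf : scan.WellFormed := by decide

theorem probe_writes (a : ℕ) : probe.writes (100 + a) = false := by
  simp only [probe, markVertex, search, augment, countReached, writes, mark_writes,
    distances_writes, findTarget_writes, walk_writes, Bool.false_or, Bool.or_false,
    Bool.or_eq_false_iff, beq_eq_false_iff_ne]
  omega

theorem probe_spec (hn : σ 0 0 = n) (hB : pair n (σ rB₀) (σ rB₁) = B)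
    (hB₀ : ∀ m, (M m).IsBase (B m : Set (Fin n)))
    (hmat : ∀ u w : Fin n, σ (100 + u) w = label M B u w) (hv : σ 0 6 = v) :
    (probe.den M F σ rFound 0 = 0 ∧ probe.den M F σ rB₀ = σ rB₀ ∧
      probe.den M F σ rB₁ = σ rB₁ ∧ ∃ k, IsAcyclicAt (ExchangeAdj M B) v k ∧
        probe.den M F σ rCount = Function.update (σ rCount) v k) ∨
    (probe.den M F σ rFound 0 = 1 ∧
      IsRotation M B (pair n (probe.den M F σ rB₀) (probe.den M F σ rB₁))) := by
  have hmark : ∀ τ, Frame markVertex σ τ → ∀ s : Fin n, τ 0 1 = s →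
      (Expr.Holds τ (.eq (.ctr 1) (.ctr 6)) ↔ s ∈ ({v} : Finset (Fin n))) := fun τ hf s hs => by
    simp [hs, (hf.ctr 6 rfl).trans hv, Fin.ext_iff]
  obtain ⟨hsrc, htgt⟩ := supp_mark (M := M) (F := F) hn hmark hmark
  have hf₁ : Frame markVertex σ (markVertex.den M F σ) := (mark_wf _ _).frame σ
  have hn₁ := (hf₁.ctr 0 rfl).trans hn
  have hf₂ := search_wf.frame (M := M) (F := F) (markVertex.den M F σ)
  have hf₃ := countReached_wf.frame (M := M) (F := F) (search.den M F (markVertex.den M F σ))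
  obtain ⟨d, hd, hdist, h⟩ := search_spec (M := M) (F := F) hn₁ (B₀ := B)
    (by rw [hf₁.row_of_ne (r := rB₀) (by simp) rfl, hf₁.row_of_ne (r := rB₁) (by simp) rfl, hB])
    hB₀ fun u w => by rw [hf₁.row_of_ne (by omega) (mark_writes _ _ u), hmat]
  have hcount := countReached_spec (M := M) (F := F) ((hf₂.ctr 0 rfl).trans hn₁)
  rw [((hf₂.ctr 6 rfl).trans (hf₁.ctr 6 rfl)).trans hv, hf₂.row_of_ne (r := rCount) (by simp) rfl,
    hf₁.row_of_ne (r := rCount) (by simp) rfl, funext hdist] at hcount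
  rw [hf₁.row_of_ne (r := rB₀) (by simp) rfl, hf₁.row_of_ne (r := rB₁) (by simp) rfl] at h
  simp only [probe, den_seq, hf₃.row_of_ne (r := rFound) (by simp) rfl,
    hf₃.row_of_ne (r := rB₀) (by simp) rfl, hf₃.row_of_ne (r := rB₁) (by simp) rfl, hcount]
  rw [markVertex, hsrc] at hd
  rw [markVertex, hsrc, htgt] at h
  simp only [Finset.mem_singleton, forall_eq, exists_eq_left] at h
  rcases h with ⟨h₁, h₂, h₃, h₄⟩ | ⟨h₁, y, hy, hyv, L, hL, hw⟩
  · exact .inl ⟨h₁, h₂, h₃, _, ⟨d, hd, fun y hyv hy => h₄ y hyv hy, rfl⟩, rfl⟩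
  · refine .inr ⟨h₁, hw.isBase, fun s => add_right_cancel (hw.mult_eq s), ?_, v, d, hd, y, hy, hyv⟩
    exact (hw.moved.resolve_left fun h => hL h.1.symm).imp fun m h => ⟨v, h⟩

theorem scan_spec (hn : σ 0 0 = n) (hB : pair n (σ rB₀) (σ rB₁) = B)
    (hB₀ : ∀ m, (M m).IsBase (B m : Set (Fin n))) :
    (scan.den M F σ rFound 0 = 0 ∧ scan.den M F σ rB₀ = σ rB₀ ∧ scan.den M F σ rB₁ = σ rB₁ ∧
      IsPotential (ExchangeAdj M B) fun v : Fin n => scan.den M F σ rCount v) ∨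
    (scan.den M F σ rFound 0 = 1 ∧
      IsRotation M B (pair n (scan.den M F σ rB₀) (scan.den M F σ rB₁))) := by
  set σ₂ := (exchangeGraph.den M F σ).set rFound 0 0 with hσ₂
  have hf₁ := exchangeGraph_wf.frame (M := M) (F := F) σ
  have hrow : ∀ r ≠ rFound, σ₂ r = exchangeGraph.den M F σ r := fun r h =>
    Store.set_row_of_ne _ _ _ _ h
  have hn₂ : σ₂ 0 0 = n := by rw [hrow 0 (by simp), hf₁.ctr 0 rfl, hn]
  have key := loop_induction (M := M) (F := F) scan_wf.seq_right.seq_right (σ := σ₂) (fun i τ =>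
    (τ rFound 0 = 0 ∧ τ rB₀ = σ rB₀ ∧ τ rB₁ = σ rB₁ ∧
      ∀ v : Fin n, (v : ℕ) < i → IsAcyclicAt (ExchangeAdj M B) v (τ rCount v)) ∨
    (τ rFound 0 = 1 ∧ IsRotation M B (pair n (τ rB₀) (τ rB₁)))) ?_ ?_
  · rw [hn₂] at key
    exact key.imp_left fun ⟨h₁, h₂, h₃, h₄⟩ =>
      ⟨h₁, h₂, h₃, isPotential_of_isAcyclicAt fun v => h₄ v v.2⟩
  · simp [hσ₂, Store.set_apply, Store.set_row_of_ne, hf₁.row_of_ne (r := rB₀) (by simp) rfl,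
      hf₁.row_of_ne (r := rB₁) (by simp) rfl]
  · intro i hi τ hf hx ih
    lift i to Fin n using hn₂ ▸ hi
    simp only [ne_eq, OfNat.ofNat_ne_zero, not_false_eq_true, Store.set_row_of_ne, den_ite,
      den_skip, Expr.holds_not, Expr.holds_var]
    rcases ih with ⟨hfound, hτ₀, hτ₁, hacyc⟩ | ih
    · rw [if_pos (not_not.2 hfound)]
      refine (probe_spec (F := F) ((hf.ctr 0 rfl).trans hn₂) (by rw [hτ₀, hτ₁, hB]) hB₀
        (fun u w => ?_) hx).imp_left ?_
      · rw [hf.row_of_ne (by omega) (by simp [writes, probe_writes]), hrow _ (by omega),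
          exchangeGraph_spec (F := F) hn, hB]
      · rintro ⟨h₁, h₂, h₃, k, hk, hcount⟩
        refine ⟨h₁, h₂.trans hτ₀, h₃.trans hτ₁, fun v hv => ?_⟩
        rw [hcount, Function.update_apply]
        split_ifs with hvi
        · rwa [Fin.ext hvi]
        · exact hacyc v (by omega)
    · rw [if_neg (not_not.2 (by simp [ih.1]))]
      exact .inr ih

end Cmd

end Search

section Colour

variable {n : ℕ} {M : Fin 2 → Matroid (Fin n)} {F : Fin 2 → ExchangeProcedure n}
  {V : Finset (Fin n)} {φ γ : Fin n → Fin n} {σ τ : Store} {u v : Fin n}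

/-- The expression checking that the item numbered `e` lies in exactly one of the sets in the rows
`rB₀` and `rC₀`. -/
def Expr.differ (e : Expr) : Expr := .not (.eq (.not (.cell rB₀ e)) (.not (.cell rC₀ e)))

theorem Expr.holds_differ {e : Expr} (he : e.eval σ = v) :
    e.differ.Holds σ ↔ v ∈ symmDiff (supp n (σ rB₀)) (supp n (σ rC₀)) := by
  rw [Finset.mem_symmDiff, mem_supp, mem_supp, ← he]
  simp only [Expr.differ, Expr.holds_eq, Expr.not, Expr.eval_eq, Expr.eval_cell,
    Expr.eval_const]
  split_ifs <;> simp_all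

/-- The memory holds, for each element of `V = symmDiff B₀ C₀`, its partners in the matchings `φ`
and `γ`. -/
structure HasMates (V : Finset (Fin n)) (φ γ : Fin n → Fin n) (σ : Store) : Prop where
  symmDiff_eq : symmDiff (supp n (σ rB₀)) (supp n (σ rC₀)) = V
  mate₀ : ∀ s ∈ V, σ rMate₀ s = φ s
  mate₁ : ∀ s ∈ V, σ rMate₁ s = γ s

theorem HasMates.of_frame {c : Cmd} (h : HasMates V φ γ σ) (hf : Cmd.Frame c σ τ)
    (hc : [rB₀, rC₀, rMate₀, rMate₁].all fun r => !c.writes r) : HasMates V φ γ τ := by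
  simp only [List.all_cons, List.all_nil, Bool.and_true, Bool.and_eq_true, Bool.not_eq_true'] at hc
  obtain ⟨hB, hC, h₀, h₁⟩ := hc
  refine ⟨?_, ?_, ?_⟩
  · rw [hf.row_of_ne (by simp) hB, hf.row_of_ne (by simp) hC, h.symmDiff_eq]
  · rw [hf.row_of_ne (by simp) h₀]
    exact h.mate₀
  · rw [hf.row_of_ne (by simp) h₁]
    exact h.mate₁

/-- The colours in row `rColour`. -/
def colours (n : ℕ) (σ : Store) (s : Fin n) : ℕ := σ rColour s

theorem colours_congr (h : τ rColour = σ rColour) : colours n τ = colours n σ := by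
  funext s
  rw [colours, h, colours]

namespace Cmd

/-- Colour the current vertex and its partner, and go on. -/
def colourStep : Cmd :=
  ite (.and (.differ (.var rCur)) (.not (.cell rColour (.var rCur))))
    (set rColour (.var rCur) (.const 1) ;;
      set rColour (.cell rMate₀ (.var rCur)) (.const 2) ;;
      set rCur (.const 0) (.cell rMate₁ (.cell rMate₀ (.var rCur)))) skip

/-- Colour the alternating cycle through the vertex in counter `1`. -/
def colourCycle : Cmd := set rCur (.const 0) (.ctr 1) ;; loop 2 colourStep

/-- Colour all alternating cycles. -/
def colour : Cmd := loop 1 (set rColour (.ctr 1) (.const 0)) ;; loop 1 colourCycle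

theorem colourCycle_wf : colourCycle.WellFormed := by decide
theorem colour_wf : colour.WellFormed := by decide

theorem holds_colourStep (h : HasMates V φ γ σ) (hu : σ rCur 0 = u) :
    Expr.Holds σ (.and (.differ (.var rCur)) (.not (.cell rColour (.var rCur)))) ↔
      u ∈ V ∧ colours n σ u = 0 := by
  rw [Expr.holds_and, Expr.holds_differ (v := u) (by simpa using hu), h.symmDiff_eq]
  simp [hu, colours]

theorem colourStep_of_pos (h : HasMates V φ γ σ) (hφ : IsMatching V φ) (hcur : σ rCur 0 = u)
    (hu : u ∈ V) (h0 : colours n σ u = 0) :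
    colours n (colourStep.den M F σ)
        = Function.update (Function.update (colours n σ) u 1) (φ u) 2 ∧
      colourStep.den M F σ rCur 0 = γ (φ u) := by
  rw [colourStep, den_ite, if_pos ((holds_colourStep h hcur).2 ⟨hu, h0⟩)]
  constructor
  · funext s
    simp [colours, Store.set_row, hcur, h.mate₀ u hu, Function.update_apply, Fin.val_inj]
  · simp [Store.set_row, hcur, h.mate₀ u hu, h.mate₁ _ (hφ u hu).1]

theorem colourStep_of_neg (h : HasMates V φ γ σ) (hcur : σ rCur 0 = u)
    (hu : ¬ (u ∈ V ∧ colours n σ u = 0)) : colourStep.den M F σ = σ := by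
  rw [colourStep, den_ite, if_neg (mt (holds_colourStep h hcur).1 hu), den_skip]

/-- The invariant of the loop of `colourCycle`: unless the walk from `v` has arrived at a coloured
element, each of the `i` steps so far has coloured new elements. -/
def CycleInvariant (V : Finset (Fin n)) (φ γ : Fin n → Fin n) (v : Fin n) (c₀ : Fin n → ℕ) (i : ℕ)
    (τ : Store) : Prop :=
  ∃ u : Fin n, τ rCur 0 = u ∧ ColourWalk V φ γ v (colours n τ) u ∧
    (∀ s, c₀ s ≠ 0 → colours n τ s ≠ 0) ∧
    (colours n τ u ≠ 0 ∨ i ≤ (Finset.univ.filter (colours n τ · ≠ 0)).card)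

theorem CycleInvariant.step {c₀ : Fin n → ℕ} {i : ℕ} (hφ : IsMatching V φ) (hγ : IsMatching V γ)
    (h : HasMates V φ γ τ) (hi : CycleInvariant V φ γ v c₀ i τ) :
    CycleInvariant V φ γ v c₀ (i + 1) (colourStep.den M F τ) := by
  obtain ⟨u, hcur, hwalk, hmono, hcard⟩ := hi
  by_cases h0 : colours n τ u = 0
  · obtain ⟨hcol, hcur'⟩ := colourStep_of_pos (M := M) (F := F) h hφ hcur hwalk.mem h0
    have hmono' : ∀ s, colours n τ s ≠ 0 → colours n (colourStep.den M F τ) s ≠ 0 := fun s hs => by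
      rw [hcol]
      simp only [Function.update_apply]
      split_ifs <;> simp [hs]
    refine ⟨γ (φ u), hcur', hcol ▸ hwalk.step hφ hγ h0, fun s hs => hmono' s (hmono s hs), .inr ?_⟩
    refine (hcard.resolve_left (not_not.2 h0)).trans_lt (Finset.card_lt_card ?_)
    refine (Finset.ssubset_iff_of_subset fun s hs => ?_).2 ⟨u, ?_, by simpa using h0⟩
    · exact (Finset.mem_filter_univ s).2 (hmono' s ((Finset.mem_filter_univ s).1 hs))
    · simp only [Finset.mem_filter_univ, hcol, Function.update_apply]
      split_ifs <;> simp
  · rw [colourStep_of_neg h hcur fun h => h0 h.2]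
    exact ⟨u, hcur, hwalk, hmono, .inl h0⟩

theorem CycleInvariant.isColouring {c₀ : Fin n → ℕ} (h : CycleInvariant V φ γ v c₀ n τ) :
    IsColouring V φ (colours n τ) ∧ IsColouring V γ (colours n τ) ∧ colours n τ v ≠ 0 := by
  obtain ⟨u, -, hwalk, -, hcard⟩ := h
  have hu : colours n τ u ≠ 0 := hcard.elim id fun hcard => by
    have huniv := Finset.eq_univ_of_card _ (le_antisymm (Finset.card_le_univ _)
      ((Fintype.card_fin n).trans_le hcard))
    exact (Finset.mem_filter_univ u).1 (huniv ▸ Finset.mem_univ u)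
  obtain ⟨rfl, hγ⟩ := hwalk.ends.resolve_right fun h => hu h.1
  exact ⟨hwalk.isColouring, hγ, hu⟩

theorem colourCycle_spec (hn : σ 0 0 = n) (hv : σ 0 1 = v) (hφ : IsMatching V φ)
    (hγ : IsMatching V γ) (h : HasMates V φ γ σ) {c : Fin n → ℕ} (hc : colours n σ = c)
    (hcφ : IsColouring V φ c) (hcγ : IsColouring V γ c) {c' : Fin n → ℕ}
    (hc' : colours n (colourCycle.den M F σ) = c') :
    IsColouring V φ c' ∧ IsColouring V γ c' ∧ (∀ s, c s ≠ 0 → c' s ≠ 0) ∧ (v ∈ V → c' v ≠ 0) := by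
  have hf₀ : Frame colourCycle σ (σ.set rCur 0 v) :=
    ⟨fun r hr => Store.set_row_of_ne _ _ _ _ fun h => by
      simp [h, colourCycle, writes] at hr, by simp⟩
  have hden : colourCycle.den M F σ = (loop 2 colourStep).den M F (σ.set rCur 0 v) := by
    simp only [colourCycle, den_seq, den_set, Expr.eval_const, Expr.eval_ctr, hv]
  have hcur : σ.set rCur 0 v rCur 0 = v := by simp [Store.set_apply]
  have hcol : colours n (σ.set rCur 0 v) = c :=
    (colours_congr (Store.set_row_of_ne _ _ _ _ (by simp))).trans hc
  have hmates : ∀ τ, Frame (loop 2 colourStep) (σ.set rCur 0 v) τ → HasMates V φ γ τ :=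
    fun τ hf => (h.of_frame hf₀ rfl).of_frame hf rfl
  by_cases hvV : v ∈ V
  · have key := loop_induction (M := M) (F := F) colourCycle_wf.seq_right (σ := σ.set rCur 0 v)
      (CycleInvariant V φ γ v c) ⟨v, hcur, ?_, ?_, ?_⟩ fun i _ τ hf _ ih => ?_
    · rw [Store.set_row_of_ne _ _ _ _ (by simp), hn, ← hden] at key
      have ⟨_, _, _, hmono, _⟩ := key
      have hcolours := key.isColouring
      rw [hc'] at hmono hcolours
      exact ⟨hcolours.1, hcolours.2.1, hmono, fun _ => hcolours.2.2⟩
    · rw [colours_congr (Store.set_row_of_ne _ _ _ _ (by simp)), hcol]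
      exact ⟨hvV, hvV, hcφ, .inl ⟨rfl, hcγ⟩⟩
    · rw [colours_congr (Store.set_row_of_ne _ _ _ _ (by simp)), hcol]
      exact fun _ => id
    · exact .inr (Nat.zero_le _)
    · exact CycleInvariant.step hφ hγ (hmates τ hf) ih
  · have key := loop_induction (M := M) (F := F) colourCycle_wf.seq_right (σ := σ.set rCur 0 v)
      (fun _ τ => τ rCur 0 = v ∧ colours n τ = c) ⟨hcur, hcol⟩ fun i _ τ hf _ ih => ?_
    · rw [← hden, hc'] at key
      rw [key.2]
      exact ⟨hcφ, hcγ, fun _ => id, fun h => absurd h hvV⟩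
    · rw [colourStep_of_neg (hmates τ hf) ih.1 fun h => hvV h.1]
      exact ih

theorem colour_spec (hn : σ 0 0 = n) (hφ : IsMatching V φ) (hγ : IsMatching V γ)
    (h : HasMates V φ γ σ) {c : Fin n → ℕ} (hc : colours n (colour.den M F σ) = c) {s : Fin n}
    (hs : s ∈ V) : (c s = 1 ∨ c s = 2) ∧ c (φ s) ≠ c s ∧ c (γ s) ≠ c s := by
  set τ := (loop 1 (set rColour (.ctr 1) (.const 0))).den M F σ with hτ
  have hf₀ : Frame _ σ τ := colour_wf.seq_left.frame σ
  have hn' := (hf₀.ctr 0 rfl).trans hn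
  have hclear := loop_fill (M := M) (F := F) colour_wf.seq_left (σ := σ) (r := rColour) (by simp)
    (fun _ => 0) fun i _ τ _ hx _ => by simp [Store.set_row, hx]
  have key := loop_induction (M := M) (F := F) colour_wf.seq_right (σ := τ) (fun i τ =>
    IsColouring V φ (colours n τ) ∧ IsColouring V γ (colours n τ) ∧
      ∀ s ∈ V, (s : ℕ) < i → colours n τ s ≠ 0) ?_ ?_
  · rw [hn', show (loop 1 colourCycle).den M F τ = colour.den M F σ from rfl, hc] at key
    have := key.1 s hs
    have := key.2.1 s hs
    have := key.2.2 s hs s.2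
    omega
  · have hzero : ∀ s, colours n (τ.set 0 1 0) s = 0 := fun s => hclear s (hn ▸ s.2)
    simp [IsColouring, hzero]
  · intro i hi ρ hf hx ⟨ihφ, ihγ, ih⟩
    lift i to Fin n using hn' ▸ hi
    obtain ⟨h₁, h₂, h₃, h₄⟩ := colourCycle_spec (M := M) (F := F) ((hf.ctr 0 rfl).trans hn') hx hφ
      hγ ((h.of_frame hf₀ rfl).of_frame hf rfl) rfl ihφ ihγ rfl
    refine ⟨h₁, h₂, fun s hs hsi => ?_⟩
    rcases Nat.lt_succ_iff_lt_or_eq.1 hsi with hsi | hsi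
    · exact h₃ s (ih s hs hsi)
    · obtain rfl := Fin.ext hsi
      exact h₄ hs

end Cmd

end Colour

section Improve

variable {n : ℕ} {M : Fin 2 → Matroid (Fin n)} {F : Fin 2 → ExchangeProcedure n}
  {μ : Fin n → ℕ} {B C : Fin 2 → Finset (Fin n)} {σ τ : Store} {r r' t o : ℕ}

/-- The procedures `F` return exchange bijections of the matroids `M`. -/
def ComputesExchanges (M : Fin 2 → Matroid (Fin n)) (F : Fin 2 → ExchangeProcedure n) : Prop :=
  ∀ m, ∀ B C : Finset (Fin n), (M m).IsBase B → (M m).IsBase C →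
    IsExchangeBijection (M m) B C ((F m).map B C)

namespace Cmd

theorem den_exch_of_ne (m : Fin 2) (h : r ≠ t) : (exch m r' o t).den M F σ r = σ r := by
  funext b
  simp [den, Store.setRow, h]

theorem den_exch_self (m : Fin 2) (s : Fin n) :
    (exch m r r' t).den M F σ t s = (F m).map (supp n (σ r)) (supp n (σ r')) s := by
  simp [den, Store.setRow]

/-- Match the current element, if it belongs to row `r`, with its image in row `t`. -/
def mate (r t o : ℕ) : Cmd :=
  ite (.cell r (.ctr 1))
    (set o (.ctr 1) (.cell t (.ctr 1)) ;; set o (.cell t (.ctr 1)) (.ctr 1)) skip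

/-- Compute an exchange bijection from row `r` to row `r'` into row `t`, and into row `o` the
matching of the symmetric difference of the two rows that it defines. -/
def matching (m : Fin 2) (r r' t o : ℕ) : Cmd := exch m r r' t ;; loop 1 (mate r t o)

theorem mate_row (hto : t ≠ o) {i : Fin n} (hx : σ 0 1 = i) {f : Fin n → Fin n}
    (ho : o ≠ 0) (hf : ∀ s : Fin n, σ t s = f s) :
    (mate r t o).den M F σ o = if i ∈ supp n (σ r) then
      Function.update (Function.update (σ o) i (f i)) (f i) i else σ o := by
  have htr : σ.set o i (f i) t = σ t := Store.set_row_of_ne _ _ _ _ hto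
  have h0 : σ.set o i (f i) 0 = σ 0 := Store.set_row_of_ne _ _ _ _ ho.symm
  simp only [mate, den_ite, Expr.holds_cell, Expr.eval_ctr, hx, mem_supp, den_seq, den_set,
    Expr.eval_cell, hf, htr, h0, den_skip, Store.ite_apply, Store.set_row]

theorem loop_mate_spec (hr : r ≠ 0) (ht : t ≠ 0) (ho : o ≠ 0) (hro : r ≠ o) (hto : t ≠ o)
    (hn : σ 0 0 = n) {N : Matroid (Fin n)} {B C : Finset (Fin n)} {f : Fin n → Fin n}
    (hB : supp n (σ r) = B) (hfσ : ∀ s : Fin n, σ t s = f s)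
    (hf : IsExchangeBijection N (B : Set (Fin n)) (C : Set (Fin n)) f) :
    ∀ s ∈ B, s ∉ C → (loop 1 (mate r t o)).den M F σ o s = f s ∧
      (loop 1 (mate r t o)).den M F σ o (f s) = s := by
  have hwf : (loop 1 (mate r t o)).WellFormed := by
    simp [WellFormed, writes, nested, uses, mate, ho.symm]
  have key := loop_induction (M := M) (F := F) hwf (σ := σ) (fun i τ => ∀ s ∈ B, s ∉ C →
    (s : ℕ) < i → τ o s = f s ∧ τ o (f s) = s) (by simp) ?_
  · exact fun s hs hs' => key s hs hs' (by rw [hn]; exact s.2)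
  intro i hi τ hfr hx ih s hs hs' hsi
  lift i to Fin n using hn ▸ hi
  have hτr : τ r = σ r := hfr.row_of_ne hr (by simp [writes, mate, hro])
  have hτt : τ t = σ t := hfr.row_of_ne ht (by simp [writes, mate, hto])
  have hfs : f s ∉ B := hf.apply_notMem (by simpa using hs) (by simpa using hs')
  rw [Store.set_row_of_ne _ _ _ _ ho, mate_row hto hx ho fun s => by rw [hτt, hfσ], hτr, hB]
  rcases eq_or_ne s i with rfl | hsi'
  · have hne : s ≠ f s := fun h => hfs (h ▸ hs)
    simp [hs, Fin.val_inj, hne]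
  · obtain ⟨h₁, h₂⟩ := ih s hs hs' (lt_of_le_of_ne (Nat.lt_succ_iff.1 hsi) (Fin.val_ne_iff.2 hsi'))
    split_ifs with hi
    · have hsf : s ≠ f i := fun h => hs' (h ▸ hf.1.mapsTo hi)
      have hfi : f s ≠ i := fun h => hfs (h ▸ hi)
      have hff : f s ≠ f i := fun h => hsi' (hf.1.injOn hs hi h)
      simp only [Function.update_apply, Fin.val_inj, hsi', hsf, hfi, hff, if_false]
      exact ⟨h₁, h₂⟩
    · exact ⟨h₁, h₂⟩

theorem matching_spec (hr : r ≠ 0) (ht : t ≠ 0) (ho : o ≠ 0) (hrt : r ≠ t) (hro : r ≠ o)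
    (hto : t ≠ o) (hn : σ 0 0 = n) {m : Fin 2} {B C : Finset (Fin n)} (hB : supp n (σ r) = B)
    (hC : supp n (σ r') = C) (hf : IsExchangeBijection (M m) B C ((F m).map B C)) :
    ∃ φ, IsMatching (symmDiff B C) φ ∧
      (∀ s ∈ symmDiff B C, (matching m r r' t o).den M F σ o s = φ s) ∧
      ∀ s ∈ B, s ∉ C → φ s = (F m).map B C s := by
  obtain ⟨φ, hφ, hφf⟩ := hf.exists_isMatching
  have hspec := loop_mate_spec (M := M) (F := F) (σ := (exch m r r' t).den M F σ) hr ht ho hro hto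
    (by rw [den_exch_of_ne m ht.symm, hn]) (by rw [den_exch_of_ne m hrt, hB])
    (fun s => by rw [den_exch_self, hB, hC]) hf
  refine ⟨φ, hφ, fun s hs => ?_, fun s hs hs' => (hφf s hs hs').1⟩
  have mate_of_mem : ∀ s ∈ B, s ∉ C → (matching m r r' t o).den M F σ o s = φ s ∧
      (matching m r r' t o).den M F σ o (φ s) = s := fun s hs hs' => by
    rw [(hφf s hs hs').1]
    exact hspec s hs hs'
  rcases Finset.mem_symmDiff.1 hs with ⟨hsB, hsC⟩ | ⟨hsC, hsB⟩
  · exact (mate_of_mem s hsB hsC).1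
  · obtain ⟨b, hb, rfl⟩ := hf.1.surjOn hsC
    have hbC : b ∉ C := fun h => hsB (by rwa [hf.apply_eq_self hb (by simpa using h)])
    rw [(hφf b hb hbC).2, ← (hφf b hb hbC).1]
    exact (mate_of_mem b hb hbC).2

/-- Compute exchange bijections from the bases in the rows `rB₀` and `rB₁` to those in the rows
`rC₀` and `rC₁`, and the matchings that they define. -/
def mates : Cmd :=
  matching 0 rB₀ rC₀ rMap₀ rMate₀ ;; matching 1 rB₁ rC₁ rMap₁ rMate₁

theorem mates_wf : mates.WellFormed := by decide

theorem mates_safe (hB : pair n (σ rB₀) (σ rB₁) = B) (hC : pair n (σ rC₀) (σ rC₁) = C)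
    (hBb : ∀ m, (M m).IsBase (B m)) (hCb : ∀ m, (M m).IsBase (C m)) : mates.Safe M F σ := by
  subst hB hC
  have hf : Frame _ σ ((matching 0 rB₀ rC₀ rMap₀ rMate₀).den M F σ) := mates_wf.seq_left.frame σ
  refine ⟨⟨⟨hBb 0, hCb 0⟩, safe_of_noExch M F _ (by decide) _⟩, ⟨?_, ?_⟩,
    safe_of_noExch M F _ (by decide) _⟩
  · rw [rowSet_eq_supp, hf.row_of_ne (r := rB₁) (by simp) rfl]
    exact hBb 1
  · rw [rowSet_eq_supp, hf.row_of_ne (r := rC₁) (by simp) rfl]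
    exact hCb 1

theorem mates_spec (hn : σ 0 0 = n) (hB : pair n (σ rB₀) (σ rB₁) = B)
    (hC : pair n (σ rC₀) (σ rC₁) = C)
    (hf : ∀ m, IsExchangeBijection (M m) (B m) (C m) ((F m).map (B m) (C m)))
    (hV : symmDiff (B 1) (C 1) = symmDiff (B 0) (C 0)) :
    ∃ φ : Fin 2 → Fin n → Fin n, (∀ m, IsMatching (symmDiff (B 0) (C 0)) (φ m)) ∧
      HasMates (symmDiff (B 0) (C 0)) (φ 0) (φ 1) (mates.den M F σ) ∧
      ∀ m, ∀ s ∈ B m, s ∉ C m → φ m s = (F m).map (B m) (C m) s := by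
  set τ := (matching 0 rB₀ rC₀ rMap₀ rMate₀).den M F σ
  have hf₀ : Frame _ σ τ := mates_wf.seq_left.frame σ
  have hf₁ : Frame _ τ (mates.den M F σ) := mates_wf.seq_right.frame τ
  have hn' := (hf₀.ctr 0 rfl).trans hn
  have hB₁ : supp n (τ rB₁) = B 1 := by
    rw [hf₀.row_of_ne (by simp) rfl, ← hB, pair_one]
  have hC₁ : supp n (τ rC₁) = C 1 := by
    rw [hf₀.row_of_ne (by simp) rfl, ← hC, pair_one]
  obtain ⟨φ, hφ, hφτ, hφf⟩ := matching_spec (r := rB₀) (t := rMap₀) (o := rMate₀) (by simp)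
    (by simp) (by simp) (by simp) (by simp) (by simp) hn (congrFun hB 0) (congrFun hC 0) (hf 0)
  obtain ⟨γ, hγ, hγτ, hγf⟩ := matching_spec (r := rB₁) (t := rMap₁) (o := rMate₁) (by simp)
    (by simp) (by simp) (by simp) (by simp) (by simp) hn' hB₁ hC₁ (hf 1)
  rw [hV] at hγ hγτ
  refine ⟨![φ, γ], Fin.forall_fin_two.2 ⟨hφ, hγ⟩, ⟨?_, fun s hs => ?_, hγτ⟩,
    Fin.forall_fin_two.2 ⟨hφf, hγf⟩⟩
  · rw [hf₁.row_of_ne (r := rB₀) (by simp) rfl, hf₁.row_of_ne (r := rC₀) (by simp) rfl,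
      hf₀.row_of_ne (r := rB₀) (by simp) rfl, hf₀.row_of_ne (r := rC₀) (by simp) rfl,
      ← hB, ← hC, pair_zero, pair_zero]
  · rw [hf₁.row_of_ne (r := rMate₀) (by simp) rfl]
    exact hφτ s hs

/-- Replace each of the four sets, on the symmetric difference of the rows `rB₀` and `rC₀`, by the
elements of colour `1` or by those of colour `2`. -/
def recombine : Cmd :=
  loop 1 (ite (.differ (.ctr 1))
    (set rB₀ (.ctr 1) (.eq (.cell rColour (.ctr 1)) (.const 1)) ;;
      set rB₁ (.ctr 1) (.eq (.cell rColour (.ctr 1)) (.const 1)) ;;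
      set rC₀ (.ctr 1) (.eq (.cell rColour (.ctr 1)) (.const 2)) ;;
      set rC₁ (.ctr 1) (.eq (.cell rColour (.ctr 1)) (.const 2))) skip)

theorem recombine_wf : recombine.WellFormed := by decide

theorem recombine_row (hn : σ 0 0 = n) {V : Finset (Fin n)}
    (hV : symmDiff (supp n (σ rB₀)) (supp n (σ rC₀)) = V) {k : ℕ}
    (hr : (r = rB₀ ∨ r = rB₁) ∧ k = 1 ∨ (r = rC₀ ∨ r = rC₁) ∧ k = 2) (s : Fin n) :
    s ∈ supp n (recombine.den M F σ r) ↔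
      if s ∈ V then colours n σ s = k else s ∈ supp n (σ r) := by
  classical
  have key := loop_pointwise (M := M) (F := F) recombine_wf (σ := σ)
    (fun r => (r = rB₀ ∨ r = rB₁) ∨ (r = rC₀ ∨ r = rC₁))
    (by rintro r ((rfl | rfl) | (rfl | rfl)) <;> simp)
    (fun r i => if ∃ s ∈ V, (s : ℕ) = i then
      (if σ rColour i = (if r = rB₀ ∨ r = rB₁ then 1 else 2) then 1 else 0) else σ r i) ?_ r
      (by tauto) s
  · have hk : (if r = rB₀ ∨ r = rB₁ then 1 else 2) = k := by
      rcases hr with ⟨rfl | rfl, rfl⟩ | ⟨rfl | rfl, rfl⟩ <;> simp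
    rw [mem_supp, recombine, key, if_pos (by rw [hn]; exact s.2), hk]
    simp only [Fin.val_inj, exists_eq_right, mem_supp, colours]
    split_ifs <;> simp_all
  · intro i hi τ hf hx hτ r hr
    lift i to Fin n using hn ▸ hi
    have hcol : τ rColour = σ rColour := hf.row_of_ne (by simp) rfl
    have hd : (Expr.differ (.ctr 1)).Holds τ ↔ i ∈ V := by
      rw [Expr.holds_differ (v := i) (by simpa using hx), ← hV, Finset.mem_symmDiff,
        Finset.mem_symmDiff]
      simp only [mem_supp, hτ rB₀ (by simp) i, hτ rC₀ (by simp) i, lt_irrefl, if_false]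
    by_cases h : i ∈ V
    · rw [den_ite, if_pos (hd.2 h), if_pos ⟨i, h, rfl⟩]
      rcases hr with (rfl | rfl) | (rfl | rfl) <;> simp [Store.set_row, hx, hcol]
    · rw [den_ite, if_neg (mt hd.1 h), den_skip, if_neg (by simpa [Fin.val_inj] using h),
        ← (hτ r hr i).trans (if_neg (lt_irrefl _)), Function.update_eq_self]

theorem recombine_spec (hn : σ 0 0 = n) (hB : pair n (σ rB₀) (σ rB₁) = B)
    (hC : pair n (σ rC₀) (σ rC₁) = C) (m : Fin 2) (s : Fin n) :
    (s ∈ pair n (recombine.den M F σ rB₀) (recombine.den M F σ rB₁) m ↔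
        if s ∈ symmDiff (B 0) (C 0) then colours n σ s = 1 else s ∈ B m) ∧
      (s ∈ pair n (recombine.den M F σ rC₀) (recombine.den M F σ rC₁) m ↔
        if s ∈ symmDiff (B 0) (C 0) then colours n σ s = 2 else s ∈ C m) := by
  subst hB hC
  fin_cases m
  · exact ⟨recombine_row hn rfl (by simp) s, recombine_row hn rfl (by simp) s⟩
  · exact ⟨recombine_row hn rfl (by simp) s, recombine_row hn rfl (by simp) s⟩

/-- Recombine the bases `B₀`, `B₁`, `C₀`, `C₁` in the rows `rB₀`, `rB₁`, `rC₀`, `rC₁` along exchange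
bijections such that `B₀` and `B₁` agree where `B₀` and `C₀` differ, and so do `C₀` and `C₁`. -/
def improve : Cmd := mates ;; colour ;; recombine

theorem improve_spec (hF : ComputesExchanges M F) (hn : σ 0 0 = n)
    (hB : pair n (σ rB₀) (σ rB₁) = B) (hC : pair n (σ rC₀) (σ rC₁) = C)
    (hBb : ∀ m, (M m).IsBase (B m)) (hCb : ∀ m, (M m).IsBase (C m))
    (hμ : ∀ s, mult B s + mult C s = 2 * μ s) (hτ : improve.den M F σ = τ) :
    improve.Safe M F σ ∧
      IsBalanced M μ (pair n (τ rB₀) (τ rB₁)) (pair n (τ rC₀) (τ rC₁)) ∧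
      symmDiff (supp n (τ rB₀)) (supp n (τ rC₀)) = symmDiff (B 0) (C 0) := by
  have hf m := hF m (B m) (C m) (hBb m) (hCb m)
  have hV := symmDiff_eq_symmDiff_zero hμ
  obtain ⟨φ, hφ, hmates, hφf⟩ := mates_spec hn hB hC hf (hV 1)
  set ρ := colour.den M F (mates.den M F σ)
  have hf₀ : Frame _ σ (mates.den M F σ) := mates_wf.frame σ
  have hf₁ : Frame _ (mates.den M F σ) ρ := colour_wf.frame _
  have hn₀ := (hf₀.ctr 0 rfl).trans hn
  have hcol := fun s => colour_spec hn₀ (hφ 0) (hφ 1) hmates (c := colours n ρ) rfl (s := s)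
  have hBρ : pair n (ρ rB₀) (ρ rB₁) = B := by
    rw [hf₁.row_of_ne (r := rB₀) (by simp) rfl, hf₁.row_of_ne (r := rB₁) (by simp) rfl,
      hf₀.row_of_ne (r := rB₀) (by simp) rfl, hf₀.row_of_ne (r := rB₁) (by simp) rfl, hB]
  have hCρ : pair n (ρ rC₀) (ρ rC₁) = C := by
    rw [hf₁.row_of_ne (r := rC₀) (by simp) rfl, hf₁.row_of_ne (r := rC₁) (by simp) rfl,
      hf₀.row_of_ne (r := rC₀) (by simp) rfl, hf₀.row_of_ne (r := rC₁) (by simp) rfl, hC]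
  have hrec := recombine_spec (M := M) (F := F) ((hf₁.ctr 0 rfl).trans hn₀) hBρ hCρ
  rw [show recombine.den M F ρ = τ from hτ] at hrec
  refine ⟨⟨mates_safe hB hC hBb hCb, safe_of_noExch M F _ (by decide) _⟩,
    isBalanced_of_colouring hμ hf (fun s hs => (hcol s hs).1) (fun m s hs hs' => ?_)
      (fun m s => (hrec m s).1) fun m s => (hrec m s).2, ?_⟩
  · have hsV : s ∈ symmDiff (B 0) (C 0) := hV m ▸ Finset.mem_symmDiff.2 (.inl ⟨hs, hs'⟩)
    rw [← hφf m s hs hs']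
    exact (Fin.forall_fin_two.2 (hcol s hsV).2 :
      ∀ m, colours n ρ (φ m s) ≠ colours n ρ s) m
  · ext s
    have hs₁ := (hrec 0 s).1
    have hs₂ := (hrec 0 s).2
    have hs := hcol s
    rw [pair_zero] at hs₁ hs₂
    rw [Finset.mem_symmDiff, hs₁, hs₂]
    split_ifs with h
    · have := (hs h).1
      simp only [h, iff_true]
      omega
    · rw [Finset.mem_symmDiff]

end Cmd

end Improve

section Pricing

variable {n : ℕ} {M : Fin 2 → Matroid (Fin n)} {F : Fin 2 → ExchangeProcedure n}
  {μ : Fin n → ℕ} {B C B₁ C₁ : Fin 2 → Finset (Fin n)} {σ : Store}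

namespace Cmd

/-- Recombine the four bases, if the exchange graph has a closed walk. -/
def refineStep : Cmd := scan ;; ite (.var rFound) improve skip

theorem refineStep_spec (hF : ComputesExchanges M F) (hn : σ 0 0 = n)
    (hB : pair n (σ rB₀) (σ rB₁) = B) (hC : pair n (σ rC₀) (σ rC₁) = C) (h : IsBalanced M μ B C)
    (hB₁ : pair n (refineStep.den M F σ rB₀) (refineStep.den M F σ rB₁) = B₁)
    (hC₁ : pair n (refineStep.den M F σ rC₀) (refineStep.den M F σ rC₁) = C₁) :
    refineStep.Safe M F σ ∧ IsBalanced M μ B₁ C₁ ∧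
      (IsPotential (ExchangeAdj M B₁) (fun v : Fin n => refineStep.den M F σ rCount v) ∨
        (symmDiff (B 0) (C 0)).card < (symmDiff (B₁ 0) (C₁ 0)).card ∧
          ∀ k, ¬ IsPotential (ExchangeAdj M B) k) := by
  have hf : Frame scan σ (scan.den M F σ) := scan_wf.frame σ
  have hscan := scan_spec (M := M) (F := F) hn hB h.isBase_left
  have hden : refineStep.den M F σ = (ite (.var rFound) improve skip).den M F (scan.den M F σ) :=
    rfl
  rw [hden, den_ite, Expr.holds_var] at hB₁ hC₁ ⊢
  set τ := scan.den M F σ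
  have hCτ : pair n (τ rC₀) (τ rC₁) = C := by
    rw [hf.row_of_ne (r := rC₀) (by simp) rfl, hf.row_of_ne (r := rC₁) (by simp) rfl, hC]
  have safe_of : (τ rFound 0 ≠ 0 → improve.Safe M F τ) → refineStep.Safe M F σ := fun h' =>
    ⟨safe_of_noExch M F _ (by decide) _, h', fun _ => trivial⟩
  rcases hscan with ⟨hfound, h₀, h₁, hk⟩ | ⟨hfound, hrot⟩
  · rw [if_neg (not_not.2 hfound)] at hB₁ hC₁ ⊢
    rw [den_skip, h₀, h₁, hB] at hB₁
    rw [den_skip, hCτ] at hC₁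
    subst hB₁ hC₁
    exact ⟨safe_of fun h' => absurd hfound h', h, .inl hk⟩
  · rw [if_pos (by simp [hfound])] at hB₁ hC₁ ⊢
    obtain ⟨hsafe, hbal, hV⟩ := improve_spec hF ((hf.ctr 0 rfl).trans hn) rfl hCτ hrot.isBase
      h.isBase_right (fun s => by rw [hrot.mult_eq, h.mult_add_mult]) rfl
    rw [hB₁, hC₁] at hbal
    refine ⟨safe_of fun _ => hsafe, hbal, .inr ⟨?_, fun k hk => hk.not_isRotation hrot⟩⟩
    obtain ⟨m, x, hx, hx'⟩ := hrot.moved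
    rw [← hB₁, ← hC₁, pair_zero, pair_zero, hV]
    exact h.card_symmDiff_lt hrot.mult_eq hx hx'

/-- Recombine the four bases until the exchange graph has no closed walk. -/
def refineAll : Cmd := loop 7 refineStep ;; refineStep

theorem refineAll_wf : refineAll.WellFormed := by decide

theorem refineAll_spec (hF : ComputesExchanges M F) (hn : σ 0 0 = n)
    (h : IsBalanced M μ (pair n (σ rB₀) (σ rB₁)) (pair n (σ rC₀) (σ rC₁)))
    (hB : pair n (refineAll.den M F σ rB₀) (refineAll.den M F σ rB₁) = B)
    (hC : pair n (refineAll.den M F σ rC₀) (refineAll.den M F σ rC₁) = C) :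
    refineAll.Safe M F σ ∧ IsBalanced M μ B C ∧
      IsPotential (ExchangeAdj M B) (fun v : Fin n => refineAll.den M F σ rCount v) := by
  have key := loop_induction_safe (M := M) (F := F) refineAll_wf.seq_left (σ := σ) (fun i τ =>
    IsBalanced M μ (pair n (τ rB₀) (τ rB₁)) (pair n (τ rC₀) (τ rC₁)) ∧
      ((∃ k, IsPotential (ExchangeAdj M (pair n (τ rB₀) (τ rB₁))) k) ∨
        i ≤ (symmDiff (supp n (τ rB₀)) (supp n (τ rC₀))).card)) ⟨h, .inr (Nat.zero_le _)⟩ ?_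
  · obtain ⟨hsafe, hbal, hk⟩ := key
    have hf : Frame _ σ ((loop 7 refineStep).den M F σ) := refineAll_wf.seq_left.frame σ
    obtain ⟨hsafe', hbal', hk'⟩ := refineStep_spec hF ((hf.ctr 0 rfl).trans hn) rfl rfl hbal hB hC
    refine ⟨⟨hsafe, hsafe'⟩, hbal', hk'.resolve_right fun ⟨hlt, hno⟩ => ?_⟩
    refine hk.elim (fun ⟨k, hk⟩ => hno k hk) fun hle => ?_
    rw [hn] at hle
    exact ((hle.trans_lt hlt).trans_le (Finset.card_le_univ _)).ne (Fintype.card_fin n).symm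
  · intro i _ τ hf _ ⟨hbal, hk⟩
    obtain ⟨hsafe, hbal', hk'⟩ := refineStep_spec hF ((hf.ctr 0 rfl).trans hn) rfl rfl hbal rfl rfl
    exact ⟨hsafe, hbal', hk'.imp (fun hk' => ⟨_, hk'⟩) fun ⟨hlt, hno⟩ =>
      hk.elim (fun ⟨k, hk⟩ => absurd hk (hno k)) fun hle => hle.trans_lt hlt⟩

/-- Duplicate the two bases, and mark the elements outside of them. -/
def duplicate : Cmd :=
  loop 1 (set rC₀ (.ctr 1) (.cell rB₀ (.ctr 1)) ;; set rC₁ (.ctr 1) (.cell rB₁ (.ctr 1)) ;;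
    set rUncov (.ctr 1) (.not (.add (.cell rB₀ (.ctr 1)) (.cell rB₁ (.ctr 1)))))

theorem duplicate_wf : duplicate.WellFormed := by decide

theorem duplicate_spec (hn : σ 0 0 = n) (hB : pair n (σ rB₀) (σ rB₁) = B) :
    pair n (duplicate.den M F σ rC₀) (duplicate.den M F σ rC₁) = B ∧
      ∀ s : Fin n, duplicate.den M F σ rUncov s = 0 ↔ s ∈ Finset.univ.biUnion B := by
  have key := loop_pointwise (M := M) (F := F) duplicate_wf (σ := σ)
    (fun r => r = rC₀ ∨ r = rC₁ ∨ r = rUncov) (by rintro r (rfl | rfl | rfl) <;> simp)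
    (fun r i => if r = rC₀ then σ rB₀ i else if r = rC₁ then σ rB₁ i else
      if σ rB₀ i + σ rB₁ i = 0 then 1 else 0) ?_
  · have hrow : ∀ r, (r = rC₀ ∨ r = rC₁ ∨ r = rUncov) → ∀ j < n, duplicate.den M F σ r j = _ :=
      fun r hr j hj => (key r hr j).trans (if_pos (hn ▸ hj))
    refine ⟨?_, fun s => ?_⟩
    · rw [← hB, pair, supp_congr (hrow rC₀ (by simp)), supp_congr (hrow rC₁ (by simp))]
      rfl
    · rw [hrow rUncov (by simp) s s.2]
      simp [← hB, or_iff_not_imp_left]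
  · intro i _ τ hf hx _ r hr
    have h₀ : τ rB₀ = σ rB₀ := hf.row_of_ne (by simp) rfl
    have h₁ : τ rB₁ = σ rB₁ := hf.row_of_ne (by simp) rfl
    rcases hr with rfl | rfl | rfl <;> simp [Store.set_row, hx, h₀, h₁, Expr.not, Expr.eval_eq]

/-- Write the prices: `2` on the marked elements, and a fraction with denominator `n + 1` on the
others. -/
def output : Cmd :=
  loop 1 (ite (.cell rUncov (.ctr 1))
    (set 1 (.ctr 1) (.add (.add (.ctr 0) (.const 1)) (.add (.ctr 0) (.const 1))))
    (set 1 (.ctr 1) (.cell rCount (.ctr 1))) ;; set 2 (.ctr 1) (.add (.ctr 0) (.const 1)))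

theorem output_wf : output.WellFormed := by decide

theorem output_spec (hn : σ 0 0 = n) (s : Fin n) :
    output.den M F σ 2 s ≠ 0 ∧
      (output.den M F σ).outputPrice n s =
        if σ rUncov s = 0 then (σ rCount s : ℝ) / (n + 1) else 2 := by
  have key := loop_pointwise (M := M) (F := F) output_wf (σ := σ)
    (fun r => r = 1 ∨ r = 2) (by rintro r (rfl | rfl) <;> simp)
    (fun r i => if r = 1 then (if σ rUncov i = 0 then σ rCount i else (n + 1) + (n + 1))
      else n + 1) ?_
  · have h₁ : output.den M F σ 1 s = if σ rUncov s = 0 then σ rCount s else (n + 1) + (n + 1) :=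
      (key 1 (by simp) s).trans (if_pos (hn ▸ s.2))
    have h₂ : output.den M F σ 2 s = n + 1 := (key 2 (by simp) s).trans (if_pos (hn ▸ s.2))
    rw [Store.outputPrice, h₁, h₂]
    have : (n + 1 : ℝ) ≠ 0 := by positivity
    refine ⟨n.succ_ne_zero, ?_⟩
    split_ifs
    · push_cast
      rfl
    · push_cast
      field_simp
      norm_num
  · intro i _ τ hf hx _ r hr
    have h₀ : τ rUncov = σ rUncov := hf.row_of_ne (by simp) rfl
    have h₁ : τ rCount = σ rCount := hf.row_of_ne (by simp) rfl
    have h₂ : τ 0 0 = n := (hf.ctr 0 rfl).trans hn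
    by_cases a : σ rUncov i = 0 <;>
      rcases hr with rfl | rfl <;> simp [Store.set_row, hx, h₀, h₁, h₂, a]

/-- Compute the prices. -/
def pricing : Cmd := cover ;; duplicate ;; refineAll ;; output

theorem pricing_wf : pricing.WellFormed := by decide

theorem pricing_spec (hF : ComputesExchanges M F) :
    pricing.Safe M F (Store.init n) ∧
      (∀ s : Fin n, pricing.den M F (Store.init n) 2 s ≠ 0) ∧
      ∃ B C U, IsPricingCertificate M B C U ((pricing.den M F (Store.init n)).outputPrice n) := by
  have hn : Store.init n 0 0 = n := by simp [Store.init]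
  obtain ⟨hb, hA⟩ := cover_spec (M := M) (F := F) hn (by simp [Store.init]) (by simp [Store.init])
    rfl
  have hf₁ : Frame _ (Store.init n) (cover.den M F (Store.init n)) := cover_wf.frame _
  have hn₁ := (hf₁.ctr 0 rfl).trans hn
  set σ₁ := cover.den M F (Store.init n)
  set A := pair n (σ₁ rB₀) (σ₁ rB₁) with hA₁
  obtain ⟨hC₂, hU⟩ := duplicate_spec (M := M) (F := F) hn₁ hA₁.symm
  have hf₂ : Frame _ σ₁ (duplicate.den M F σ₁) := duplicate_wf.frame _
  have hn₂ := (hf₂.ctr 0 rfl).trans hn₁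
  have hB₂ : pair n (duplicate.den M F σ₁ rB₀) (duplicate.den M F σ₁ rB₁) = A := by
    rw [hf₂.row_of_ne (r := rB₀) (by simp) rfl, hf₂.row_of_ne (r := rB₁) (by simp) rfl]
  set σ₂ := duplicate.den M F σ₁
  obtain ⟨hsafe, hbal, hk⟩ := refineAll_spec (μ := mult A) hF hn₂
    (hB₂.symm ▸ hC₂.symm ▸ IsBalanced.refl hb) rfl rfl
  have hf₃ : Frame _ σ₂ (refineAll.den M F σ₂) := refineAll_wf.frame _
  have hout := output_spec (M := M) (F := F) ((hf₃.ctr 0 rfl).trans hn₂)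
  rw [hf₃.row_of_ne (r := rUncov) (by simp) rfl] at hout
  have safe_of (c : Cmd) (hc : c.noExch = true) (τ : Store) := safe_of_noExch M F c hc τ
  refine ⟨⟨safe_of _ (by decide) _, safe_of _ (by decide) _, hsafe, safe_of _ (by decide) _⟩,
    fun s => (hout s).1, _, _, _, hbal.isPricingCertificate hA hk (fun s hs => ?_) fun s hs => ?_⟩
  · rw [Fintype.card_fin]
    exact (hout s).2.trans (if_pos ((hU s).2 hs))
  · exact (hout s).2.trans (if_neg (hs ∘ (hU s).1))

end Cmd

theorem polyTimePricing_of_certificate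
    {Pre : ∀ n : ℕ, Matroid (Fin n) → Matroid (Fin n) → Prop}
    {Good : ∀ n : ℕ, Matroid (Fin n) → Matroid (Fin n) → (Fin n → ℝ) → Prop}
    (h : ∀ (n : ℕ) (M : Fin 2 → Matroid (Fin n)), (∀ m, (M m).E = Set.univ) →
      (∀ m, StronglyBaseOrderable (M m)) → Pre n (M 0) (M 1) →
      ∀ B C U p, IsPricingCertificate M B C U p → Good n (M 0) (M 1) p) :
    PolyTimePricing Pre Good := by
  refine ⟨Cmd.pricing.compile, fun q => ⟨Cmd.pricing.timeBound q, ?_⟩⟩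
  intro n M F hE hM hF hpre
  obtain ⟨hsafe, hden, B, C, U, hcert⟩ :=
    Cmd.pricing_spec fun m B B' hB hB' => (hF m B B' hB hB').1
  obtain ⟨t, hexec, ht⟩ := Cmd.exec_compile Cmd.pricing_wf hF (by simp [Store.init]) hsafe
  exact ⟨t, _, hexec, ht, hden, h n M hE hM hpre B C U _ hcert⟩

theorem polyTimePricing_base : PolyTimePricing (fun _ M₁ M₂ => ComplementaryBases M₁ M₂)
    (fun _ M₁ M₂ p => IsBasePricing M₁ M₂ p) :=
  polyTimePricing_of_certificate fun _ _ hE hM hpre _ _ _ _ h =>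
    h.isBasePricing ((hE 0).trans (hE 1).symm) hM hpre

theorem polyTimePricing_rank : PolyTimePricing (fun _ _ _ => True)
    (fun _ M₁ M₂ p => IsRankPricing M₁ M₂ p) :=
  polyTimePricing_of_certificate fun _ _ hE hM _ _ _ _ _ h =>
    h.isRankPricing ((hE 0).trans (hE 1).symm) hM

end Pricing

section Comap

variable {α β : Type*} {f : β → α} {M : Matroid α}

theorem isBase_comap_iff (hf : f.Injective) (hE : Set.range f = M.E) {B : Set β} :
    (M.comap f).IsBase B ↔ M.IsBase (f '' B) := by
  rw [Matroid.comap_isBase_iff, ← hE, Set.preimage_range, Set.image_univ, hE,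
    Matroid.isBasis_ground_iff]
  simp [hf.injOn]

theorem StronglyBaseOrderable.comap (hM : StronglyBaseOrderable M) (hf : f.Injective)
    (hE : Set.range f = M.E) : StronglyBaseOrderable (M.comap f) := by
  intro B B' hB hB'
  rw [isBase_comap_iff hf hE] at hB hB'
  obtain ⟨g, hg, hgX⟩ := hM _ _ hB hB'
  have hlift : ∀ i ∈ B, ∃ j ∈ B', f j = g (f i) := fun i hi => hg.mapsTo ⟨i, hi, rfl⟩
  classical
  let h : β → β := fun i => if hi : i ∈ B then (hlift i hi).choose else i
  have hh : ∀ i ∈ B, h i ∈ B' ∧ f (h i) = g (f i) := fun i hi => by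
    simpa only [h, dif_pos hi] using (hlift i hi).choose_spec
  refine ⟨h, ⟨fun i hi => (hh i hi).1, fun i hi j hj hij => ?_, fun j hj => ?_⟩, fun X hX => ?_⟩
  · refine hf (hg.injOn ⟨i, hi, rfl⟩ ⟨j, hj, rfl⟩ ?_)
    rw [← (hh i hi).2, ← (hh j hj).2, hij]
  · obtain ⟨-, ⟨i, hi, rfl⟩, hij⟩ := hg.surjOn ⟨j, hj, rfl⟩
    exact ⟨i, hi, hf ((hh i hi).2.trans hij)⟩
  · rw [isBase_comap_iff hf hE, Set.image_union, Set.image_sdiff hf]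
    convert hgX (f '' X) (Set.image_mono hX) using 2
    rw [Set.image_image, Set.image_image]
    exact Set.image_congr fun i hi => (hh i (hX hi)).2

theorem rank_comap_preimage (hf : f.Injective) (hE : Set.range f = M.E) (X : Finset α) :
    rank (M.comap f) (X.preimage f hf.injOn) = rank M X := by
  rw [rank, rank, Matroid.eRk_comap, Finset.coe_preimage, Set.image_preimage_eq_inter_range, hE,
    Matroid.eRk_inter_ground]

theorem ExchangeArc.of_map {e : β ↪ α} {B : Finset β} {i : β} {w : α}
    (h : ExchangeArc M (B.map e : Finset α) (e i) w) :
    ∃ j, e j = w ∧ ExchangeArc (M.comap e) B i j := by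
  obtain ⟨hi, hw, hI⟩ := h
  obtain ⟨j, hj, rfl⟩ := Finset.mem_map.1 (Finset.mem_coe.1 hw)
  refine ⟨j, rfl, by simpa using hi, hj, Matroid.comap_indep_iff.2 ⟨?_, e.injective.injOn⟩⟩
  rwa [Set.image_sdiff e.injective, Set.image_insert_eq, Set.image_singleton, ← Finset.coe_map]

end Comap

section Transport

variable {α β : Type*} [DecidableEq α] [DecidableEq β] {M : Fin 2 → Matroid α}

theorem IsPricingCertificate.map {e : β ↪ α} (hE : ∀ m, Set.range e = (M m).E)
    {B C : Fin 2 → Finset β} {U : Finset β} {q : β → ℝ}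
    (h : IsPricingCertificate (fun m => (M m).comap e) B C U q) :
    IsPricingCertificate M (fun m => (B m).map e) (fun m => (C m).map e) (U.map e)
      (Function.extend e q 2) := by
  have hext : ∀ i, Function.extend e q 2 (e i) = q i := e.injective.extend_apply q 2
  refine ⟨fun m => ?_, fun m => ?_, fun m => ?_, fun X Y hXY => ?_, fun s hs => ?_, fun s hs => ?_,
    fun s hs => ?_, fun m u hu w huw => ?_⟩
  · simpa only [Finset.coe_map, isBase_comap_iff e.injective (hE m)] using h.isBase_left m
  · simpa only [Finset.coe_map, isBase_comap_iff e.injective (hE m)] using h.isBase_right m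
  · rw [← Finset.map_union, h.union_eq]
  · rw [← rank_comap_preimage e.injective (hE 0), ← rank_comap_preimage e.injective (hE 1),
      Finset.card_map]
    refine h.welfare_le _ _ (Finset.disjoint_left.2 fun i hi hi' => ?_)
    exact Finset.disjoint_left.1 hXY (Finset.mem_preimage.1 hi) (Finset.mem_preimage.1 hi')
  · obtain ⟨i, hi, rfl⟩ := Finset.mem_map.1 hs
    exact hext i ▸ h.pos i hi
  · obtain ⟨i, hi, rfl⟩ := Finset.mem_map.1 hs
    exact hext i ▸ h.lt_one i hi
  · by_cases hse : ∃ i, e i = s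
    · obtain ⟨i, rfl⟩ := hse
      exact hext i ▸ h.one_lt i fun hi => hs (Finset.mem_map_of_mem e hi)
    · rw [Function.extend_apply' _ _ _ hse]
      exact one_lt_two
  · obtain ⟨i, hi, rfl⟩ := Finset.mem_map.1 hu
    obtain ⟨j, rfl, hij⟩ := huw.of_map
    rw [hext, hext]
    exact h.lt_of_exchangeArc m i hi j hij

theorem exists_computesExchanges {n : ℕ} {M : Fin 2 → Matroid (Fin n)}
    (hM : ∀ m, StronglyBaseOrderable (M m)) : ∃ F, ComputesExchanges M F := by
  have hex : ∀ (m : Fin 2) (B C : Finset (Fin n)), (M m).IsBase B → (M m).IsBase C →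
      ∃ f, IsExchangeBijection (M m) B C f := fun m B C => hM m B C
  have : Nonempty (Fin n → Fin n) := ⟨id⟩
  choose! f hf using hex
  exact ⟨fun m => ⟨f m, 0⟩, hf⟩

theorem exists_isPricingCertificate (hfin : (M 0).Finite) (hE : (M 0).E = (M 1).E)
    (hM : ∀ m, StronglyBaseOrderable (M m)) : ∃ B C U p, IsPricingCertificate M B C U p := by
  obtain ⟨n, e, he⟩ := hfin.ground_finite.fin_embedding
  have hrange : ∀ m, Set.range e = (M m).E := Fin.forall_fin_two.2 ⟨he, he.trans hE⟩
  obtain ⟨F, hF⟩ := exists_computesExchanges fun m => (hM m).comap e.injective (hrange m)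
  obtain ⟨-, -, B, C, U, h⟩ := Cmd.pricing_spec hF
  exact ⟨_, _, _, _, h.map hrange⟩

end Transport

end MatroidPricing

open MatroidPricing in
theorem theorem2 :
    (∀ (α : Type*) (M₁ M₂ : Matroid α), M₁.Finite → M₂.Finite → M₁.E = M₂.E →
      StronglyBaseOrderable M₁ → StronglyBaseOrderable M₂ →
        (ComplementaryBases M₁ M₂ → ∃ p : α → ℝ, IsBasePricing M₁ M₂ p) ∧
        (∃ p : α → ℝ, IsRankPricing M₁ M₂ p)) ∧
    PolyTimePricing (fun _ M₁ M₂ => ComplementaryBases M₁ M₂)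
      (fun _ M₁ M₂ p => IsBasePricing M₁ M₂ p) ∧
    PolyTimePricing (fun _ _ _ => True)
      (fun _ M₁ M₂ p => IsRankPricing M₁ M₂ p) := by
  classical
  refine ⟨fun α M₁ M₂ hfin _ hE hM₁ hM₂ => ?_, polyTimePricing_base, polyTimePricing_rank⟩
  have hM : ∀ m, StronglyBaseOrderable (![M₁, M₂] m) := Fin.forall_fin_two.2 ⟨hM₁, hM₂⟩
  obtain ⟨B, C, U, p, h⟩ := exists_isPricingCertificate (M := ![M₁, M₂]) hfin hE hM
  exact ⟨fun hc => ⟨p, h.isBasePricing hE hM hc⟩, p, h.isRankPricing hE hM⟩
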